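/- Work in the theory $\mathbf{SPOT}$ in the language $\{\in,\mathrm{st}\}$ ($\mathrm{st}(x)$ reads "$x$ is standard"), whose axioms are those of ZF (Separation and Replacement for $\in$-formulas, no choice) together with - Transfer: $\forall^{\mathrm{st}}x\,\phi(x)\Rightarrow\forall x\,\phi(x)$ for every $\in$-formula $\phi$ with standard parameters; - Nontriviality: some $\nu\in\mathbb N$ differs from every standard $n\in\mathbb N$; - Standard Part: for every $A\subseteq\mathbb N$ there is a standard $B\subseteq\mathbb N$ with the same standard elements as $A$. (Equivalently: the result holds in every model of $\mathbf{SPOT}$.) For reals write $x\approx y$ if $|x-y|\le 1/n$ for all standard $n\in\mathbb N$, $n\ne0$; a real $x$ is limited if $|x|\le n$ for some standard $n\in\mathbb N$, and unlimited otherwise. Let $F:[0,\infty)\times\mathbb R\to\mathbb R$ be standard and continuous. A global solution of $$(\ast)\qquad y(0)=0,\quad y'(x)=F(x,y(x))$$ is a function $y:[0,a)\to\mathbb R$, $0<a\le\infty$, that satisfies $(\ast)$ on $[0,a)$ (one-sided derivative at $0$) and cannot be continued to a solution on any $[0,a')$ with $a'>a$. Fix any positive unlimited integer $N$, put $h=1/N$,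 and fix any reals $x_0\ge 0$, $x_0\approx0$, and $y_0\approx0$; let $x_k=x_0+kh$. An infinitesimal perturbation is a sequence $\varepsilon=\langle\varepsilon_k\mid k<N^2\rangle$ of reals with $\varepsilon_k\approx0$ for every $k<N^2$. Given $\varepsilon$, define $$y_{k+1}=y_k+(F(x_k,y_k)+\varepsilon_k)\,h\qquad(k<N^2),$$ and let $Y$ be the standard subset of $[0,\infty)\times\mathbb R$ whose standard elements are exactly the standard pairs $\langle x,v\rangle$ such that $x\approx x_k$ and $v\approx y_k$ for some $k<N^2$. Let $y_\varepsilon$ be the restriction of $Y$ to the largest interval $[0,a)$, $0<a\le\infty$, on which $Y$ is an everywhere defined, single-valued and continuous function. **Theorem.** For every standard global solution $y$ of $(\ast)$ there is an infinitesimal perturbation $\varepsilon$ such that $y=y_\varepsilon$. Conversely, for every infinitesimal perturbation $\varepsilon$ the function $y_\varepsilon$ exists, is unique, and is a standard global solution of $(\ast)$. So the standard global solutions of $(\ast)$ are exactly the functions $y_\varepsilon$. -/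

import Mathlib

universe u

/-! ### The language of set theory and the theory SPOT -/

/-- The only non-logical symbol of the `∈`-language. -/
inductive MemSymbol : ℕ → Type
  | mem : MemSymbol 2

/-- The first-order language with one binary relation symbol `∈`. -/
def memLanguage : FirstOrder.Language.{0, 0} := ⟨fun _ => Empty, MemSymbol⟩

/-- A structure for the `st`-`∈`-language: a universe of "sets" with a binary membership
predicate and a unary predicate "standard". -/
class StMemStructure (M : Type u) where
  Mem : M → M → Prop
  St : M → Prop

open StMemStructure

infix:50 " ∈ₘ " => StMemStructure.Mem

/-- The reduct to the `∈`-language. Formulas of `memLanguage` are the `∈`-formulas: they do not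
mention the predicate `St`. -/
instance memStructure (M : Type u) [StMemStructure M] : memLanguage.Structure M where
  funMap := fun f _ => Empty.elim f
  RelMap := fun {_} r => match r with
    | MemSymbol.mem => fun v => v 0 ∈ₘ v 1

section SetTheory

variable {M : Type u} [StMemStructure M]

/-- `w` contains the empty set and is closed under `x ↦ x ∪ {x}`. -/
def IsInductive (w : M) : Prop :=
  (∀ e, (∀ z, ¬ z ∈ₘ e) → e ∈ₘ w) ∧
    ∀ x, x ∈ₘ w → ∀ s, (∀ z, z ∈ₘ s ↔ (z ∈ₘ x ∨ z = x)) → s ∈ₘ w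

/-- `w` is the set of natural numbers, i.e. the least inductive set. -/
def IsOmega (w : M) : Prop :=
  IsInductive w ∧ ∀ v, IsInductive v → ∀ x, x ∈ₘ w → x ∈ₘ v

/-- `p` is the Kuratowski ordered pair `{{a}, {a, b}}`. -/
def IsPair (p a b : M) : Prop :=
  ∀ z, z ∈ₘ p ↔ ((∀ w, w ∈ₘ z ↔ w = a) ∨ (∀ w, w ∈ₘ z ↔ (w = a ∨ w = b)))

/-- The ordered pair `⟨x, v⟩` belongs to `f`; for a function `f`, this is `f(x) = v`. -/
def AppRel (f x v : M) : Prop := ∃ p, IsPair p x v ∧ p ∈ₘ f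

/-- The triple `⟨⟨x, y⟩, v⟩` belongs to `f`; for a function `f`, this is `f(x, y) = v`. -/
def AppRel₂ (f x y v : M) : Prop := ∃ q, IsPair q x y ∧ AppRel f q v

end SetTheory

/-- `M` is a model of the theory SPOT: the axioms of ZF (Separation and Replacement for
`∈`-formulas with arbitrary parameters), Transfer, Nontriviality and Standard Part.
Sets and relations that are `Set.Definable` over a set `A` of parameters are those given by an
`∈`-formula with parameters from `A`. -/
class SPOT (M : Type u) extends StMemStructure M where
  extensionality : ∀ a b : M, (∀ z, z ∈ₘ a ↔ z ∈ₘ b) → a = b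
  pairing : ∀ a b : M, ∃ c, ∀ z, z ∈ₘ c ↔ (z = a ∨ z = b)
  union : ∀ a : M, ∃ c, ∀ z, z ∈ₘ c ↔ ∃ y, y ∈ₘ a ∧ z ∈ₘ y
  powerset : ∀ a : M, ∃ c, ∀ z, z ∈ₘ c ↔ ∀ y, y ∈ₘ z → y ∈ₘ a
  infinity : ∃ w : M, IsInductive w
  foundation : ∀ a : M, (∃ x, x ∈ₘ a) → ∃ x, x ∈ₘ a ∧ ∀ y, ¬ (y ∈ₘ x ∧ y ∈ₘ a)
  separation : ∀ P : Set M, (Set.univ : Set M).Definable₁ memLanguage P →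
    ∀ a : M, ∃ b, ∀ x, x ∈ₘ b ↔ (x ∈ₘ a ∧ x ∈ P)
  replacement : ∀ Q : Set (M × M), (Set.univ : Set M).Definable₂ memLanguage Q →
    ∀ a : M, (∀ x, x ∈ₘ a → ∃! y, (x, y) ∈ Q) → ∃ b, ∀ y, y ∈ₘ b ↔ ∃ x, x ∈ₘ a ∧ (x, y) ∈ Q
  transfer : ∀ P : Set M, {x : M | St x}.Definable₁ memLanguage P →
    (∀ x, St x → x ∈ P) → ∀ x, x ∈ P
  nontriviality : ∀ w : M, IsOmega w → ∃ ν, ν ∈ₘ w ∧ ∀ n, n ∈ₘ w → St n → n ≠ ν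
  standardPart : ∀ w : M, IsOmega w → ∀ A, (∀ n, n ∈ₘ A → n ∈ₘ w) →
    ∃ B, St B ∧ (∀ n, n ∈ₘ B → n ∈ₘ w) ∧ ∀ n, n ∈ₘ w → St n → (n ∈ₘ B ↔ n ∈ₘ A)

/-! ### The real numbers of a model -/

/-- A standard complete ordered field inside a model `M` of SPOT, i.e. the set `ℝ` of real numbers
of `M` (unique up to a unique standard isomorphism): `carrier` is an element of `M`, addition,
multiplication and the order are given by elements of `M`, and the ordered field axioms hold.
Completeness concerns subsets that are elements of `M`. -/
structure RealField (M : Type u) [SPOT M] where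
  carrier : M
  add : M
  mul : M
  lt : M
  st_carrier : St carrier
  st_add : St add
  st_mul : St mul
  st_lt : St lt
  field : Field {x : M // x ∈ₘ carrier}
  linearOrder : LinearOrder {x : M // x ∈ₘ carrier}
  isStrictOrderedRing : IsStrictOrderedRing {x : M // x ∈ₘ carrier}
  rel_add : ∀ x y z : {x : M // x ∈ₘ carrier}, AppRel₂ add x.1 y.1 z.1 ↔ x + y = z
  rel_mul : ∀ x y z : {x : M // x ∈ₘ carrier}, AppRel₂ mul x.1 y.1 z.1 ↔ x * y = z
  rel_lt : ∀ x y : {x : M // x ∈ₘ carrier}, AppRel lt x.1 y.1 ↔ x < y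
  complete : ∀ s : M, (∃ x : {x : M // x ∈ₘ carrier}, x.1 ∈ₘ s) →
    (∃ b : {x : M // x ∈ₘ carrier}, ∀ x : {x : M // x ∈ₘ carrier}, x.1 ∈ₘ s → x ≤ b) →
    ∃ c : {x : M // x ∈ₘ carrier}, IsLUB {x : {x : M // x ∈ₘ carrier} | x.1 ∈ₘ s} c

namespace RealField

variable {M : Type u} [SPOT M] (R : RealField M)

/-- The type of real numbers of the model. -/
abbrev K : Type u := {x : M // x ∈ₘ R.carrier}

instance instField : Field R.K := R.field
instance instLinearOrder : LinearOrder R.K := R.linearOrder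
instance instIsStrictOrderedRing : IsStrictOrderedRing R.K := R.isStrictOrderedRing

/-- `x` is a natural number of the model: it lies in every set of the model that contains `0` and
is closed under `z ↦ z + 1`. -/
def IsNat (x : R.K) : Prop :=
  ∀ s : M, (0 : R.K).1 ∈ₘ s → (∀ z : R.K, z.1 ∈ₘ s → (z + 1).1 ∈ₘ s) → x.1 ∈ₘ s

/-- `x ≈ y`: `|x - y| ≤ 1 / n` for all standard natural numbers `n ≠ 0`. -/
def Near (x y : R.K) : Prop :=
  ∀ n : R.K, R.IsNat n → St n.1 → n ≠ 0 → |x - y| ≤ 1 / n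

/-- `|x| ≤ n` for some standard natural number `n`. -/
def Limited (x : R.K) : Prop :=
  ∃ n : R.K, R.IsNat n ∧ St n.1 ∧ |x| ≤ n

/-- The interval `[0, a)`, where `a` is a real number or `⊤ = ∞`. -/
def Ico0 (a : WithTop R.K) : Set R.K := {x | 0 ≤ x ∧ (x : WithTop R.K) < a}

/-- The set `f` of the model is (the graph of) a function from `D` to the reals. -/
def IsFunOn (f : M) (D : Set R.K) : Prop :=
  (∀ p, p ∈ₘ f → ∃ x ∈ D, ∃ v : R.K, IsPair p x.1 v.1) ∧
    ∀ x ∈ D, ∃! v : R.K, AppRel f x.1 v.1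

/-- The set `F` of the model is a continuous function from `[0, ∞) × ℝ` to `ℝ`. -/
def IsContinuousRHS (F : M) : Prop :=
  (∀ p, p ∈ₘ F → ∃ x y v : R.K, 0 ≤ x ∧ ∃ q, IsPair q x.1 y.1 ∧ IsPair p q v.1) ∧
  (∀ x y : R.K, 0 ≤ x → ∃! v : R.K, AppRel₂ F x.1 y.1 v.1) ∧
  ∀ x y v : R.K, 0 ≤ x → AppRel₂ F x.1 y.1 v.1 → ∀ e : R.K, 0 < e → ∃ δ : R.K, 0 < δ ∧
    ∀ x' y' v' : R.K, 0 ≤ x' → AppRel₂ F x'.1 y'.1 v'.1 → |x' - x| < δ → |y' - y| < δ → |v' - v| < e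

/-- `y` is a solution on `[0, a)` of `y(0) = 0`, `y'(x) = F(x, y(x))` (one-sided derivative
at `0`). -/
def IsSolution (F : M) (a : WithTop R.K) (y : M) : Prop :=
  R.IsFunOn y (R.Ico0 a) ∧ AppRel y (0 : R.K).1 (0 : R.K).1 ∧
  ∀ x ∈ R.Ico0 a, ∀ v d : R.K, AppRel y x.1 v.1 → AppRel₂ F x.1 v.1 d.1 →
    ∀ e : R.K, 0 < e → ∃ δ : R.K, 0 < δ ∧
      ∀ z ∈ R.Ico0 a, ∀ w : R.K, AppRel y z.1 w.1 → |z - x| < δ →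
        |w - v - d * (z - x)| ≤ e * |z - x|

/-- `y` is a global solution: a solution on some `[0, a)`, `0 < a ≤ ∞`, that cannot be continued
to a solution on any `[0, a')` with `a' > a`. -/
def IsGlobalSolution (F y : M) : Prop :=
  ∃ a : WithTop R.K, 0 < a ∧ R.IsSolution F a y ∧
    ∀ a' : WithTop R.K, a < a' → ∀ z : M, R.IsSolution F a' z → ¬ ∀ p, p ∈ₘ y → p ∈ₘ z

/-- `ep` is an infinitesimal perturbation: a sequence `⟨ε_k | k < N²⟩` with all `ε_k ≈ 0`. -/
def IsPerturbation (N : R.K) (ep : M) : Prop :=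
  R.IsFunOn ep {k | R.IsNat k ∧ k < N ^ 2} ∧
    ∀ k e : R.K, AppRel ep k.1 e.1 → R.Near e 0

/-- `u = ⟨y_k | k ≤ N²⟩` is the perturbed Euler sequence with `h = 1 / N`, `x_k = x₀ + k h`:
`u` starts at `y₀` and `y_{k+1} = y_k + (F(x_k, y_k) + ε_k) h` for `k < N²`. -/
def IsEuler (F : M) (N x₀ y₀ : R.K) (ep u : M) : Prop :=
  R.IsFunOn u {k | R.IsNat k ∧ k ≤ N ^ 2} ∧ AppRel u (0 : R.K).1 y₀.1 ∧
  ∀ k : R.K, R.IsNat k → k < N ^ 2 → ∀ v e d : R.K, AppRel u k.1 v.1 → AppRel ep k.1 e.1 →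
    AppRel₂ F (x₀ + k * (1 / N)).1 v.1 d.1 → AppRel u (k + 1).1 (v + (d + e) * (1 / N)).1

/-- `Y` is the shadow of the sequence `u`: the standard subset of `[0, ∞) × ℝ` whose standard
elements are the standard `⟨x, v⟩` with `x ≈ x_k` and `v ≈ y_k` for some `k < N²`. -/
def IsShadow (N x₀ : R.K) (u Y : M) : Prop :=
  St Y ∧ (∀ p, p ∈ₘ Y → ∃ x v : R.K, 0 ≤ x ∧ IsPair p x.1 v.1) ∧
  ∀ x v : R.K, St x.1 → St v.1 → 0 ≤ x →
    (AppRel Y x.1 v.1 ↔ ∃ k t : R.K, R.IsNat k ∧ k < N ^ 2 ∧ AppRel u k.1 t.1 ∧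
      R.Near x (x₀ + k * (1 / N)) ∧ R.Near v t)

/-- On `D`, the relation `Y` is an everywhere defined, single-valued, continuous function. -/
def IsContinuousFunOn (Y : M) (D : Set R.K) : Prop :=
  (∀ x ∈ D, ∃! v : R.K, AppRel Y x.1 v.1) ∧
  ∀ x ∈ D, ∀ v : R.K, AppRel Y x.1 v.1 → ∀ e : R.K, 0 < e → ∃ δ : R.K, 0 < δ ∧
    ∀ x' ∈ D, ∀ v' : R.K, AppRel Y x'.1 v'.1 → |x' - x| < δ → |v' - v| < e

/-- `y = y_ε`: `y` is the restriction of the shadow `Y` of the perturbed Euler sequence to the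
largest interval `[0, a)`, `0 < a ≤ ∞`, on which `Y` is a continuous function. -/
def IsPerturbedSolution (F : M) (N x₀ y₀ : R.K) (ep y : M) : Prop :=
  ∃ u Y : M, R.IsEuler F N x₀ y₀ ep u ∧ R.IsShadow N x₀ u Y ∧
    ∃ a : WithTop R.K, 0 < a ∧ R.IsContinuousFunOn Y (R.Ico0 a) ∧
      (∀ b : WithTop R.K, a < b → ¬ R.IsContinuousFunOn Y (R.Ico0 b)) ∧
      ∀ p, p ∈ₘ y ↔ (p ∈ₘ Y ∧ ∃ x ∈ R.Ico0 a, ∃ v : R.K, IsPair p x.1 v.1)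

end RealField

/-! From perturbations to solutions. Near a standard point `(x, v)` the standard function `F`
differs from `m = F(x, v)` by less than any prescribed standard `e`. An Euler sequence that enters a
small enough standard box therefore has slopes within `e` of `m` until its time leaves the box
(`IsEuler.box`). Taking shadows and applying Transfer turns this into a property of the standard set
`Y` in which neither `st` nor infinitesimals occur, namely `IsFunnel`: `Y` has only the value `0` at
`0`, and from each of its points near `(x, v)` it continues for a while as a single-valued function
with slopes within `e` of `F(x, v)`.

From there on the argument is ordinary analysis. Past any of its points a funnel is locally a
Lipschitz function, so it has a maximal interval of continuity, and its restriction to that interval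
solves the equation. If some solution continued this restriction beyond a finite end `c`, then `Y`
would contain points close to a point over `c`, and the funnel property would carry `Y` past `c` as
a continuous function (`IsFunnel.extend`), contradicting maximality.

From solutions to perturbations. Given a standard solution `y`, let `ε_k` be the error that makes
the Euler sequence equal to `y(x_k) + c` exactly, where `c = y₀ - y(x₀)` is infinitesimal. The mean
value inequality bounds this error by any standard `e` at mesh points that are not too large and not
too close to the end of the domain (`IsSolution.quotient_bound`). Overspill (`exists_infinitesimal`)
replaces `e` by an infinitesimal `t`; where the restrictions for `t` fail, `ε_k` is set to `0`. The
shadow then agrees with `y` on the domain of `y`, and since `y` is global this domain is the maximal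
interval of `Y`.

Groundwork. Separation and Transfer apply only to `∈`-formulas, so each property used with them is
shown definable with suitable parameters, by instance search. Standard Part speaks only of subsets
of `ω`. Coding rationals and rational boxes by natural numbers extends it to standard parts of
limited reals (`Limited.exists_near`) and to shadows of internal planar relations (`exists_shadow`).
-/

set_option synthInstance.maxSize 1000000000
set_option synthInstance.maxHeartbeats 4000000
set_option maxHeartbeats 4000000

/-! ### Definable predicates and functions on finite products -/

section Definability

variable {M : Type u} [StMemStructure M]

/-- Types whose elements are coded by finite tuples of elements of `M`. -/
class Enc (M : outParam (Type u)) (α : Type u) where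
  Idx : Type
  fin : Finite Idx
  enc : α → Idx → M
  inj : Function.Injective enc

attribute [instance] Enc.fin

/-- The set of codes of elements of `α` is definable over `A`. -/
class EncRange (A : Set M) (α : Type u) [Enc M α] : Prop where
  out : A.Definable memLanguage {v : Enc.Idx α → M | ∃ a : α, Enc.enc a = v}

/-- `P` is given by an `∈`-formula with parameters from `A`. -/
class DefPred (A : Set M) {α : Type u} [Enc M α] (P : α → Prop) : Prop where
  out : A.Definable memLanguage {v : Enc.Idx α → M | ∃ a : α, Enc.enc a = v ∧ P a}

instance Enc.self (M : Type u) [StMemStructure M] : Enc M M where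
  Idx := Fin 1
  fin := inferInstance
  enc a := fun _ => a
  inj _ _ h := congrFun h 0

instance Enc.prod (α β : Type u) [Enc M α] [Enc M β] : Enc M (α × β) where
  Idx := Enc.Idx α ⊕ Enc.Idx β
  fin := inferInstance
  enc p := Sum.elim (Enc.enc p.1) (Enc.enc p.2)
  inj p q h := by
    have h1 : Enc.enc p.1 = Enc.enc q.1 := by
      funext i; exact congrFun h (Sum.inl i)
    have h2 : Enc.enc p.2 = Enc.enc q.2 := by
      funext i; exact congrFun h (Sum.inr i)
    exact Prod.ext (Enc.inj h1) (Enc.inj h2)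

instance EncRange.self (A : Set M) : EncRange A M where
  out := by
    convert! Set.definable_univ (L := memLanguage) (A := A) using 1
    ext v
    simp only [Set.mem_ofPred_eq, Set.mem_univ, iff_true]
    exact ⟨v (0 : Fin 1), funext fun i => congrArg v (Subsingleton.elim (α := Fin 1) _ _)⟩

instance EncRange.prod (A : Set M) (α β : Type u) [Enc M α] [Enc M β] [EncRange A α]
    [EncRange A β] : EncRange A (α × β) where
  out := by
    convert! ((EncRange.out (A := A) (α := α)).preimage_comp
      (Sum.inl : _ → Enc.Idx (α × β))).inter
      ((EncRange.out (A := A) (α := β)).preimage_comp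
      (Sum.inr : _ → Enc.Idx (α × β))) using 1
    ext v
    constructor
    · rintro ⟨⟨a, b⟩, rfl⟩
      exact ⟨⟨a, rfl⟩, ⟨b, rfl⟩⟩
    · rintro ⟨⟨a, ha⟩, ⟨b, hb⟩⟩
      refine ⟨(a, b), ?_⟩
      funext i
      rcases i with i | i
      · exact congrFun ha i
      · exact congrFun hb i

namespace DefPred

variable {A : Set M} {α β γ : Type u} [Enc M α] [Enc M β] [Enc M γ]

theorem and {P Q : α → Prop} (hP : DefPred A P) (hQ : DefPred A Q) :
    DefPred A (fun a => P a ∧ Q a) where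
  out := by
    convert! hP.out.inter hQ.out using 1
    ext v
    constructor
    · rintro ⟨a, h, h1, h2⟩
      exact ⟨⟨a, h, h1⟩, ⟨a, h, h2⟩⟩
    · rintro ⟨⟨a, rfl, h1⟩, ⟨b, h, h2⟩⟩
      obtain rfl := Enc.inj h
      exact ⟨b, rfl, h1, h2⟩

theorem not [EncRange A α] {P : α → Prop} (hP : DefPred A P) : DefPred A (fun a => ¬ P a) where
  out := by
    convert! (EncRange.out (A := A) (α := α)).inter hP.out.compl using 1
    ext v
    constructor
    · rintro ⟨a, rfl, h⟩
      refine ⟨⟨a, rfl⟩, ?_⟩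
      rintro ⟨b, hb, h'⟩
      obtain rfl := Enc.inj hb
      exact h h'
    · rintro ⟨⟨a, rfl⟩, h⟩
      exact ⟨a, rfl, fun h' => h ⟨a, rfl, h'⟩⟩

theorem congr {P Q : α → Prop} (hP : DefPred A P) (h : ∀ a, Q a ↔ P a) : DefPred A Q := by
  rwa [show Q = P from funext fun a => propext (h a)]

theorem or [EncRange A α] {P Q : α → Prop} (hP : DefPred A P) (hQ : DefPred A Q) :
    DefPred A (fun a => P a ∨ Q a) :=
  (hP.not.and hQ.not).not.congr fun a => by tauto

theorem imp [EncRange A α] {P Q : α → Prop} (hP : DefPred A P) (hQ : DefPred A Q) :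
    DefPred A (fun a => P a → Q a) :=
  (hP.and hQ.not).not.congr fun a => by tauto

theorem iff [EncRange A α] {P Q : α → Prop} (hP : DefPred A P) (hQ : DefPred A Q) :
    DefPred A (fun a => P a ↔ Q a) :=
  ((hP.imp hQ).and (hQ.imp hP)).congr fun a => by tauto

theorem const [EncRange A α] (p : Prop) : DefPred A (fun _ : α => p) := by
  by_cases hp : p
  · refine ⟨?_⟩
    convert! EncRange.out (A := A) (α := α) using 1
    ext v
    simp [hp]
  · refine ⟨?_⟩
    convert! Set.definable_empty (L := memLanguage) (A := A) using 1
    ext v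
    simp [hp]

/-- On codes, an existential quantifier is the projection that forgets the coordinates of `β`.
Definability survives because index types are finite. -/
theorem ex {P : α → β → Prop} (hP : DefPred A (fun p : α × β => P p.1 p.2)) :
    DefPred A (fun a => ∃ b, P a b) where
  out := by
    convert! hP.out.image_comp (Sum.inl : Enc.Idx α → Enc.Idx (α × β)) using 1
    ext v
    constructor
    · rintro ⟨a, rfl, b, h⟩
      exact ⟨_, ⟨(a, b), rfl, h⟩, rfl⟩
    · rintro ⟨_, ⟨⟨a, b⟩, rfl, h⟩, rfl⟩
      exact ⟨a, rfl, b, h⟩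

theorem all [EncRange A α] [EncRange A β] {P : α → β → Prop}
    (hP : DefPred A (fun p : α × β => P p.1 p.2)) : DefPred A (fun a => ∀ b, P a b) :=
  (ex (P := fun a b => ¬ P a b) hP.not).not.congr fun a => by simp

/-- Substitution of maps that only rearrange coordinates. -/
theorem comp_coord [EncRange A α] {P : β → Prop} (hP : DefPred A P) (f : α → β)
    (σ : Enc.Idx β → Enc.Idx α) (hf : ∀ a i, Enc.enc (f a) i = Enc.enc a (σ i)) :
    DefPred A (fun a => P (f a)) where
  out := by
    convert! (EncRange.out (A := A) (α := α)).inter (hP.out.preimage_comp σ) using 1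
    ext v
    constructor
    · rintro ⟨a, rfl, h⟩
      exact ⟨⟨a, rfl⟩, ⟨f a, funext fun i => hf a i, h⟩⟩
    · rintro ⟨⟨a, rfl⟩, ⟨b, hb, h⟩⟩
      refine ⟨a, rfl, ?_⟩
      have : Enc.enc (f a) = Enc.enc b := by
        rw [hb]; exact funext fun i => hf a i
      rwa [Enc.inj this]

theorem eq_diag [EncRange A α] : DefPred A (fun p : α × α => p.1 = p.2) where
  out := by
    have h : A.Definable memLanguage
        (⋂ i, {v : Enc.Idx (α × α) → M | v (Sum.inl i) = v (Sum.inr i)}) := by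
      refine Set.definable_iInter_of_finite fun i => ?_
      exact ⟨(FirstOrder.Language.var (Sum.inl i)).equal (FirstOrder.Language.var (Sum.inr i)),
        by ext; simp⟩
    convert! (EncRange.out (A := A) (α := α × α)).inter h using 1
    ext v
    simp only [Set.mem_ofPred_eq, Set.mem_inter_iff, Set.mem_iInter]
    constructor
    · rintro ⟨⟨a, b⟩, rfl, h⟩
      obtain rfl : a = b := h
      exact ⟨⟨_, rfl⟩, fun i => rfl⟩
    · rintro ⟨⟨⟨a, b⟩, rfl⟩, h⟩
      exact ⟨_, rfl, Enc.inj (funext h)⟩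

theorem mem_pair : DefPred A (fun p : M × M => p.1 ∈ₘ p.2) where
  out := by
    refine ⟨FirstOrder.Language.Relations.formula₂
      ((FirstOrder.Language.lhomWithConstants memLanguage A).onRelation
        (show memLanguage.Relations 2 from MemSymbol.mem))
      (FirstOrder.Language.var (Sum.inl (0 : Fin 1)))
          (FirstOrder.Language.var (Sum.inr (0 : Fin 1))), ?_⟩
    ext v
    simp only [Set.mem_ofPred_eq]
    have key : ∀ a b : M, FirstOrder.Language.Structure.RelMap (L := memLanguage)
      (M := M) MemSymbol.mem ![a, b] ↔ a ∈ₘ b := fun a b => Iff.rfl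
    have : (∃ a : M × M, Enc.enc a = v ∧ a.1 ∈ₘ a.2) ↔ v (Sum.inl (0 : Fin 1))
        ∈ₘ v (Sum.inr (0 : Fin 1)) := by
      constructor
      · rintro ⟨⟨a, b⟩, rfl, h⟩
        exact h
      · intro h
        refine ⟨(v (Sum.inl (0 : Fin 1)), v (Sum.inr (0 : Fin 1))), ?_, h⟩
        funext i
        rcases i with i | i <;>
            exact congrArg v (congrArg _ (Subsingleton.elim (α := Fin 1) _ _))
    rw [this, ← key]
    rw [FirstOrder.Language.Formula.realize_rel₂]
    exact iff_of_eq (FirstOrder.Language.LHom.IsExpansionOn.map_onRelation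
      (ϕ := FirstOrder.Language.lhomWithConstants memLanguage A) MemSymbol.mem
      ![v (Sum.inl (0 : Fin 1)), v (Sum.inr (0 : Fin 1))]).symm

end DefPred

/-- The graph of `f` is given by an `∈`-formula with parameters from `A`. -/
class DefFun (A : Set M) {α β : Type u} [Enc M α] [Enc M β] (f : α → β) : Prop where
  out : DefPred A (fun p : α × β => f p.1 = p.2)

/-- All coordinates of `a` are in `A`. -/
class Par (A : Set M) {α : Type u} [Enc M α] (a : α) : Prop where
  out : ∀ i, Enc.enc a i ∈ A

theorem Par.defPred_eq {A : Set M} {α : Type u} [Enc M α] (c : α) [h : Par A c] :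
    DefPred A (fun a : α => a = c) where
  out := by
    have h : A.Definable memLanguage
        (⋂ i, {v : Enc.Idx α → M | v i = Enc.enc c i}) := by
      refine Set.definable_iInter_of_finite fun i => ?_
      refine ⟨(FirstOrder.Language.var i).equal
        (FirstOrder.Language.con memLanguage (⟨_, h.out i⟩ : A)).term, ?_⟩
      ext; simp
    convert! h using 1
    ext v
    simp only [Set.mem_ofPred_eq, Set.mem_iInter]
    constructor
    · rintro ⟨a, rfl, rfl⟩ i
      rfl
    · intro h
      exact ⟨c, funext fun i => (h i).symm, rfl⟩

/-! ### Composition of definable maps -/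

section comp

variable {A : Set M} {α β γ : Type u} [Enc M α] [Enc M β] [Enc M γ]
  [EncRange A α] [EncRange A β] [EncRange A γ]

theorem DefPred.comp_snd {P : β → Prop} (hP : DefPred A P) :
    DefPred A (fun p : α × β => P p.2) :=
  hP.comp_coord (fun p : α × β => p.2) Sum.inr fun _ _ => rfl

/-- The language has no function symbols, so substituting `f` means quantifying over a point of its
graph. -/
theorem DefPred.comp {P : β → Prop} (hP : DefPred A P) {f : α → β} (hf : DefFun A f) :
    DefPred A (fun a => P (f a)) :=
  (DefPred.ex (P := fun a b => f a = b ∧ P b) (hf.out.and hP.comp_snd)).congr fun a => by simp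

theorem DefFun.of_coord (f : α → β)
    (σ : Enc.Idx β → Enc.Idx α) (hf : ∀ a i, Enc.enc (f a) i = Enc.enc a (σ i)) :
    DefFun A f where
  out := (DefPred.eq_diag (A := A) (α := β)).comp_coord (fun p : α × β => (f p.1, p.2))
    (Sum.elim (Sum.inl ∘ σ) Sum.inr) (by
      rintro ⟨a, b⟩ (i | i)
      · exact hf a i
      · rfl)

theorem DefFun.prod {f : α → β} {g : α → γ} (hf : DefFun A f) (hg : DefFun A g) :
    DefFun A (fun a => (f a, g a)) where
  out := by
    have h1 : DefPred A (fun p : α × β × γ => f p.1 = p.2.1) :=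
      hf.out.comp_coord (fun p : α × β × γ => (p.1, p.2.1))
        (Sum.elim Sum.inl (Sum.inr ∘ Sum.inl)) (by rintro ⟨a, b, c⟩ (i | i) <;> rfl)
    have h2 : DefPred A (fun p : α × β × γ => g p.1 = p.2.2) :=
      hg.out.comp_coord (fun p : α × β × γ => (p.1, p.2.2))
        (Sum.elim Sum.inl (Sum.inr ∘ Sum.inr)) (by rintro ⟨a, b, c⟩ (i | i) <;> rfl)
    exact (h1.and h2).congr fun p => by simp [Prod.ext_iff]

theorem DefFun.comp {g : β → γ} (hg : DefFun A g) {f : α → β} (hf : DefFun A f) :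
    DefFun A (fun a => g (f a)) where
  out := by
    have hf' : DefFun A (fun p : α × γ => f p.1) :=
      ⟨hf.out.comp_coord (fun p : (α × γ) × β => (p.1.1, p.2))
        (Sum.elim (Sum.inl ∘ Sum.inl) Sum.inr) (by rintro ⟨⟨a, b⟩, c⟩ (i | i) <;> rfl)⟩
    exact hg.out.comp (hf'.prod (DefFun.of_coord (fun p : α × γ => p.2) Sum.inr fun _ _ => rfl))

end comp

/-! Instances, so that definability is established by unification. -/

section instances

variable {A : Set M} {α β γ : Type u} [Enc M α] [Enc M β] [Enc M γ]
  [EncRange A α] [EncRange A β] [EncRange A γ]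

instance DefFun.instId : DefFun A (no_index (fun a : α => a)) :=
  DefFun.of_coord _ (fun i => i) fun _ _ => rfl

instance (priority := 2000) DefFun.instConst (c : β) [Par A c] : DefFun A (fun _ : α => c) where
  out := (Par.defPred_eq (A := A) c).comp_snd.congr fun _ => eq_comm

instance DefFun.instFst' : DefFun A (no_index (Prod.fst : α × β → α)) :=
  DefFun.of_coord _ Sum.inl fun _ _ => rfl

instance DefFun.instSnd' : DefFun A (no_index (Prod.snd : α × β → β)) :=
  DefFun.of_coord _ Sum.inr fun _ _ => rfl

instance DefFun.instFst (f : α → β × γ) [hf : DefFun A f] :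
    DefFun A (no_index (fun a => (f a).1)) :=
  DefFun.instFst'.comp hf

instance DefFun.instSnd (f : α → β × γ) [hf : DefFun A f] :
    DefFun A (no_index (fun a => (f a).2)) :=
  DefFun.instSnd'.comp hf

instance DefFun.instPair (f : α → β) (g : α → γ) [hf : DefFun A f] [hg : DefFun A g] :
    DefFun A (no_index (fun a => (f a, g a))) := hf.prod hg

instance (priority := 2000) DefPred.instConst (p : Prop) : DefPred A (fun _ : α => p) :=
  DefPred.const p

instance DefPred.instAnd (P Q : α → Prop) [hP : DefPred A P] [hQ : DefPred A Q] :
    DefPred A (no_index (fun a => P a ∧ Q a)) := hP.and hQ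

instance DefPred.instOr (P Q : α → Prop) [hP : DefPred A P] [hQ : DefPred A Q] :
    DefPred A (no_index (fun a => P a ∨ Q a)) := hP.or hQ

instance DefPred.instImp (P Q : α → Prop) [hP : DefPred A P] [hQ : DefPred A Q] :
    DefPred A (no_index (fun a => P a → Q a)) := hP.imp hQ

instance DefPred.instIff (P Q : α → Prop) [hP : DefPred A P] [hQ : DefPred A Q] :
    DefPred A (no_index (fun a => P a ↔ Q a)) := hP.iff hQ

instance DefPred.instEx (P : α → β → Prop) [hP : DefPred A (fun p : α × β => P p.1 p.2)] :
    DefPred A (no_index (fun a => ∃ b, P a b)) := hP.ex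

instance DefPred.instAll (P : α → β → Prop) [hP : DefPred A (fun p : α × β => P p.1 p.2)] :
    DefPred A (no_index (fun a => ∀ b, P a b)) := hP.all

instance DefPred.instEq (f g : α → β) [hf : DefFun A f] [hg : DefFun A g] :
    DefPred A (no_index (fun a => f a = g a)) := DefPred.eq_diag.comp (hf.prod hg)

instance DefPred.instNe (f g : α → β) [hf : DefFun A f] [hg : DefFun A g] :
    DefPred A (no_index (fun a => f a ≠ g a)) := (DefPred.instEq f g).not

instance DefPred.instExUnique (P : α → β → Prop)
    [hP : DefPred A (fun p : α × β => P p.1 p.2)] :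
    DefPred A (no_index (fun a => ∃! b, P a b)) := by
  have h2 : DefPred A (fun p : (α × β) × β => P p.1.1 p.2) :=
    hP.comp (f := fun p : (α × β) × β => (p.1.1, p.2)) inferInstance
  exact inferInstanceAs (DefPred A fun a => ∃ b, P a b ∧ ∀ b', P a b' → b' = b)

instance DefPred.instMem (f g : α → M) [hf : DefFun A f] [hg : DefFun A g] :
    DefPred A (no_index (fun a => f a ∈ₘ g a)) := DefPred.mem_pair.comp (hf.prod hg)

instance DefPred.instIsPair (f g h : α → M) [DefFun A f] [DefFun A g] [DefFun A h] :
    DefPred A (no_index (fun a => IsPair (f a) (g a) (h a))) := by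
  have : DefPred A (fun p : M × M × M => IsPair p.1 p.2.1 p.2.2) := by
    unfold IsPair; infer_instance
  exact this.comp (f := fun a => (f a, g a, h a)) inferInstance

instance DefPred.instAppRel (f g h : α → M) [DefFun A f] [DefFun A g] [DefFun A h] :
    DefPred A (no_index (fun a => AppRel (f a) (g a) (h a))) := by
  have : DefPred A (fun p : M × M × M => AppRel p.1 p.2.1 p.2.2) := by
    unfold AppRel; infer_instance
  exact this.comp (f := fun a => (f a, g a, h a)) inferInstance

instance DefPred.instAppRel₂ (f g h k : α → M) [DefFun A f] [DefFun A g] [DefFun A h]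
    [DefFun A k] : DefPred A (no_index (fun a => AppRel₂ (f a) (g a) (h a) (k a))) := by
  have : DefPred A (fun p : M × M × M × M => AppRel₂ p.1 p.2.1 p.2.2.1 p.2.2.2) := by
    unfold AppRel₂; infer_instance
  exact this.comp (f := fun a => (f a, g a, h a, k a)) inferInstance

instance DefPred.instIsInductive (f : α → M) [DefFun A f] :
    DefPred A (no_index (fun a => IsInductive (f a))) := by
  have : DefPred A (fun p : M => IsInductive p) := by
    unfold IsInductive; infer_instance
  exact this.comp (f := f) inferInstance

instance Par.instUniv (a : α) : Par (Set.univ : Set M) a := ⟨fun _ => trivial⟩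

end instances

end Definability

/-! ### Basic set theory and transfer -/

section Sets

variable {M : Type u} [SPOT M]

theorem exists_sep (P : M → Prop) [hP : DefPred (Set.univ : Set M) P] (a : M) :
    ∃ b, ∀ x, x ∈ₘ b ↔ (x ∈ₘ a ∧ P x) := by
  refine SPOT.separation {x | P x} ?_ a
  have := hP.out
  unfold Set.Definable₁
  convert! this using 1
  ext v
  constructor
  · intro h
    exact ⟨v 0, funext fun i => congrArg v (Subsingleton.elim (α := Fin 1) _ _), h⟩
  · rintro ⟨a, rfl, h⟩
    exact h

theorem exists_isPair (a b : M) : ∃ p, IsPair p a b := by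
  obtain ⟨s, hs⟩ := SPOT.pairing a a
  obtain ⟨t, ht⟩ := SPOT.pairing a b
  obtain ⟨p, hp⟩ := SPOT.pairing s t
  refine ⟨p, fun z => ?_⟩
  rw [hp]
  refine or_congr ⟨?_, fun h => ?_⟩ ⟨?_, fun h => ?_⟩
  · rintro rfl w
    simp [hs]
  · exact SPOT.extensionality _ _ fun w => by simp [hs, h]
  · rintro rfl w
    simp [ht]
  · exact SPOT.extensionality _ _ fun w => by simp [ht, h]

theorem IsPair.unique {p q a b : M} (hp : IsPair p a b) (hq : IsPair q a b) : p = q :=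
  SPOT.extensionality _ _ fun z => by rw [hp, hq]

theorem IsPair.inj {p a b a' b' : M} (h : IsPair p a b) (h' : IsPair p a' b') :
    a = a' ∧ b = b' := by
  obtain ⟨s, hs⟩ := SPOT.pairing a a
  obtain ⟨t, ht⟩ := SPOT.pairing a b
  obtain ⟨s', hs'⟩ := SPOT.pairing a' a'
  obtain ⟨t', ht'⟩ := SPOT.pairing a' b'
  have e1 := (h' s).1 ((h s).2 (Or.inl fun w => by simp [hs]))
  have e2 := (h' t).1 ((h t).2 (Or.inr fun w => by simp [ht]))
  have e4 := (h t').1 ((h' t').2 (Or.inr fun w => by simp [ht']))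
  have haa : a = a' := by
    rcases e1 with e | e
    · exact (e a).1 ((hs a).2 (Or.inl rfl))
    · have := (hs a').1 ((e a').2 (Or.inl rfl))
      tauto
  subst haa
  refine ⟨rfl, ?_⟩
  have hb : b = a ∨ b = b' := by
    have := (ht b).2 (Or.inr rfl)
    rcases e2 with e | e
    · exact Or.inl ((e b).1 this)
    · exact (e b).1 this
  have hb' : b' = a ∨ b' = b := by
    have := (ht' b').2 (Or.inr rfl)
    rcases e4 with e | e
    · exact Or.inl ((e b').1 this)
    · exact (e b').1 this
  rcases hb with rfl | hb
  · rcases hb' with h | h <;> exact h.symm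
  · exact hb

theorem appRel_iff {f x v p : M} (hp : IsPair p x v) : AppRel f x v ↔ p ∈ₘ f :=
  ⟨fun ⟨_, hq, h⟩ => hp.unique hq ▸ h, fun h => ⟨p, hp, h⟩⟩

variable (M) in
/-- The standard elements. -/
def stdSet : Set M := {x | St x}

/-- `A` contains all standard elements. -/
class StdSub (A : Set M) : Prop where
  sub : ∀ x, St x → x ∈ A

instance : StdSub (Set.univ : Set M) := ⟨fun _ _ => trivial⟩

instance : StdSub (stdSet M) := ⟨fun _ h => h⟩

/-- `a` is standard. -/
abbrev Std {α : Type u} [Enc M α] (a : α) : Prop := Par (stdSet M) a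

theorem Par.mono {A : Set M} [StdSub A] {α : Type u} [Enc M α] (a : α) [h : Std a] : Par A a :=
  ⟨fun i => StdSub.sub _ (h.out i)⟩

theorem std_iff {a : M} : Std a ↔ St a := ⟨fun h => h.out (0 : Fin 1), fun h => ⟨fun _ => h⟩⟩

theorem transfer_sets (P : M → Prop) [hP : DefPred (stdSet M) P]
    (h : ∀ x, Std x → P x) (x : M) : P x := by
  refine SPOT.transfer {x | P x} ?_ (fun x hx => h x (std_iff.2 hx)) x
  have := hP.out
  unfold Set.Definable₁
  convert! this using 1
  ext v
  constructor
  · intro h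
    exact ⟨v 0, funext fun i => congrArg v (Subsingleton.elim (α := Fin 1) _ _), h⟩
  · rintro ⟨a, rfl, h⟩
    exact h

/-! ### Transfer for elements of standard sets and for tuples -/

instance Enc.subtype (c : M) : Enc M {x : M // x ∈ₘ c} where
  Idx := Fin 1
  fin := inferInstance
  enc a := fun _ => a.1
  inj _ _ h := Subtype.ext (congrFun h 0)

instance EncRange.subtype (A : Set M) (c : M) [Par A c] : EncRange A {x : M // x ∈ₘ c} where
  out := by
    have : DefPred A (fun x : M => x ∈ₘ c) := inferInstance
    convert! this.out using 1
    ext v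
    constructor
    · rintro ⟨a, rfl⟩
      exact ⟨a.1, rfl, a.2⟩
    · rintro ⟨a, rfl, h⟩
      exact ⟨⟨a, h⟩, rfl⟩

instance DefFun.instVal' (A : Set M) (c : M) [Par A c] :
    DefFun A (no_index (Subtype.val : {x : M // x ∈ₘ c} → M)) :=
  DefFun.of_coord _ (fun i => i) fun _ _ => rfl

instance DefFun.instVal (A : Set M) {α : Type u} [Enc M α] [EncRange A α] (c : M) [Par A c]
    (f : α → {x : M // x ∈ₘ c}) [hf : DefFun A f] : DefFun A (no_index (fun a => (f a).1)) :=
  (DefFun.instVal' A c).comp hf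

theorem std_subtype_iff {c : M} {a : {x : M // x ∈ₘ c}} : Std a ↔ St a.1 :=
  ⟨fun h => h.out (0 : Fin 1), fun h => ⟨fun _ => h⟩⟩

theorem std_prod_iff {α β : Type u} [Enc M α] [Enc M β] {p : α × β} :
    Std p ↔ Std p.1 ∧ Std p.2 := by
  constructor
  · intro h
    exact ⟨⟨fun i => h.out (Sum.inl i)⟩, ⟨fun i => h.out (Sum.inr i)⟩⟩
  · rintro ⟨h1, h2⟩
    refine ⟨?_⟩
    rintro (i | i)
    · exact h1.out i
    · exact h2.out i

variable (M) in
/-- Types for which Transfer holds. -/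
class HasTransfer (α : Type u) [Enc M α] : Prop where
  out : ∀ (P : α → Prop) [DefPred (stdSet M) P], (∀ x, Std x → P x) → ∀ x, P x

instance : HasTransfer M M := ⟨transfer_sets⟩

/-- Transfer is applied to a variable `y` ranging over all sets, with the element of `c` tied to it
by `a.1 = y`. -/
instance (c : M) [Std c] : HasTransfer M {x : M // x ∈ₘ c} where
  out P hP h x := by
    have key : ∀ y : M, ∀ a : {x : M // x ∈ₘ c}, a.1 = y → P a := by
      have h1 : DefPred (stdSet M) (fun p : M × {x : M // x ∈ₘ c} => P p.2) := hP.comp_snd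
      refine transfer_sets _ ?_
      rintro y hy a rfl
      exact h a (std_subtype_iff.2 (std_iff.1 hy))
    exact key _ x rfl

/-- One coordinate is transferred at a time: once the first is a standard element, it is an
admissible parameter for transferring the second. -/
instance {α β : Type u} [Enc M α] [Enc M β] [EncRange (stdSet M) α] [EncRange (stdSet M) β]
    [HasTransfer M α] [HasTransfer M β] : HasTransfer M (α × β) where
  out P hP h x := by
    have key : ∀ a : α, ∀ b : β, P (a, b) := by
      have h1 : DefPred (stdSet M) (fun p : α × β => P (p.1, p.2)) := hP
      refine HasTransfer.out (M := M) _ fun a ha => ?_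
      have : DefPred (stdSet M) (fun b : β => P (a, b)) :=
        hP.comp (f := fun b => (a, b)) inferInstance
      exact HasTransfer.out (M := M) _ fun b hb => h (a, b) (std_prod_iff.2 ⟨ha, hb⟩)
    exact key x.1 x.2

theorem transfer {α : Type u} [Enc M α] [HasTransfer M α] {P : α → Prop}
    [DefPred (stdSet M) P] (h : ∀ x, Std x → P x) (x : α) : P x := HasTransfer.out P h x

theorem exists_std {α : Type u} [Enc M α] [EncRange (stdSet M) α] [HasTransfer M α]
    {P : α → Prop} [DefPred (stdSet M) P] (h : ∃ x, P x) : ∃ x, Std x ∧ P x := by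
  by_contra hc
  push Not at hc
  obtain ⟨x, hx⟩ := h
  exact transfer (P := fun x => ¬ P x) hc x hx

theorem std_of_def {α : Type u} [Enc M α] [EncRange (stdSet M) α] [HasTransfer M α]
    (c : α) [DefPred (stdSet M) (fun x => x = c)] : Std c := by
  obtain ⟨x, hx, rfl⟩ := exists_std (P := fun x => x = c) ⟨c, rfl⟩
  exact hx

/-- By Transfer a definable property with a witness has a standard witness, and here there is only
one candidate. This is the source of nearly all standardness claims about constants, values and
endpoints. -/
theorem std_of_unique {α : Type u} [Enc M α] [EncRange (stdSet M) α] [HasTransfer M α]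
    {c : α} (P : α → Prop) [hP : DefPred (stdSet M) P] (hc : P c)
    (hu : ∀ x, P x → x = c) : Std c := by
  obtain ⟨x, hx, h⟩ := exists_std (P := P) ⟨c, hc⟩
  exact hu x h ▸ hx

end Sets

/-! ### Definability of the real field of a model -/

namespace RealField

variable {M : Type u} [SPOT M] (R : RealField M) {A : Set M} [StdSub A]
  {α β : Type u} [Enc M α] [Enc M β] [EncRange A α] [EncRange A β]

instance : Par A R.carrier := ⟨fun _ => StdSub.sub _ R.st_carrier⟩
instance : Par A R.add := ⟨fun _ => StdSub.sub _ R.st_add⟩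
instance : Par A R.mul := ⟨fun _ => StdSub.sub _ R.st_mul⟩
instance : Par A R.lt := ⟨fun _ => StdSub.sub _ R.st_lt⟩

variable {R}

instance instDefAdd (f g : α → R.K) [hf : DefFun A f] [hg : DefFun A g] :
    DefFun A (no_index (fun a => f a + g a)) := by
  have : DefFun A (fun p : R.K × R.K => p.1 + p.2) := by
    refine ⟨?_⟩
    simp only [← R.rel_add]
    infer_instance
  exact this.comp (f := fun a => (f a, g a)) inferInstance

instance instDefMul (f g : α → R.K) [hf : DefFun A f] [hg : DefFun A g] :
    DefFun A (no_index (fun a => f a * g a)) := by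
  have : DefFun A (fun p : R.K × R.K => p.1 * p.2) := by
    refine ⟨?_⟩
    simp only [← R.rel_mul]
    infer_instance
  exact this.comp (f := fun a => (f a, g a)) inferInstance

instance instDefLt (f g : α → R.K) [hf : DefFun A f] [hg : DefFun A g] :
    DefPred A (no_index (fun a => f a < g a)) := by
  simp only [← R.rel_lt]
  infer_instance

instance instDefLe (f g : α → R.K) [hf : DefFun A f] [hg : DefFun A g] :
    DefPred A (no_index (fun a => f a ≤ g a)) := by
  simp only [← not_lt]
  infer_instance

instance instStdZero : Std (0 : R.K) :=
  std_of_unique (fun z : R.K => z + z = z) (by simp) fun x hx => by simpa using hx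

instance instStdOne : Std (1 : R.K) :=
  std_of_unique (fun z : R.K => z * z = z ∧ ¬ z = 0) (by simp) fun x hx => by
    have := mul_right_cancel₀ hx.2 (hx.1.trans (one_mul x).symm)
    exact this

instance instStdAdd (x y : R.K) [Std x] [Std y] : Std (x + y) := std_of_def _

instance instStdMul (x y : R.K) [Std x] [Std y] : Std (x * y) := std_of_def _

instance instStdOfNat (n : ℕ) [n.AtLeastTwo] : Std (no_index (OfNat.ofNat n : R.K)) := by
  rw [← Nat.cast_ofNat]
  generalize (OfNat.ofNat n : ℕ) = m
  induction m with
  | zero => rw [Nat.cast_zero]; infer_instance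
  | succ m ih => rw [Nat.cast_succ]; infer_instance

instance instParZero : Par A (0 : R.K) := Par.mono _

instance instParOne : Par A (1 : R.K) := Par.mono _

instance instDefNeg (f : α → R.K) [hf : DefFun A f] : DefFun A (no_index (fun a => - f a)) := by
  have : DefFun A (fun p : R.K => -p) :=
    ⟨DefPred.congr (P := fun p : R.K × R.K => p.1 + p.2 = 0) inferInstance fun p =>
      neg_eq_iff_add_eq_zero⟩
  exact this.comp hf

instance instDefSub (f g : α → R.K) [hf : DefFun A f] [hg : DefFun A g] :
    DefFun A (no_index (fun a => f a - g a)) := by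
  simp only [sub_eq_add_neg]
  infer_instance

instance instDefInv (f : α → R.K) [hf : DefFun A f] : DefFun A (no_index (fun a => (f a)⁻¹)) := by
  have : DefFun A (fun p : R.K => p⁻¹) :=
    -- The second disjunct encodes the convention that the inverse of `0` is `0`.
    ⟨DefPred.congr (P := fun p : R.K × R.K => (¬ p.1 = 0 ∧ p.1 * p.2 = 1) ∨ (p.1 = 0 ∧ p.2 = 0))
      inferInstance fun p => by
        by_cases h : p.1 = 0
        · simp [h, eq_comm]
        · simp only [h, not_false_eq_true, true_and, false_and, or_false]
          rw [inv_eq_iff_eq_inv, eq_comm, inv_eq_iff_eq_inv, ← mul_eq_one_iff_eq_inv₀ h, mul_comm]⟩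
  exact this.comp hf

instance instDefDiv (f g : α → R.K) [hf : DefFun A f] [hg : DefFun A g] :
    DefFun A (no_index (fun a => f a / g a)) := by
  simp only [div_eq_mul_inv]
  infer_instance

instance instDefAbs (f : α → R.K) [hf : DefFun A f] : DefFun A (no_index (fun a => |f a|)) := by
  have : DefFun A (fun p : R.K => |p|) :=
    ⟨DefPred.congr (P := fun p : R.K × R.K => (0 ≤ p.1 ∧ p.1 = p.2) ∨ (¬ 0 ≤ p.1 ∧ -p.1 = p.2))
      inferInstance fun p => by
        by_cases h : 0 ≤ p.1
        · simp [h, abs_of_nonneg]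
        · simp [h, abs_of_neg (not_le.1 h)]⟩
  exact this.comp hf

instance instStdNeg (x : R.K) [Std x] : Std (-x) := std_of_def _
instance instStdSub (x y : R.K) [Std x] [Std y] : Std (x - y) := std_of_def _
instance instStdDiv (x y : R.K) [Std x] [Std y] : Std (x / y) := std_of_def _
instance instStdAbs (x : R.K) [Std x] : Std |x| := std_of_def _

theorem isNat_iff_def (x : R.K) : R.IsNat x ↔
  ∀ s : M, (0 : R.K).1 ∈ₘ s → (∀ z : R.K, z.1 ∈ₘ s → (z + 1).1 ∈ₘ s) → x.1 ∈ₘ s := Iff.rfl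

instance instDefIsNat (f : α → R.K) [hf : DefFun A f] :
    DefPred A (no_index (fun a => R.IsNat (f a))) := by
  have : DefPred A (fun x : R.K => R.IsNat x) := by
    simp only [isNat_iff_def]
    infer_instance
  exact this.comp hf

variable (R)

open Classical in
/-- The value at `x` of the function with graph `f`, and `0` if it is not defined. -/
noncomputable def val (f : M) (x : R.K) : R.K :=
  if h : ∃! v : R.K, AppRel f x.1 v.1 then h.exists.choose else 0

open Classical in
/-- The value at `(x, y)` of the function of two variables with graph `f`. -/
noncomputable def val₂ (f : M) (x y : R.K) : R.K :=
  if h : ∃! v : R.K, AppRel₂ f x.1 y.1 v.1 then h.exists.choose else 0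

variable {R}

theorem val_eq_iff {f : M} {x : R.K} (h : ∃! v : R.K, AppRel f x.1 v.1) {v : R.K} :
    R.val f x = v ↔ AppRel f x.1 v.1 := by
  have h' : R.val f x = h.exists.choose := by rw [val, dif_pos h]
  rw [h']
  exact ⟨fun e => e ▸ h.exists.choose_spec, fun e => h.unique h.exists.choose_spec e⟩

theorem val₂_eq_iff {f : M} {x y : R.K} (h : ∃! v : R.K, AppRel₂ f x.1 y.1 v.1) {v : R.K} :
    R.val₂ f x y = v ↔ AppRel₂ f x.1 y.1 v.1 := by
  have h' : R.val₂ f x y = h.exists.choose := by rw [val₂, dif_pos h]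
  rw [h']
  exact ⟨fun e => e ▸ h.exists.choose_spec, fun e => h.unique h.exists.choose_spec e⟩

instance instDefValF (f : α → M) (g : α → R.K) [hf : DefFun A f] [hg : DefFun A g] :
    DefFun A (no_index (fun a => R.val (f a) (g a))) := by
  have : DefFun A (fun p : M × R.K => R.val p.1 p.2) :=
    ⟨DefPred.congr (P := fun p : (M × R.K) × R.K =>
      ((∃! v : R.K, AppRel p.1.1 p.1.2.1 v.1) ∧ AppRel p.1.1 p.1.2.1 p.2.1) ∨
      (¬ (∃! v : R.K, AppRel p.1.1 p.1.2.1 v.1) ∧ 0 = p.2)) inferInstance fun p => by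
        by_cases h : ∃! v : R.K, AppRel p.1.1 p.1.2.1 v.1
        · rw [val_eq_iff h]; tauto
        · rw [val, dif_neg h]; tauto⟩
  exact this.comp (f := fun a => (f a, g a)) inferInstance

instance instDefVal₂ (f : α → M) (g k : α → R.K) [hf : DefFun A f] [hg : DefFun A g]
    [hk : DefFun A k] : DefFun A (no_index (fun a => R.val₂ (f a) (g a) (k a))) := by
  have : DefFun A (fun p : M × R.K × R.K => R.val₂ p.1 p.2.1 p.2.2) :=
    ⟨DefPred.congr (P := fun p : (M × R.K × R.K) × R.K =>
      ((∃! v : R.K, AppRel₂ p.1.1 p.1.2.1.1 p.1.2.2.1 v.1) ∧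
        AppRel₂ p.1.1 p.1.2.1.1 p.1.2.2.1 p.2.1) ∨
      (¬ (∃! v : R.K, AppRel₂ p.1.1 p.1.2.1.1 p.1.2.2.1 v.1) ∧ 0 = p.2)) inferInstance fun p => by
        by_cases h : ∃! v : R.K, AppRel₂ p.1.1 p.1.2.1.1 p.1.2.2.1 v.1
        · rw [val₂_eq_iff h]; tauto
        · rw [val₂, dif_neg h]; tauto⟩
  exact this.comp (f := fun a => (f a, g a, k a)) inferInstance

instance instStdVal (f : M) (x : R.K) [Std f] [Std x] : Std (R.val f x) := std_of_def _
instance instStdVal₂ (f : M) (x y : R.K) [Std f] [Std x] [Std y] : Std (R.val₂ f x y) :=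
  std_of_def _

/-- `WithTop R.K` carries no coding. An infinite endpoint imposes no condition, and a finite one
enters as a parameter, which has to be admissible; the `Fact` hypothesis says so. -/
instance instDefBelow (f : α → R.K) [DefFun A f] (a : WithTop R.K)
    [h : Fact (∀ b : R.K, a = b → Par A b)] :
    DefPred A (no_index (fun x => (f x : WithTop R.K) < a)) := by
  rcases a with _ | b
  · exact DefPred.congr (P := fun _ => True) inferInstance fun x => by
      exact iff_true_intro (WithTop.coe_lt_top (f x))
  · have := h.out b rfl
    change DefPred A fun x => (f x : WithTop R.K) < (b : WithTop R.K)
    simp only [WithTop.coe_lt_coe]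
    infer_instance

instance (a : WithTop R.K) : Fact (∀ b : R.K, a = b → Par (Set.univ : Set M) b) :=
  ⟨fun _ _ => inferInstance⟩

/-! ### Comprehension -/

theorem exists_set (P : R.K → Prop) [hP : DefPred (Set.univ : Set M) P] :
    ∃ s : M, (∀ p, p ∈ₘ s → p ∈ₘ R.carrier) ∧ ∀ x : R.K, x.1 ∈ₘ s ↔ P x := by
  have : DefPred (Set.univ : Set M) (fun p : M × R.K => P p.2) := hP.comp_snd
  obtain ⟨s, hs⟩ := exists_sep (fun p : M => ∃ x : R.K, x.1 = p ∧ P x) R.carrier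
  refine ⟨s, fun p hp => ((hs p).1 hp).1, fun x => ?_⟩
  rw [hs]
  constructor
  · rintro ⟨_, y, hy, h⟩
    rwa [Subtype.ext hy] at h
  · exact fun h => ⟨x.2, x, rfl, h⟩

/-- Kuratowski pairs of elements of `c` lie in the double power set of `c`. This supplies the
ambient set that Separation needs for building relations. -/
theorem exists_pairs_sup (c : M) : ∃ s : M, ∀ p a b, a ∈ₘ c → b ∈ₘ c → IsPair p a b → p ∈ₘ s := by
  obtain ⟨c1, h1⟩ := SPOT.powerset c
  obtain ⟨c2, h2⟩ := SPOT.powerset c1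
  refine ⟨c2, fun p a b ha hb hp => ?_⟩
  rw [h2]
  intro z hz
  rw [h1]
  intro w hw
  rcases (hp z).1 hz with h | h
  · rw [(h w).1 hw]; exact ha
  · rcases (h w).1 hw with rfl | rfl <;> assumption

theorem exists_graph (P : R.K → R.K → Prop)
    [hP : DefPred (Set.univ : Set M) (fun p : R.K × R.K => P p.1 p.2)] :
    ∃ f : M, (∀ p, p ∈ₘ f ↔ ∃ x v : R.K, IsPair p x.1 v.1 ∧ P x v) ∧
      ∀ x v : R.K, AppRel f x.1 v.1 ↔ P x v := by
  obtain ⟨s, hs⟩ := exists_pairs_sup R.carrier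
  have : DefPred (Set.univ : Set M) (fun p : (M × R.K) × R.K => P p.1.2 p.2) :=
    hP.comp (f := fun p : (M × R.K) × R.K => (p.1.2, p.2)) inferInstance
  obtain ⟨f, hf⟩ := exists_sep (fun p : M => ∃ x v : R.K, IsPair p x.1 v.1 ∧ P x v) s
  have key : ∀ p, p ∈ₘ f ↔ ∃ x v : R.K, IsPair p x.1 v.1 ∧ P x v := by
    intro p
    rw [hf]
    refine and_iff_right_of_imp ?_
    rintro ⟨x, v, h, -⟩
    exact hs _ _ _ x.2 v.2 h
  refine ⟨f, key, fun x v => ?_⟩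
  obtain ⟨p, hp⟩ := exists_isPair x.1 v.1
  rw [appRel_iff hp, key]
  constructor
  · rintro ⟨x', v', h, h'⟩
    obtain ⟨h1, h2⟩ := hp.inj h
    rwa [Subtype.ext h1, Subtype.ext h2]
  · exact fun h => ⟨x, v, hp, h⟩

end RealField

namespace RealField

variable {M : Type u} [SPOT M] {R : RealField M}

/-! ### Completeness, natural numbers, the Archimedean property -/

theorem exists_lub (P : R.K → Prop) [DefPred (Set.univ : Set M) P] (h0 : ∃ x, P x)
    (b : R.K) (hb : ∀ x, P x → x ≤ b) :
    ∃ c : R.K, (∀ x, P x → x ≤ c) ∧ ∀ d, (∀ x, P x → x ≤ d) → c ≤ d := by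
  obtain ⟨s, -, hs⟩ := exists_set P
  obtain ⟨c, hc1, hc2⟩ := R.complete s (h0.imp fun x hx => (hs x).2 hx)
    ⟨b, fun x hx => hb x ((hs x).1 hx)⟩
  exact ⟨c, fun x hx => hc1 ((hs x).2 hx), fun d hd => hc2 fun x hx => hd x ((hs x).1 hx)⟩

theorem isNat_zero : R.IsNat 0 := fun _ h _ => h

theorem IsNat.succ {n : R.K} (hn : R.IsNat n) : R.IsNat (n + 1) :=
  fun s h0 hs => hs n (hn s h0 hs)

theorem IsNat.induction {P : R.K → Prop} [hP : DefPred (Set.univ : Set M) P] (h0 : P 0)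
    (hs : ∀ n, R.IsNat n → P n → P (n + 1)) {n : R.K} (hn : R.IsNat n) : P n := by
  obtain ⟨s, -, hsP⟩ := exists_set (R := R) (fun n => R.IsNat n ∧ P n)
  exact ((hsP n).1 (hn s ((hsP 0).2 ⟨isNat_zero, h0⟩) fun z hz =>
    (hsP _).2 ⟨((hsP z).1 hz).1.succ, hs z ((hsP z).1 hz).1 ((hsP z).1 hz).2⟩)).2

theorem IsNat.add {m n : R.K} (hm : R.IsNat m) (hn : R.IsNat n) : R.IsNat (m + n) := by
  refine IsNat.induction (P := fun n => R.IsNat (m + n)) (by simpa using hm) ?_ hn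
  intro n _ h
  rw [← add_assoc]; exact h.succ

theorem IsNat.mul {m n : R.K} (hm : R.IsNat m) (hn : R.IsNat n) : R.IsNat (m * n) := by
  refine IsNat.induction (P := fun n => R.IsNat (m * n)) (by simpa using isNat_zero) ?_ hn
  intro n _ h
  rw [mul_add, mul_one]; exact h.add hm

theorem IsNat.nonneg {n : R.K} (hn : R.IsNat n) : 0 ≤ n :=
  IsNat.induction (P := fun n => 0 ≤ n) le_rfl (fun n _ h => by linarith) hn

theorem IsNat.zero_or_succ {n : R.K} (hn : R.IsNat n) : n = 0 ∨ ∃ m, R.IsNat m ∧ n = m + 1 :=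
  IsNat.induction (P := fun n => n = 0 ∨ ∃ m, R.IsNat m ∧ n = m + 1) (Or.inl rfl)
    (fun n hn _ => Or.inr ⟨n, hn, rfl⟩) hn

theorem IsNat.sub {m n : R.K} (hm : R.IsNat m) (hn : R.IsNat n) (h : m ≤ n) :
    R.IsNat (n - m) := by
  refine IsNat.induction (P := fun n => ∀ m, R.IsNat m → m ≤ n → R.IsNat (n - m)) ?_ ?_ hn m hm h
  · intro m hm h
    rw [le_antisymm h hm.nonneg]; simpa using isNat_zero
  · intro n hn ih m hm h
    rcases hm.zero_or_succ with rfl | ⟨k, hk, rfl⟩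
    · simpa using hn.succ
    · rw [add_sub_add_right_eq_sub]
      exact ih k hk (by linarith)

theorem IsNat.one_le {n : R.K} (hn : R.IsNat n) (h : 0 < n) : 1 ≤ n := by
  rcases hn.zero_or_succ with rfl | ⟨m, hm, rfl⟩
  · exact absurd h (lt_irrefl _)
  · linarith [hm.nonneg]

theorem IsNat.succ_le {m n : R.K} (hm : R.IsNat m) (hn : R.IsNat n) (h : m < n) : m + 1 ≤ n := by
  linarith [(hm.sub hn h.le).one_le (by linarith)]

/-- If the naturals were bounded, their supremum minus `1` would still be an upper bound, because
they are closed under successor. -/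
theorem exists_nat_gt (x : R.K) : ∃ n, R.IsNat n ∧ x < n := by
  by_contra hc
  push Not at hc
  obtain ⟨c, hc1, hc2⟩ := exists_lub (fun n : R.K => R.IsNat n) ⟨0, isNat_zero⟩ x hc
  have := hc2 (c - 1) fun n hn => by linarith [hc1 _ hn.succ]
  linarith

theorem exists_floor {x : R.K} (hx : 0 ≤ x) : ∃ n, R.IsNat n ∧ n ≤ x ∧ x < n + 1 := by
  obtain ⟨m, hm, h⟩ := exists_nat_gt x
  refine IsNat.induction
    (P := fun m => x < m → ∃ n, R.IsNat n ∧ n ≤ x ∧ x < n + 1) ?_ ?_ hm h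
  · intro h; exact absurd h (not_lt.2 hx)
  · intro m hm ih h
    by_cases hxm : x < m
    · exact ih hxm
    · exact ⟨m, hm, not_lt.1 hxm, h⟩

theorem exists_std_nat_gt (x : R.K) [Std x] : ∃ n, Std n ∧ R.IsNat n ∧ x < n :=
  exists_std (P := fun n => R.IsNat n ∧ x < n) (exists_nat_gt x)

/-- Writing rationals as `(p - q) / (m + 1)` with natural `p`, `q`, `m` avoids integers and zero
denominators, and makes them ready for coding by natural numbers. -/
theorem exists_rat_btwn {x y : R.K} (h : x < y) :
    ∃ p q m, R.IsNat p ∧ R.IsNat q ∧ R.IsNat m ∧ x < (p - q) / (m + 1) ∧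
      (p - q) / (m + 1) < y := by
  obtain ⟨m, hm, hm'⟩ := exists_nat_gt (1 / (y - x))
  have hyx : 0 < y - x := sub_pos.2 h
  have hm1 : 0 < m + 1 := by linarith [hm.nonneg]
  -- Adding `q` makes the scaled number positive, so that `exists_floor` applies.
  obtain ⟨q, hq, hq'⟩ := exists_nat_gt (-(x * (m + 1)))
  obtain ⟨n, hn, h1, h2⟩ := exists_floor (x := x * (m + 1) + q) (by linarith)
  refine ⟨n + 1, q, m, hn.succ, hq, hm, ?_, ?_⟩
  · rw [lt_div_iff₀ hm1]; linarith
  · rw [div_lt_iff₀ hm1]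
    rw [div_lt_iff₀ hyx] at hm'
    nlinarith

/-! ### Infinitesimals -/

/-- Transfer of the Archimedean property gives a standard natural number above `1 / e`, so arbitrary
standard positive tolerances may replace the numbers `1 / n`. -/
theorem near_iff {x y : R.K} : R.Near x y ↔ ∀ e : R.K, Std e → 0 < e → |x - y| < e := by
  constructor
  · intro h e he he0
    obtain ⟨n, hn1, hn2, hn3⟩ := exists_std_nat_gt (1 / e)
    have hn0 : 0 < n := lt_trans (by positivity) hn3
    refine lt_of_le_of_lt (h n hn2 (std_subtype_iff.1 hn1) hn0.ne') ?_
    rw [div_lt_iff₀ hn0]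
    rwa [div_lt_iff₀ he0, mul_comm] at hn3
  · intro h n hn hs hn0
    have : Std n := std_subtype_iff.2 hs
    exact (h (1 / n) inferInstance
      (one_div_pos.2 (lt_of_le_of_ne hn.nonneg (Ne.symm hn0)))).le

theorem limited_iff {x : R.K} : R.Limited x ↔ ∃ b : R.K, Std b ∧ |x| ≤ b := by
  constructor
  · rintro ⟨n, -, h, h'⟩
    exact ⟨n, std_subtype_iff.2 h, h'⟩
  · rintro ⟨b, hb, h⟩
    obtain ⟨n, hn1, hn2, hn3⟩ := exists_std_nat_gt b
    exact ⟨n, hn2, std_subtype_iff.1 hn1, h.trans hn3.le⟩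

theorem Near.refl (x : R.K) : R.Near x x := near_iff.2 fun e _ h => by simpa using h

theorem Near.symm {x y : R.K} (h : R.Near x y) : R.Near y x :=
  near_iff.2 fun e he h0 => by rw [abs_sub_comm]; exact near_iff.1 h e he h0

theorem Near.add {x y x' y' : R.K} (h : R.Near x y) (h' : R.Near x' y') :
    R.Near (x + x') (y + y') := near_iff.2 fun e he h0 => by
  have h1 := near_iff.1 h (e / 2) inferInstance (by linarith)
  have h2 := near_iff.1 h' (e / 2) inferInstance (by linarith)
  rw [abs_lt] at *
  constructor <;> linarith

theorem Near.neg {x y : R.K} (h : R.Near x y) : R.Near (-x) (-y) :=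
  near_iff.2 fun e he h0 => by
    rw [neg_sub_neg, abs_sub_comm]; exact near_iff.1 h e he h0

theorem Near.sub {x y x' y' : R.K} (h : R.Near x y) (h' : R.Near x' y') :
    R.Near (x - x') (y - y') := by
  simpa [sub_eq_add_neg] using h.add h'.neg

theorem Near.trans {x y z : R.K} (h : R.Near x y) (h' : R.Near y z) : R.Near x z := by
  simpa using (h.add h').sub (Near.refl y)

theorem Near.of_abs_le {x y z w : R.K} (h : R.Near z w) (hle : |x - y| ≤ |z - w|) :
    R.Near x y := near_iff.2 fun e he h0 => lt_of_le_of_lt hle (near_iff.1 h e he h0)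

theorem Near.mul_left {x y : R.K} (h : R.Near x y) {c : R.K} (b : R.K) [Std b] (hc : |c| ≤ b) :
    R.Near (c * x) (c * y) := near_iff.2 fun e he h0 => by
  have hb : 0 ≤ b := (abs_nonneg c).trans hc
  have hb1 : 0 < b + 1 := by linarith
  have h1 := near_iff.1 h (e / (b + 1)) inferInstance (by positivity)
  rw [← mul_sub, abs_mul]
  rw [lt_div_iff₀ hb1] at h1
  nlinarith [abs_nonneg (x - y)]

theorem Near.eq {x y : R.K} [Std x] [Std y] (h : R.Near x y) : x = y := by
  by_contra hne
  exact lt_irrefl _ (near_iff.1 h |x - y| inferInstance (abs_pos.2 (sub_ne_zero.2 hne)))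

/-- If `y' < x'`, the gap is a standard positive number; halving it gives a tolerance that forces `y
< x`. Weak inequalities thus pass to standard parts, and strict ones lift back (`Near.lt`). -/
theorem Near.le {x y x' y' : R.K} [Std x'] [Std y'] (hx : R.Near x x') (hy : R.Near y y')
    (h : x ≤ y) : x' ≤ y' := by
  by_contra hc
  push Not at hc
  have h1 := near_iff.1 hx ((x' - y') / 2) inferInstance (by linarith)
  have h2 := near_iff.1 hy ((x' - y') / 2) inferInstance (by linarith)
  rw [abs_lt] at h1 h2
  linarith

theorem Near.lt {x y x' y' : R.K} [Std x'] [Std y'] (hx : R.Near x x') (hy : R.Near y y')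
    (h : x' < y') : x < y := by
  by_contra hc
  push Not at hc
  exact absurd (Near.le hy hx hc) (not_le.2 h)

theorem near_one_div {N : R.K} (hN : 0 < N) (h : ¬ R.Limited N) : R.Near (1 / N) 0 :=
  near_iff.2 fun e he h0 => by
    rw [sub_zero, abs_of_pos (one_div_pos.2 hN), div_lt_iff₀ hN]
    by_contra hc
    refine h (limited_iff.2 ⟨1 / e, inferInstance, ?_⟩)
    rw [abs_of_pos hN, le_div_iff₀ h0]
    linarith

/-- A monotone internal property of all standard `e > 0` holds for some infinitesimal. -/
theorem exists_infinitesimal {θ : R.K} (hθ : 0 < θ) (hθ0 : R.Near θ 0) (P : R.K → Prop)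
    [DefPred (Set.univ : Set M) P] (hmono : ∀ e e', 0 < e → P e → e ≤ e' → P e')
    (hstd : ∀ e, Std e → 0 < e → P e) : ∃ e, 0 < e ∧ R.Near e 0 ∧ P e := by
  by_cases hPθ : P θ
  · exact ⟨θ, hθ, hθ0, hPθ⟩
  have hb : ∀ e, Std e → 0 < e → ∀ x, 0 < x ∧ ¬ P x → x ≤ e := by
    rintro e he he0 x ⟨hx0, hx⟩
    by_contra hc
    exact hx (hmono e x he0 (hstd e he he0) (not_le.1 hc).le)
  -- Overspill: by monotonicity every standard positive number bounds the failures of `P` from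
  -- above, so their supremum `c` is infinitesimal, and `2 * c` lies beyond all failures. The
  -- failure at `θ` guarantees `0 < c`.
  obtain ⟨c, hc1, hc2⟩ := exists_lub (fun e : R.K => 0 < e ∧ ¬ P e) ⟨θ, hθ, hPθ⟩ 1
    (hb 1 inferInstance one_pos)
  have hc0 : 0 < c := lt_of_lt_of_le hθ (hc1 θ ⟨hθ, hPθ⟩)
  refine ⟨2 * c, by linarith, ?_, ?_⟩
  · refine near_iff.2 fun e he h0 => ?_
    have := hc2 (e / 4) (hb (e / 4) inferInstance (by linarith))
    rw [sub_zero, abs_of_pos (by linarith)]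
    linarith
  · by_contra hP
    linarith [hc1 (2 * c) ⟨by linarith, hP⟩]

end RealField

/-! ### Natural numbers of the field and the set `ω` -/

section Omega

variable {M : Type u} [SPOT M]

theorem exists_empty : ∃ e : M, ∀ z, ¬ z ∈ₘ e := by
  obtain ⟨w, -⟩ := SPOT.infinity (M := M)
  obtain ⟨e, he⟩ := exists_sep (fun _ : M => False) w
  exact ⟨e, fun z hz => ((he z).1 hz).2⟩

/-- `s = x ∪ {x}`. -/
def IsSucc (s x : M) : Prop := ∀ z, z ∈ₘ s ↔ (z ∈ₘ x ∨ z = x)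

instance instDefIsSucc {A : Set M} {α : Type u} [Enc M α] [EncRange A α] (f g : α → M)
    [DefFun A f] [DefFun A g] : DefPred A (no_index (fun a => IsSucc (f a) (g a))) := by
  unfold IsSucc
  have : DefPred A (fun p : M × M => ∀ z, z ∈ₘ p.1 ↔ (z ∈ₘ p.2 ∨ z = p.2)) := inferInstance
  exact this.comp (f := fun a => (f a, g a)) inferInstance

theorem exists_isSucc (x : M) : ∃ s, IsSucc s x := by
  obtain ⟨t, ht⟩ := SPOT.pairing x x
  obtain ⟨p, hp⟩ := SPOT.pairing x t
  obtain ⟨s, hs⟩ := SPOT.union p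
  refine ⟨s, fun z => ?_⟩
  rw [hs]
  constructor
  · rintro ⟨y, hy, hz⟩
    rcases (hp y).1 hy with rfl | rfl
    · exact Or.inl hz
    · exact Or.inr (by simpa using (ht z).1 hz)
  · rintro (h | rfl)
    · exact ⟨x, (hp x).2 (Or.inl rfl), h⟩
    · exact ⟨t, (hp t).2 (Or.inr rfl), (ht z).2 (Or.inl rfl)⟩

/-- Two distinct predecessors would be members of each other, which Foundation forbids for the set
`{a, b}`. -/
theorem IsSucc.inj {s a b : M} (ha : IsSucc s a) (hb : IsSucc s b) : a = b := by
  by_contra hne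
  have h1 : a ∈ₘ b := ((hb a).1 ((ha a).2 (Or.inr rfl))).resolve_right hne
  have h2 : b ∈ₘ a := ((ha b).1 ((hb b).2 (Or.inr rfl))).resolve_right (Ne.symm hne)
  obtain ⟨p, hp⟩ := SPOT.pairing a b
  obtain ⟨x, hx, hx'⟩ := SPOT.foundation p ⟨a, (hp a).2 (Or.inl rfl)⟩
  rcases (hp x).1 hx with rfl | rfl
  · exact hx' b ⟨h2, (hp b).2 (Or.inr rfl)⟩
  · exact hx' a ⟨h1, (hp a).2 (Or.inl rfl)⟩

variable (M) in
theorem exists_isOmega : ∃ w : M, IsOmega w := by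
  obtain ⟨w, hw⟩ := SPOT.infinity (M := M)
  obtain ⟨o, ho⟩ := exists_sep (fun x : M => ∀ v, IsInductive v → x ∈ₘ v) w
  refine ⟨o, ⟨fun e he => (ho e).2 ⟨hw.1 e he, fun v hv => hv.1 e he⟩, fun x hx s hs => ?_⟩,
    fun v hv x hx => ((ho x).1 hx).2 v hv⟩
  have hx' := (ho x).1 hx
  exact (ho s).2 ⟨hw.2 x hx'.1 s hs, fun v hv => hv.2 x (hx'.2 v hv) s hs⟩

end Omega

namespace RealField

variable {M : Type u} [SPOT M] {R : RealField M}

/-- `s` contains `⟨0, ∅⟩` and with `⟨m, b⟩` also `⟨m + 1, b ∪ {b}⟩`. -/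
def CountClosed (R : RealField M) (s : M) : Prop :=
  (∀ e, (∀ z, ¬ z ∈ₘ e) → AppRel s (0 : R.K).1 e) ∧
    ∀ (m : R.K) (b b' : M), AppRel s m.1 b → IsSucc b' b → AppRel s (m + 1).1 b'

/-- The correspondence between the natural numbers of the field and the elements of `ω`. -/
def Counts (R : RealField M) (n : R.K) (a : M) : Prop :=
  ∀ s, R.CountClosed s → AppRel s n.1 a

instance instDefCounts {A : Set M} [StdSub A] {α : Type u} [Enc M α] [EncRange A α]
    (f : α → R.K) (g : α → M) [hf : DefFun A f] [hg : DefFun A g] :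
    DefPred A (no_index (fun a => R.Counts (f a) (g a))) := by
  have : DefPred A (fun p : R.K × M => R.Counts p.1 p.2) := by
    unfold Counts CountClosed; infer_instance
  exact this.comp (f := fun a => (f a, g a)) inferInstance

theorem counts_zero {e : M} (he : ∀ z, ¬ z ∈ₘ e) : R.Counts 0 e := fun _ hs => hs.1 e he

theorem Counts.succ {n : R.K} {a a' : M} (h : R.Counts n a) (ha : IsSucc a' a) :
    R.Counts (n + 1) a' := fun s hs => hs.2 n a a' (h s hs) ha

/-- `Counts` is the least closed relation, so it is enough to test it against one closed set: the
pairs in `Counts` satisfying `Q` whose second entry is in `w`. Requiring membership in `w` keeps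
these pairs inside a set. -/
theorem Counts.induction {w : M} (hw : IsOmega w) (Q : R.K → M → Prop)
    [hQ : DefPred (Set.univ : Set M) (fun p : R.K × M => Q p.1 p.2)]
    (h0 : ∀ e, (∀ z, ¬ z ∈ₘ e) → Q 0 e)
    (hs : ∀ n a a', R.Counts n a → Q n a → IsSucc a' a → Q (n + 1) a')
    {n : R.K} {a : M} (h : R.Counts n a) : Q n a ∧ a ∈ₘ w := by
  obtain ⟨p, hp⟩ := SPOT.pairing R.carrier w
  obtain ⟨c, hc⟩ := SPOT.union p
  obtain ⟨t, ht⟩ := exists_pairs_sup c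
  have : DefPred (Set.univ : Set M) (fun q : (M × R.K) × M => Q q.1.2 q.2) :=
    hQ.comp (f := fun q : (M × R.K) × M => (q.1.2, q.2)) inferInstance
  obtain ⟨s, hs'⟩ := exists_sep (fun q : M => ∃ (n : R.K) (a : M), IsPair q n.1 a ∧
    (Q n a ∧ R.Counts n a ∧ a ∈ₘ w)) t
  have key : ∀ (n : R.K) (a : M), AppRel s n.1 a ↔ (Q n a ∧ R.Counts n a ∧ a ∈ₘ w) := by
    intro n a
    obtain ⟨q, hq⟩ := exists_isPair n.1 a
    rw [appRel_iff hq, hs']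
    constructor
    · rintro ⟨-, n', a', h, h'⟩
      obtain ⟨h1, rfl⟩ := hq.inj h
      rwa [Subtype.ext h1]
    · intro h
      refine ⟨ht q n.1 a ?_ ?_ hq, n, a, hq, h⟩
      · exact (hc _).2 ⟨R.carrier, (hp _).2 (Or.inl rfl), n.2⟩
      · exact (hc _).2 ⟨w, (hp _).2 (Or.inr rfl), h.2.2⟩
  have := (key n a).1 (h s ⟨fun e he => (key 0 e).2 ⟨h0 e he, counts_zero he, hw.1.1 e he⟩,
    fun m b b' hm hb => ?_⟩)
  · exact ⟨this.1, this.2.2⟩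
  · obtain ⟨h1, h2, h3⟩ := (key m b).1 hm
    exact (key _ _).2 ⟨hs m b b' h2 h1 hb, h2.succ hb, hw.1.2 b h3 b' hb⟩

theorem Counts.cases {w : M} (hw : IsOmega w) {n : R.K} {a : M} (h : R.Counts n a) :
    (n = 0 ∧ ∀ z, ¬ z ∈ₘ a) ∨ ∃ (m : R.K) (b : M), R.Counts m b ∧ n = m + 1 ∧ IsSucc a b :=
  (Counts.induction hw (fun n a => (n = 0 ∧ ∀ z, ¬ z ∈ₘ a) ∨
    ∃ (m : R.K) (b : M), R.Counts m b ∧ n = m + 1 ∧ IsSucc a b)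
    (fun _ he => Or.inl ⟨rfl, he⟩)
    (fun n a _ h _ ha => Or.inr ⟨n, a, h, rfl, ha⟩) h).1

/-- Induction along the counting, with `IsSucc.inj` in the successor step. Uniqueness lets a subset
of `ω` be read back as a set of natural numbers of the field. -/
theorem Counts.unique {w : M} (hw : IsOmega w) {n m : R.K} {a : M} (h : R.Counts n a)
    (h' : R.Counts m a) : m = n := by
  refine (Counts.induction hw (fun n a => ∀ m : R.K, R.Counts m a → m = n) ?_ ?_ h).1 m h'
  · intro e he m hm
    rcases hm.cases hw with h | ⟨k, b, -, -, hb⟩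
    · exact h.1
    · exact absurd ((hb b).2 (Or.inr rfl)) (he b)
  · intro n a a' _ ih ha m hm
    rcases hm.cases hw with h | ⟨k, b, hk, rfl, hb⟩
    · exact absurd ((ha a).2 (Or.inr rfl)) (h.2 a)
    · obtain rfl := ha.inj hb
      rw [ih k hk]

theorem IsNat.exists_counts {n : R.K} (hn : R.IsNat n) : ∃ a, R.Counts n a := by
  refine IsNat.induction (P := fun n => ∃ a, R.Counts n a) ?_ ?_ hn
  · obtain ⟨e, he⟩ := exists_empty (M := M)
    exact ⟨e, counts_zero he⟩
  · rintro n - ⟨a, ha⟩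
    obtain ⟨s, hs⟩ := exists_isSucc a
    exact ⟨s, ha.succ hs⟩

/-- The Standard Part axiom for sets of natural numbers of the field. -/
theorem exists_std_nat_set (P : R.K → Prop) [hP : DefPred (Set.univ : Set M) P] :
    ∃ B : M, Std B ∧ ∀ n : R.K, Std n → R.IsNat n → (n.1 ∈ₘ B ↔ P n) := by
  obtain ⟨w, hw⟩ := exists_isOmega M
  have : DefPred (Set.univ : Set M) (fun p : M × R.K => P p.2) := hP.comp_snd
  -- The property is carried over to a subset `S` of `ω`, where the Standard Part axiom applies.
  obtain ⟨S, hS⟩ := exists_sep (fun a : M => ∃ n : R.K, R.Counts n a ∧ P n) w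
  obtain ⟨B, hB, hBw, hBS⟩ := SPOT.standardPart w hw S fun n hn => ((hS n).1 hn).1
  have hBstd : Std B := std_iff.2 hB
  have key : ∀ n : R.K, Std n → ((∃ a, R.Counts n a ∧ a ∈ₘ B) → P n) ∧
      (R.IsNat n → P n → ∃ a, R.Counts n a ∧ a ∈ₘ B) := by
    intro n hn
    constructor
    · intro h
      obtain ⟨a, ha, hna, haB⟩ := exists_std (P := fun a => R.Counts n a ∧ a ∈ₘ B) h
      obtain ⟨m, hm, hPm⟩ := ((hS a).1 ((hBS a (hBw a haB) (std_iff.1 ha)).1 haB)).2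
      rwa [← hna.unique hw hm]
    · intro hnat hPn
      obtain ⟨a, ha, hna⟩ := exists_std (P := fun a => R.Counts n a) hnat.exists_counts
      have haw : a ∈ₘ w := (Counts.induction hw (fun _ _ => True) (fun _ _ => trivial)
        (fun _ _ _ _ _ _ => trivial) hna).2
      exact ⟨a, hna, (hBS a haw (std_iff.1 ha)).2 ((hS a).2 ⟨haw, n, hna, hPn⟩)⟩
  -- The preimage of the standard set `B` under the counting relation is definable from `B`, hence
  -- may be chosen standard.
  obtain ⟨C, hC, hCB⟩ := exists_std
    (P := fun C : M => ∀ n : R.K, n.1 ∈ₘ C ↔ ∃ a, R.Counts n a ∧ a ∈ₘ B) (by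
      obtain ⟨C, -, hC⟩ := exists_set (R := R) (fun n => ∃ a, R.Counts n a ∧ a ∈ₘ B)
      exact ⟨C, hC⟩)
  exact ⟨C, hC, fun n hn hnat => by
    rw [hCB]; exact ⟨(key n hn).1, (key n hn).2 hnat⟩⟩

/-! ### Standard parts of limited reals -/

/-- An injective coding of pairs of natural numbers. -/
def code (a b : R.K) : R.K := (a + b) * (a + b) + a

instance instDefCode {A : Set M} [StdSub A] {α : Type u} [Enc M α] [EncRange A α]
    (f g : α → R.K) [hf : DefFun A f] [hg : DefFun A g] :
    DefFun A (no_index (fun a => code (f a) (g a))) := by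
  unfold code; infer_instance

instance instStdCode (x y : R.K) [Std x] [Std y] : Std (code x y) := std_of_def _

theorem IsNat.code {a b : R.K} (ha : R.IsNat a) (hb : R.IsNat b) : R.IsNat (code a b) :=
  ((ha.add hb).mul (ha.add hb)).add ha

/-- The code lies between `(a + b)²` and `(a + b + 1)²`, the latter excluded, so it determines `a +
b`, and then `a`. -/
theorem code_inj {a b a' b' : R.K} (ha : R.IsNat a) (hb : R.IsNat b) (ha' : R.IsNat a')
    (hb' : R.IsNat b') (h : code a b = code a' b') : a = a' ∧ b = b' := by
  unfold code at h
  have key : ∀ {a b a' b' : R.K}, R.IsNat a → R.IsNat b → R.IsNat a' → R.IsNat b' →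
      (a + b) * (a + b) + a = (a' + b') * (a' + b') + a' → ¬ a + b < a' + b' := by
    intro a b a' b' ha hb ha' hb' h hlt
    have h1 := (ha.add hb).succ_le (ha'.add hb') hlt
    have := ha.nonneg; have := hb.nonneg; have := ha'.nonneg; have := hb'.nonneg
    nlinarith
  have h1 := key ha hb ha' hb' h
  have h2 := key ha' hb' ha hb h.symm
  have h3 : a + b = a' + b' := le_antisymm (not_lt.1 h2) (not_lt.1 h1)
  rw [h3] at h
  have h4 : a = a' := by linarith
  exact ⟨h4, by linarith⟩

/-- The Dedekind cut of rationals below `x` is coded by a set of natural numbers. Standard Part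
yields a standard `B` with the same standard codes, and `r` is the supremum of the rationals coded
in `B`. Transfer bounds these by the standard bound of `|x|`, so `r` exists and is standard.
Standard rationals coded in `B` are exactly those below `x`, which forces `x ≈ r`. -/
theorem Limited.exists_near {x : R.K} (hx : R.Limited x) : ∃ r : R.K, Std r ∧ R.Near x r := by
  obtain ⟨b, hb, hxb⟩ := limited_iff.1 hx
  obtain ⟨B, hB, hBP⟩ := exists_std_nat_set (R := R) (fun n => ∃ p q m : R.K,
    R.IsNat p ∧ R.IsNat q ∧ R.IsNat m ∧ n = code (code p q) m ∧ (p - q) / (m + 1) < x)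
  have hmem : ∀ p q m : R.K, Std p → Std q → Std m → R.IsNat p → R.IsNat q → R.IsNat m →
      ((code (code p q) m).1 ∈ₘ B ↔ (p - q) / (m + 1) < x) := by
    intro p q m _ _ _ hp hq hm
    rw [hBP _ inferInstance ((hp.code hq).code hm)]
    constructor
    · rintro ⟨p', q', m', hp', hq', hm', h, h'⟩
      obtain ⟨h1, rfl⟩ := code_inj (hp.code hq) hm (hp'.code hq') hm' h
      obtain ⟨rfl, rfl⟩ := code_inj hp hq hp' hq' h1
      exact h'
    · exact fun h => ⟨p, q, m, hp, hq, hm, rfl, h⟩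
  set T : R.K → Prop := fun t => ∃ p q m : R.K, R.IsNat p ∧ R.IsNat q ∧ R.IsNat m ∧
    (code (code p q) m).1 ∈ₘ B ∧ t = (p - q) / (m + 1) with hT
  have hTstd : ∀ t, Std t → T t → t < x := by
    intro t ht h
    obtain ⟨p, hp, q, m, h1, h2, h3, h4, h5⟩ := exists_std (P := fun p : R.K => ∃ q m : R.K,
      R.IsNat p ∧ R.IsNat q ∧ R.IsNat m ∧ (code (code p q) m).1 ∈ₘ B ∧ t = (p - q) / (m + 1)) h
    obtain ⟨q, hq, m, h1, h2, h3, h4, h5⟩ := exists_std (P := fun q : R.K => ∃ m : R.K,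
      R.IsNat p ∧ R.IsNat q ∧ R.IsNat m ∧ (code (code p q) m).1 ∈ₘ B ∧ t = (p - q) / (m + 1))
      ⟨q, m, h1, h2, h3, h4, h5⟩
    obtain ⟨m, hm, h1, h2, h3, h4, h5⟩ := exists_std (P := fun m : R.K =>
      R.IsNat p ∧ R.IsNat q ∧ R.IsNat m ∧ (code (code p q) m).1 ∈ₘ B ∧ t = (p - q) / (m + 1))
      ⟨m, h1, h2, h3, h4, h5⟩
    rw [h5]
    exact (hmem p q m hp hq hm h1 h2 h3).1 h4
  have hbtw : ∀ y z : R.K, Std y → Std z → y < z → z < x → ∃ t, T t ∧ y < t := by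
    intro y z _ _ hyz hzx
    obtain ⟨p, hp, q, m, h1, h2, h3, h4, h5⟩ := exists_std (P := fun p : R.K => ∃ q m : R.K,
      R.IsNat p ∧ R.IsNat q ∧ R.IsNat m ∧ y < (p - q) / (m + 1) ∧ (p - q) / (m + 1) < z)
      (exists_rat_btwn hyz)
    obtain ⟨q, hq, m, h1, h2, h3, h4, h5⟩ := exists_std (P := fun q : R.K => ∃ m : R.K,
      R.IsNat p ∧ R.IsNat q ∧ R.IsNat m ∧ y < (p - q) / (m + 1) ∧ (p - q) / (m + 1) < z)
      ⟨q, m, h1, h2, h3, h4, h5⟩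
    obtain ⟨m, hm, h1, h2, h3, h4, h5⟩ := exists_std (P := fun m : R.K =>
      R.IsNat p ∧ R.IsNat q ∧ R.IsNat m ∧ y < (p - q) / (m + 1) ∧ (p - q) / (m + 1) < z)
      ⟨m, h1, h2, h3, h4, h5⟩
    exact ⟨_, ⟨p, q, m, h1, h2, h3, (hmem p q m hp hq hm h1 h2 h3).2 (h5.trans hzx), rfl⟩, h4⟩
  have hTdef : DefPred (stdSet M) T := by rw [hT]; infer_instance
  have hTdef' : DefPred (Set.univ : Set M) T := by rw [hT]; infer_instance
  rw [abs_le] at hxb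
  have hTb : ∀ t, T t → t ≤ b :=
    transfer fun t ht h => ((hTstd t ht h).trans_le hxb.2).le
  obtain ⟨t0, ht0, -⟩ := hbtw (-b - 2) (-b - 1) inferInstance inferInstance (by linarith)
    (by linarith)
  obtain ⟨r, hr1, hr2⟩ := exists_lub T ⟨t0, ht0⟩ b hTb
  have hrT : ∀ {α : Type u} [Enc M α] [EncRange (stdSet M) α] (f : α → R.K)
      [DefFun (stdSet M) f], DefPred (stdSet M) (fun a => T (f a)) :=
    fun f _ => hTdef.comp inferInstance
  have hr : Std r := std_of_unique
    (fun r => (∀ x, T x → x ≤ r) ∧ ∀ d, (∀ x, T x → x ≤ d) → r ≤ d) ⟨hr1, hr2⟩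
    fun s hs => le_antisymm (hs.2 r hr1) (hr2 s hs.1)
  refine ⟨r, hr, near_iff.2 fun e he he0 => ?_⟩
  rw [abs_lt]
  constructor
  · obtain ⟨t, ht, hTt, htr⟩ := exists_std (P := fun t => T t ∧ r - e < t) (by
      by_contra hc
      push Not at hc
      linarith [hr2 (r - e) hc])
    linarith [hTstd t ht hTt]
  · by_contra hc
    obtain ⟨t, hTt, h⟩ := hbtw r (r + e / 2) inferInstance inferInstance (by linarith)
      (by linarith)
    linarith [hr1 t hTt]

end RealField

namespace RealField

variable {M : Type u} [SPOT M] {R : RealField M}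

/-! ### Shadows of internal relations -/

/-- `n` is the code of the rational number `a`. -/
def RatCode (n a : R.K) : Prop :=
  ∃ p q m : R.K, R.IsNat p ∧ R.IsNat q ∧ R.IsNat m ∧ n = code (code p q) m ∧ a = (p - q) / (m + 1)

instance instDefRatCode {A : Set M} [StdSub A] {α : Type u} [Enc M α] [EncRange A α]
    (f g : α → R.K) [hf : DefFun A f] [hg : DefFun A g] :
    DefPred A (no_index (fun a => RatCode (f a) (g a))) := by
  have : DefPred A (fun p : R.K × R.K => RatCode p.1 p.2) := by unfold RatCode; infer_instance
  exact this.comp (f := fun a => (f a, g a)) inferInstance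

theorem RatCode.isNat {n a : R.K} (h : RatCode n a) : R.IsNat n := by
  obtain ⟨p, q, m, hp, hq, hm, rfl, -⟩ := h
  exact (hp.code hq).code hm

theorem RatCode.unique {n a b : R.K} (h : RatCode n a) (h' : RatCode n b) : a = b := by
  obtain ⟨p, q, m, hp, hq, hm, rfl, rfl⟩ := h
  obtain ⟨p', q', m', hp', hq', hm', e, rfl⟩ := h'
  obtain ⟨h1, rfl⟩ := code_inj (hp.code hq) hm (hp'.code hq') hm' e
  obtain ⟨rfl, rfl⟩ := code_inj hp hq hp' hq' h1
  rfl

theorem exists_ratCode_btwn {x y : R.K} (h : x < y) : ∃ n a, RatCode n a ∧ x < a ∧ a < y := by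
  obtain ⟨p, q, m, h1, h2, h3, h4, h5⟩ := exists_rat_btwn h
  exact ⟨_, _, ⟨p, q, m, h1, h2, h3, rfl, rfl⟩, h4, h5⟩

/-- `n` is the code of the rational box `(a, b) × (c, d)`. -/
def BoxCode (n a b c d : R.K) : Prop :=
  ∃ n₁ n₂ n₃ n₄ : R.K, RatCode n₁ a ∧ RatCode n₂ b ∧ RatCode n₃ c ∧ RatCode n₄ d ∧
    n = code (code n₁ n₂) (code n₃ n₄)

instance instDefBoxCode {A : Set M} [StdSub A] {α : Type u} [Enc M α] [EncRange A α]
    (f g k l m : α → R.K) [hf : DefFun A f] [hg : DefFun A g] [hk : DefFun A k] [hl : DefFun A l]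
    [hm : DefFun A m] :
    DefPred A (no_index (fun a => BoxCode (f a) (g a) (k a) (l a) (m a))) := by
  have : DefPred A (fun p : R.K × R.K × R.K × R.K × R.K =>
      BoxCode p.1 p.2.1 p.2.2.1 p.2.2.2.1 p.2.2.2.2) := by unfold BoxCode; infer_instance
  exact this.comp (f := fun a => (f a, g a, k a, l a, m a)) inferInstance

theorem BoxCode.isNat {n a b c d : R.K} (h : BoxCode n a b c d) : R.IsNat n := by
  obtain ⟨_, _, _, _, h1, h2, h3, h4, rfl⟩ := h
  exact (h1.isNat.code h2.isNat).code (h3.isNat.code h4.isNat)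

theorem BoxCode.unique {n a b c d a' b' c' d' : R.K} (h : BoxCode n a b c d)
    (h' : BoxCode n a' b' c' d') : a' = a ∧ b' = b ∧ c' = c ∧ d' = d := by
  obtain ⟨_, _, _, _, h1, h2, h3, h4, rfl⟩ := h
  obtain ⟨_, _, _, _, h1', h2', h3', h4', e⟩ := h'
  obtain ⟨e1, e2⟩ := code_inj (h1.isNat.code h2.isNat) (h3.isNat.code h4.isNat)
    (h1'.isNat.code h2'.isNat) (h3'.isNat.code h4'.isNat) e
  obtain ⟨rfl, rfl⟩ := code_inj h1.isNat h2.isNat h1'.isNat h2'.isNat e1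
  obtain ⟨rfl, rfl⟩ := code_inj h3.isNat h4.isNat h3'.isNat h4'.isNat e2
  exact ⟨h1'.unique h1, h2'.unique h2, h3'.unique h3, h4'.unique h4⟩

/-- Standard Part is not available for sets of pairs of reals, so `Q` is replaced by the set of
codes of rational boxes that meet it. With `B` the standard part of that set, `Y` consists of the
points all of whose rational neighbourhoods have their codes in `B`. -/
theorem exists_shadow {θ : R.K} (hθ : 0 < θ) (hθ0 : R.Near θ 0) (Q : R.K → R.K → Prop)
    [hQ : DefPred (Set.univ : Set M) (fun p : R.K × R.K => Q p.1 p.2)] :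
    ∃ Y : M, Std Y ∧ (∀ p, p ∈ₘ Y → ∃ x v : R.K, 0 ≤ x ∧ IsPair p x.1 v.1) ∧
      ∀ x v : R.K, Std x → Std v → 0 ≤ x →
        (AppRel Y x.1 v.1 ↔ ∃ x' v', Q x' v' ∧ R.Near x x' ∧ R.Near v v') := by
  have hQi : ∀ {α : Type u} [Enc M α] [EncRange (Set.univ : Set M) α] (f g : α → R.K)
      [DefFun (Set.univ : Set M) f] [DefFun (Set.univ : Set M) g],
      DefPred (Set.univ : Set M) (no_index (fun a => Q (f a) (g a))) :=
    fun f g _ _ => hQ.comp (f := fun a => (f a, g a)) inferInstance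
  obtain ⟨B, hB, hBP⟩ := exists_std_nat_set (R := R) (fun n => ∃ a b c d : R.K,
    BoxCode n a b c d ∧ ∃ x v, Q x v ∧ a < x ∧ x < b ∧ c < v ∧ v < d)
  have hmem : ∀ n a b c d : R.K, Std n → BoxCode n a b c d →
      (n.1 ∈ₘ B ↔ ∃ x v, Q x v ∧ a < x ∧ x < b ∧ c < v ∧ v < d) := by
    intro n a b c d _ h
    rw [hBP n inferInstance h.isNat]
    constructor
    · rintro ⟨a', b', c', d', h', hx⟩
      obtain ⟨rfl, rfl, rfl, rfl⟩ := h.unique h'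
      exact hx
    · exact fun hx => ⟨a, b, c, d, h, hx⟩
  obtain ⟨Y, hY, hYp⟩ := exists_std (P := fun Y : M => ∀ p, p ∈ₘ Y ↔ ∃ x v : R.K,
      IsPair p x.1 v.1 ∧ (0 ≤ x ∧ ∀ n a b c d : R.K, BoxCode n a b c d → a < x → x < b → c < v →
        v < d → n.1 ∈ₘ B)) (by
    obtain ⟨Y, hY, -⟩ := exists_graph (R := R) (fun x v => 0 ≤ x ∧ ∀ n a b c d : R.K,
      BoxCode n a b c d → a < x → x < b → c < v → v < d → n.1 ∈ₘ B)
    exact ⟨Y, hY⟩)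
  refine ⟨Y, hY, fun p hp => ?_, fun x v hx hv hx0 => ?_⟩
  · obtain ⟨x, v, h, h0, -⟩ := (hYp p).1 hp
    exact ⟨x, v, h0, h⟩
  have hYx : AppRel Y x.1 v.1 ↔ ∀ n a b c d : R.K, BoxCode n a b c d → a < x → x < b → c < v →
        v < d → n.1 ∈ₘ B := by
    obtain ⟨p, hp⟩ := exists_isPair x.1 v.1
    rw [appRel_iff hp, hYp]
    constructor
    · rintro ⟨x', v', h, -, h'⟩
      obtain ⟨e1, e2⟩ := hp.inj h
      rwa [← Subtype.ext e1, ← Subtype.ext e2] at h'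
    · exact fun h => ⟨x, v, hp, hx0, h⟩
  rw [hYx]
  constructor
  · intro h
    -- For each standard `e`, a standard rational box around `(x, v)` within distance `e` meets `Q`.
    -- Overspill makes the distance infinitesimal.
    obtain ⟨e, he, he0, x', v', hq, h1, h2⟩ := exists_infinitesimal hθ hθ0
      (fun e : R.K => ∃ x' v', Q x' v' ∧ |x - x'| < e ∧ |v - v'| < e)
      (by
        rintro e e' - ⟨x', v', hq, h1, h2⟩ hle
        exact ⟨x', v', hq, h1.trans_le hle, h2.trans_le hle⟩)
      (by
        intro e he he0
        obtain ⟨⟨n, a, b, c, d⟩, hs, hbox, g1, g2, g3, g4, g5, g6, g7, g8⟩ := exists_std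
          (P := fun q : R.K × R.K × R.K × R.K × R.K =>
            BoxCode q.1 q.2.1 q.2.2.1 q.2.2.2.1 q.2.2.2.2 ∧ x - e < q.2.1 ∧ q.2.1 < x ∧
            x < q.2.2.1 ∧ q.2.2.1 < x + e ∧ v - e < q.2.2.2.1 ∧ q.2.2.2.1 < v ∧
            v < q.2.2.2.2 ∧ q.2.2.2.2 < v + e) (by
            obtain ⟨n₁, a, k1, l1, m1⟩ := exists_ratCode_btwn (show x - e < x by linarith)
            obtain ⟨n₂, b, k2, l2, m2⟩ := exists_ratCode_btwn (show x < x + e by linarith)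
            obtain ⟨n₃, c, k3, l3, m3⟩ := exists_ratCode_btwn (show v - e < v by linarith)
            obtain ⟨n₄, d, k4, l4, m4⟩ := exists_ratCode_btwn (show v < v + e by linarith)
            exact ⟨(_, a, b, c, d), ⟨n₁, n₂, n₃, n₄, k1, k2, k3, k4, rfl⟩, l1, m1, l2, m2, l3, m3,
              l4, m4⟩)
        dsimp only at hbox g1 g2 g3 g4 g5 g6 g7 g8
        have hn : Std n := (std_prod_iff.1 hs).1
        obtain ⟨x', v', hq, f1, f2, f3, f4⟩ :=
          (hmem n a b c d hn hbox).1 (h n a b c d hbox g2 g3 g6 g7)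
        refine ⟨x', v', hq, ?_, ?_⟩ <;> rw [abs_lt] <;> constructor <;> linarith)
    refine ⟨x', v', hq, he0.of_abs_le ?_, he0.of_abs_le ?_⟩ <;>
      rw [sub_zero, abs_of_pos he] <;> linarith
  · rintro ⟨x', v', hq, hxx, hvv⟩
    -- A standard open box containing `(x, v)` also contains the infinitely close point of `Q`;
    -- Transfer passes from standard boxes to all boxes.
    have key := transfer (M := M) (P := fun q : R.K × R.K × R.K × R.K × R.K =>
      BoxCode q.1 q.2.1 q.2.2.1 q.2.2.2.1 q.2.2.2.2 → q.2.1 < x → x < q.2.2.1 → q.2.2.2.1 < v →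
        v < q.2.2.2.2 → q.1.1 ∈ₘ B) (by
      rintro ⟨n, a, b, c, d⟩ hs hbox h1 h2 h3 h4
      dsimp only at hbox h1 h2 h3 h4 ⊢
      simp only [std_prod_iff] at hs
      obtain ⟨hn, ha, hb, hc, hd⟩ := hs
      refine (hmem n a b c d hn hbox).2 ⟨x', v', hq, ?_, ?_, ?_, ?_⟩
      · exact Near.lt (Near.refl a) hxx.symm h1
      · exact Near.lt hxx.symm (Near.refl b) h2
      · exact Near.lt (Near.refl c) hvv.symm h3
      · exact Near.lt hvv.symm (Near.refl d) h4)
    intro n a b c d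
    exact key (n, a, b, c, d)

/-- Two shadows are standard and have the same standard pairs, so by Transfer they have the same
pairs, and they contain nothing else. -/
theorem IsShadow.unique {N x₀ : R.K} {u Y Y' : M} (h : R.IsShadow N x₀ u Y)
    (h' : R.IsShadow N x₀ u Y') : Y = Y' := by
  have hY : Std Y := std_iff.2 h.1
  have hY' : Std Y' := std_iff.2 h'.1
  have key := transfer (M := M) (P := fun q : R.K × R.K => 0 ≤ q.1 →
    (AppRel Y q.1.1 q.2.1 ↔ AppRel Y' q.1.1 q.2.1)) (by
    rintro ⟨x, v⟩ hs h0
    have hs' := std_prod_iff.1 hs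
    rw [h.2.2 x v (std_subtype_iff.1 hs'.1) (std_subtype_iff.1 hs'.2) h0,
      h'.2.2 x v (std_subtype_iff.1 hs'.1) (std_subtype_iff.1 hs'.2) h0])
  refine SPOT.extensionality _ _ fun p => ⟨fun hp => ?_, fun hp => ?_⟩
  · obtain ⟨x, v, h0, hpair⟩ := h.2.1 p hp
    exact (appRel_iff hpair).1 ((key (x, v) h0).1 ((appRel_iff hpair).2 hp))
  · obtain ⟨x, v, h0, hpair⟩ := h'.2.1 p hp
    exact (appRel_iff hpair).1 ((key (x, v) h0).2 ((appRel_iff hpair).2 hp))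

theorem exists_isShadow {N x₀ : R.K} {u : M} (hN : 0 < N) (hN' : ¬ R.Limited N) :
    ∃ Y, R.IsShadow N x₀ u Y := by
  obtain ⟨Y, h1, h2, h3⟩ := exists_shadow (R := R) (one_div_pos.2 hN) (near_one_div hN hN')
    (fun x v => ∃ k, R.IsNat k ∧ k < N ^ 2 ∧ AppRel u k.1 v.1 ∧ x = x₀ + k * (1 / N))
  refine ⟨Y, std_iff.1 h1, h2, fun x v hx hv h0 => ?_⟩
  rw [h3 x v (std_subtype_iff.2 hx) (std_subtype_iff.2 hv) h0]
  constructor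
  · rintro ⟨_, v', ⟨k, hk, hkN, hu, rfl⟩, h4, h5⟩
    exact ⟨k, v', hk, hkN, hu, h4, h5⟩
  · rintro ⟨k, v', hk, hkN, hu, h4, h5⟩
    exact ⟨_, v', ⟨k, hk, hkN, hu, rfl⟩, h4, h5⟩

/-! ### Internal functions -/

instance instDefIte {A : Set M} {α β : Type u} [Enc M α] [EncRange A α] [Enc M β] [EncRange A β]
    (P : α → Prop) {dec : ∀ a, Decidable (P a)} (f g : α → β) [hP : DefPred A P] [hf : DefFun A f]
        [hg : DefFun A g] :
    DefFun A (no_index (fun a => if P a then f a else g a)) where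
  out := DefPred.congr
    (P := fun p : α × β => (P p.1 ∧ f p.1 = p.2) ∨ (¬ P p.1 ∧ g p.1 = p.2)) (by
      have h1 : DefPred A (fun p : α × β => P p.1) := hP.comp (f := Prod.fst) inferInstance
      have h2 : DefPred A (fun p : α × β => f p.1 = p.2) := hf.out
      have h3 : DefPred A (fun p : α × β => g p.1 = p.2) := hg.out
      exact (h1.and h2).or (h1.not.and h3)) fun p => by by_cases h : P p.1 <;> simp [h]

theorem IsFunOn.appRel_iff {f : M} {D : Set R.K} (h : R.IsFunOn f D) {x v : R.K} (hx : x ∈ D) :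
    AppRel f x.1 v.1 ↔ R.val f x = v := (val_eq_iff (h.2 x hx)).symm

theorem IsFunOn.mem_of_appRel {f : M} {D : Set R.K} (h : R.IsFunOn f D) {x v : R.K}
    (hx : AppRel f x.1 v.1) : x ∈ D := by
  obtain ⟨p, hp, hpf⟩ := hx
  obtain ⟨x', hx', v', hp'⟩ := h.1 p hpf
  rwa [Subtype.ext (hp.inj hp').1]

theorem IsFunOn.ext {f g : M} {D : Set R.K} (hf : R.IsFunOn f D) (hg : R.IsFunOn g D)
    (h : ∀ x ∈ D, R.val f x = R.val g x) : f = g := by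
  refine SPOT.extensionality _ _ fun p => ⟨fun hp => ?_, fun hp => ?_⟩
  · obtain ⟨x, hx, v, hpair⟩ := hf.1 p hp
    rw [← _root_.appRel_iff hpair, hf.appRel_iff hx, h x hx, ← hg.appRel_iff hx,
      _root_.appRel_iff hpair] at *
    exact hp
  · obtain ⟨x, hx, v, hpair⟩ := hg.1 p hp
    rw [← _root_.appRel_iff hpair, hg.appRel_iff hx, ← h x hx, ← hf.appRel_iff hx,
      _root_.appRel_iff hpair] at *
    exact hp

theorem exists_fun (D : R.K → Prop) (g : R.K → R.K) [hD : DefPred (Set.univ : Set M) D]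
    [hg : DefFun (Set.univ : Set M) g] :
    ∃ f : M, R.IsFunOn f {x | D x} ∧ ∀ x, D x → R.val f x = g x := by
  have h1 : DefPred (Set.univ : Set M) (fun p : R.K × R.K => D p.1) :=
    hD.comp (f := Prod.fst) inferInstance
  have h2 : DefFun (Set.univ : Set M) (fun p : R.K × R.K => g p.1) :=
    hg.comp (f := Prod.fst) inferInstance
  obtain ⟨f, hf1, hf2⟩ := exists_graph (R := R) (fun x v => D x ∧ v = g x)
  have hfun : R.IsFunOn f {x | D x} := by
    refine ⟨fun p hp => ?_, fun x hx => ⟨g x, (hf2 _ _).2 ⟨hx, rfl⟩, fun v hv => ?_⟩⟩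
    · obtain ⟨x, v, hpair, hx, -⟩ := (hf1 p).1 hp
      exact ⟨x, hx, v, hpair⟩
    · exact ((hf2 _ _).1 hv).2
  exact ⟨f, hfun, fun x hx => (hfun.appRel_iff hx).1 ((hf2 _ _).2 ⟨hx, rfl⟩)⟩

/-- Recursion along the natural numbers up to `n`. -/
theorem exists_rec (y : R.K) (G : R.K → R.K → R.K)
    [hG : DefFun (Set.univ : Set M) (fun p : R.K × R.K => G p.1 p.2)] {n : R.K}
    (hn : R.IsNat n) : ∃ f : M, R.val f 0 = y ∧
      ∀ k, R.IsNat k → k < n → R.val f (k + 1) = G k (R.val f k) := by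
  classical
  have hGi : ∀ {α : Type u} [Enc M α] [EncRange (Set.univ : Set M) α] (f g : α → R.K)
      [DefFun (Set.univ : Set M) f] [DefFun (Set.univ : Set M) g],
      DefFun (Set.univ : Set M) (no_index (fun a => G (f a) (g a))) :=
    fun f g _ _ => hG.comp (f := fun a => (f a, g a)) inferInstance
  refine IsNat.induction (P := fun n => ∃ f : M, R.val f 0 = y ∧
      ∀ k, R.IsNat k → k < n → R.val f (k + 1) = G k (R.val f k)) ?_ ?_ hn
  · obtain ⟨f, -, hf⟩ := exists_fun (R := R) (fun _ => True) (fun _ => y)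
    exact ⟨f, hf 0 trivial, fun k hk h => absurd h (not_lt.2 hk.nonneg)⟩
  · rintro n hn ⟨f, hf0, hf⟩
    -- Every index beyond `n` receives the next value; only the one at `n + 1` matters.
    obtain ⟨g, -, hg⟩ := exists_fun (R := R) (fun _ => True)
      (fun k => if k ≤ n then R.val f k else G n (R.val f n))
    refine ⟨g, ?_, fun k hk hkn => ?_⟩
    · rw [hg 0 trivial, if_pos hn.nonneg, hf0]
    · have hkn' : k ≤ n := by linarith [hk.succ_le hn.succ hkn]
      rw [hg _ trivial, hg _ trivial, if_pos hkn']
      rcases hkn'.lt_or_eq with h | rfl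
      · rw [if_pos (hk.succ_le hn h), hf k hk h]
      · rw [if_neg (by linarith)]

/-! ### Euler sequences -/

theorem IsContinuousRHS.appRel₂_iff {F : M} (hF : R.IsContinuousRHS F) {x y v : R.K}
    (hx : 0 ≤ x) : AppRel₂ F x.1 y.1 v.1 ↔ R.val₂ F x y = v := (val₂_eq_iff (hF.2.1 x y hx)).symm

theorem IsNat.mesh_nonneg {k N x₀ : R.K} (hk : R.IsNat k) (hN : 0 < N) (hx₀ : 0 ≤ x₀) :
    0 ≤ x₀ + k * (1 / N) := by
  have := hk.nonneg
  positivity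

theorem isEuler_iff {F ep u : M} {N x₀ y₀ : R.K} (hF : R.IsContinuousRHS F)
    (hNnat : R.IsNat N) (hN : 0 < N) (hx₀ : 0 ≤ x₀) (hep : R.IsPerturbation N ep) :
    R.IsEuler F N x₀ y₀ ep u ↔ R.IsFunOn u {k | R.IsNat k ∧ k ≤ N ^ 2} ∧ R.val u 0 = y₀ ∧
      ∀ k, R.IsNat k → k < N ^ 2 → R.val u (k + 1) = R.val u k +
        (R.val₂ F (x₀ + k * (1 / N)) (R.val u k) + R.val ep k) * (1 / N) := by
  have hN2 : R.IsNat (N ^ 2) := by rw [pow_two]; exact hNnat.mul hNnat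
  unfold IsEuler
  refine and_congr_right fun hu => and_congr ?_ (forall_congr' fun k => forall_congr' fun hk =>
    forall_congr' fun hkN => ?_)
  · exact hu.appRel_iff ⟨isNat_zero, hN2.nonneg⟩
  · have hk1 : k + 1 ∈ {k | R.IsNat k ∧ k ≤ N ^ 2} := ⟨hk.succ, hk.succ_le hN2 hkN⟩
    have hk0 : k ∈ {k | R.IsNat k ∧ k ≤ N ^ 2} := ⟨hk, hkN.le⟩
    have hke : k ∈ {k | R.IsNat k ∧ k < N ^ 2} := ⟨hk, hkN⟩
    simp only [hu.appRel_iff hk0, hu.appRel_iff hk1, hep.1.appRel_iff hke,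
      hF.appRel₂_iff (hk.mesh_nonneg hN hx₀)]
    constructor
    · intro h
      exact h _ _ _ rfl rfl rfl
    · rintro h v e d rfl rfl rfl
      exact h

theorem exists_isEuler {F ep : M} {N x₀ y₀ : R.K} (hF : R.IsContinuousRHS F)
    (hNnat : R.IsNat N) (hN : 0 < N) (hx₀ : 0 ≤ x₀) (hep : R.IsPerturbation N ep) :
    ∃ u, R.IsEuler F N x₀ y₀ ep u := by
  have hN2 : R.IsNat (N ^ 2) := by rw [pow_two]; exact hNnat.mul hNnat
  obtain ⟨f, hf0, hf⟩ := exists_rec (R := R) y₀ (fun k t : R.K => t +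
    (R.val₂ F (x₀ + k * ((1 : R.K) / N)) t + R.val ep k) * ((1 : R.K) / N)) hN2
  obtain ⟨u, hu, huf⟩ := exists_fun (R := R) (fun k => R.IsNat k ∧ k ≤ N ^ 2) (fun k => R.val f k)
  refine ⟨u, (isEuler_iff hF hNnat hN hx₀ hep).2 ⟨hu, ?_, fun k hk hkN => ?_⟩⟩
  · rw [huf 0 ⟨isNat_zero, hN2.nonneg⟩, hf0]
  · rw [huf _ ⟨hk.succ, hk.succ_le hN2 hkN⟩, huf _ ⟨hk, hkN.le⟩]
    exact hf k hk hkN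

theorem IsEuler.unique {F ep u u' : M} {N x₀ y₀ : R.K} (hF : R.IsContinuousRHS F)
    (hNnat : R.IsNat N) (hN : 0 < N) (hx₀ : 0 ≤ x₀) (hep : R.IsPerturbation N ep)
    (h : R.IsEuler F N x₀ y₀ ep u) (h' : R.IsEuler F N x₀ y₀ ep u') : u = u' := by
  have hN2 : R.IsNat (N ^ 2) := by rw [pow_two]; exact hNnat.mul hNnat
  obtain ⟨hu, hu0, hus⟩ := (isEuler_iff hF hNnat hN hx₀ hep).1 h
  obtain ⟨hu', hu0', hus'⟩ := (isEuler_iff hF hNnat hN hx₀ hep).1 h'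
  refine hu.ext hu' fun x hx => ?_
  refine IsNat.induction (P := fun k => k ≤ N ^ 2 → R.val u k = R.val u' k) (fun _ => ?_) ?_
    hx.1 hx.2
  · rw [hu0, hu0']
  · intro k hk ih hkN
    have hkN' : k < N ^ 2 := by linarith
    rw [hus k hk hkN', hus' k hk hkN', ih hkN'.le]

end RealField

namespace RealField

variable {M : Type u} [SPOT M] {R : RealField M}

/-! ### Continuity of the right-hand side -/

theorem Near.abs {x y : R.K} (h : R.Near x y) : R.Near |x| |y| :=
  h.of_abs_le (abs_abs_sub_abs_le x y)

theorem IsContinuousRHS.continuous {F : M} (hF : R.IsContinuousRHS F) {x y : R.K} (hx : 0 ≤ x)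
    {e : R.K} (he : 0 < e) : ∃ δ : R.K, 0 < δ ∧ ∀ x' y' : R.K, 0 ≤ x' → |x' - x| < δ →
      |y' - y| < δ → |R.val₂ F x' y' - R.val₂ F x y| < e := by
  obtain ⟨δ, hδ, h⟩ := hF.2.2 x y _ hx ((hF.appRel₂_iff hx).2 rfl) e he
  exact ⟨δ, hδ, fun x' y' hx' h1 h2 => h x' y' _ hx' ((hF.appRel₂_iff hx').2 rfl) h1 h2⟩

theorem IsContinuousRHS.std_continuous {F : M} [Std F] (hF : R.IsContinuousRHS F) {x y : R.K}
    [Std x] [Std y] (hx : 0 ≤ x) {e : R.K} [Std e] (he : 0 < e) :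
    ∃ δ : R.K, Std δ ∧ 0 < δ ∧ ∀ x' y' : R.K, 0 ≤ x' → |x' - x| < δ →
      |y' - y| < δ → |R.val₂ F x' y' - R.val₂ F x y| < e :=
  exists_std (P := fun δ : R.K => 0 < δ ∧ ∀ x' y' : R.K, 0 ≤ x' → |x' - x| < δ →
      |y' - y| < δ → |R.val₂ F x' y' - R.val₂ F x y| < e) (hF.continuous hx he)

/-! ### Estimates for Euler sequences -/

/-- A bootstrap: the slopes `g i` are controlled only while the sequence has drifted at most `b`
from its value at `j`. As long as they are controlled, the drift is at most `|m| + C` times the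
elapsed time, which `hb` keeps below `b`. Induction on `k` closes the circle. -/
theorem euler_bound {N x₀ m C b T : R.K} (hN : 0 < N) (hC : 0 ≤ C) {u : M} {g : R.K → R.K}
    [DefFun (Set.univ : Set M) g] {j L : R.K} (hj : R.IsNat j)
    (hu : ∀ k, R.IsNat k → k < L → R.val u (k + 1) = R.val u k + g k * (1 / N))
    (hbox : ∀ i, R.IsNat i → j ≤ i → i < L → x₀ + i * (1 / N) < T →
      |R.val u i - R.val u j| ≤ b → |g i - m| ≤ C)
    (hb : (|m| + C) * (T - (x₀ + j * (1 / N))) ≤ b) {k : R.K} (hk : R.IsNat k) (hjk : j ≤ k)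
    (hkL : k ≤ L) (hkT : x₀ + k * (1 / N) < T) :
    |R.val u k - R.val u j - m * ((k - j) * (1 / N))| ≤ C * ((k - j) * (1 / N)) := by
  have hh : 0 < 1 / N := one_div_pos.2 hN
  revert hjk hkL hkT
  refine IsNat.induction (P := fun k => j ≤ k → k ≤ L → x₀ + k * (1 / N) < T →
    |R.val u k - R.val u j - m * ((k - j) * (1 / N))| ≤ C * ((k - j) * (1 / N))) ?_ ?_ hk
  · intro h1 _ _
    rw [le_antisymm h1 hj.nonneg]
    simp
  · intro k hk ih h1 h2 h3
    rcases h1.lt_or_eq with h | rfl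
    · have hjk : j ≤ k := by linarith [hj.succ_le hk.succ h]
      have hkT : x₀ + k * (1 / N) < T := by linarith
      have hkL : k < L := by linarith
      have h4 := ih hjk hkL.le hkT
      have hd : 0 ≤ (k - j) * (1 / N) := mul_nonneg (sub_nonneg.2 hjk) hh.le
      have hdT : (k - j) * (1 / N) ≤ T - (x₀ + j * (1 / N)) := by linarith
      have h5 : |R.val u k - R.val u j| ≤ (|m| + C) * ((k - j) * (1 / N)) := by
        have : |R.val u k - R.val u j| ≤ |R.val u k - R.val u j - m * ((k - j) * (1 / N))| +
            |m * ((k - j) * (1 / N))| := by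
          simpa using abs_add_le (R.val u k - R.val u j - m * ((k - j) * (1 / N)))
            (m * ((k - j) * (1 / N)))
        rw [abs_mul m, abs_of_nonneg hd] at this
        linarith
      have h6 : |R.val u k - R.val u j| ≤ b := by
        refine h5.trans (le_trans ?_ hb)
        exact mul_le_mul_of_nonneg_left hdT (add_nonneg (abs_nonneg _) hC)
      have h7 := hbox k hk hjk hkL hkT h6
      rw [hu k hk hkL]
      have : R.val u k + g k * (1 / N) - R.val u j - m * ((k + 1 - j) * (1 / N)) =
        (R.val u k - R.val u j - m * ((k - j) * (1 / N))) + (g k - m) * (1 / N) := by ring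
      rw [this]
      refine (abs_add_le _ _).trans ?_
      rw [abs_mul, abs_of_pos hh]
      nlinarith
    · simp

/-- Take `k` to be the integer part of `x N`. Since `N` is unlimited and `x` standard, `x < N`, so
`k < N²`: the `N²` steps reach past every standard time. -/
theorem exists_mesh_near {N x₀ x : R.K} (hN : 0 < N) (hN' : ¬ R.Limited N)
    (hx₀ : R.Near x₀ 0) [Std x] (hx : 0 ≤ x) :
    ∃ k, R.IsNat k ∧ k < N ^ 2 ∧ R.Near x (x₀ + k * (1 / N)) := by
  obtain ⟨k, hk, h1, h2⟩ := exists_floor (x := x * N) (by positivity)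
  refine ⟨k, hk, ?_, ?_⟩
  · have hxN : x < N := by
      by_contra hc
      exact hN' (limited_iff.2 ⟨x, inferInstance, by rw [abs_of_pos hN]; linarith⟩)
    nlinarith
  · have h3 : R.Near x (k * (1 / N)) := (near_one_div hN hN').of_abs_le (by
      rw [sub_zero, abs_of_pos (one_div_pos.2 hN), mul_one_div, abs_of_nonneg, ← sub_nonneg]
      · have : 1 / N - (x - k / N) = (k + 1 - x * N) / N := by field_simp; ring
        rw [this]
        exact div_nonneg (by linarith) hN.le
      · rw [sub_nonneg, div_le_iff₀ hN]; exact h1)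
    simpa using hx₀.symm.add h3

/-- Near a standard point, Euler sequences have slopes close to the value of `F`. -/
theorem IsEuler.box {F ep u : M} {N x₀ y₀ : R.K} [Std F] (hF : R.IsContinuousRHS F)
    (hNnat : R.IsNat N) (hN : 0 < N) (hx₀ : 0 ≤ x₀) (hep : R.IsPerturbation N ep)
    (h : R.IsEuler F N x₀ y₀ ep u) {x v e : R.K} [Std x] [Std v] [Std e] (hx : 0 ≤ x)
    (he : 0 < e) : ∃ η : R.K, Std η ∧ 0 < η ∧ ∀ j i k : R.K, R.IsNat j → R.IsNat i → R.IsNat k →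
      |x₀ + j * (1 / N) - x| < η → |R.val u j - v| < η → j ≤ i → i ≤ k → k ≤ N ^ 2 →
      x₀ + k * (1 / N) < x + η →
      |R.val u k - R.val u i - R.val₂ F x v * ((k - i) * (1 / N))| ≤ e * ((k - i) * (1 / N)) := by
  obtain ⟨-, -, hus⟩ := (isEuler_iff hF hNnat hN hx₀ hep).1 h
  obtain ⟨δ, hδs, hδ, hcont⟩ := hF.std_continuous (y := v) hx (half_pos he)
  set m := R.val₂ F x v with hm
  have hms : Std m := by rw [hm]; infer_instance
  have hh : 0 < 1 / N := one_div_pos.2 hN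
  have hm0 := abs_nonneg m
  have hden : 0 < 2 * (|m| + e) + 1 := by linarith
  -- Chosen so that `η + 2 η (|m| + e) = δ`: the sequence starts within `η` of `v`, moves with slope
  -- at most `|m| + e` for a time below `2 η`, and so remains where `F` is within `e / 2` of `m`.
  -- The infinitesimal `ε_k` uses the other `e / 2`.
  set η := δ / (2 * (|m| + e) + 1) with hη
  have hηs : Std η := by rw [hη]; infer_instance
  have hη0 : 0 < η := by positivity
  have hηδ : η * (2 * (|m| + e) + 1) = δ := div_mul_cancel₀ _ hden.ne'
  refine ⟨η, hηs, hη0, fun j i k hj hi hk hjx hjv hji hik hkN hkx => ?_⟩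
  rw [abs_lt] at hjx
  have hηδ' : (|m| + e) * (2 * η) = δ - η := by linarith
  have hslope : ∀ i, R.IsNat i → j ≤ i → i < N ^ 2 → x₀ + i * (1 / N) < x + η →
      |R.val u i - R.val u j| ≤ δ - η →
      |R.val₂ F (x₀ + i * (1 / N)) (R.val u i) + R.val ep i - m| ≤ e := by
    intro i hi hji hiN hix hiu
    have h1 : j * (1 / N) ≤ i * (1 / N) := mul_le_mul_of_nonneg_right hji hh.le
    have h2 := hcont (x₀ + i * (1 / N)) (R.val u i) (hi.mesh_nonneg hN hx₀) (by
      have : 0 ≤ (|m| + e) * (2 * η) := by positivity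
      rw [abs_lt]; constructor <;> linarith) (by
      have : R.val u i - v = (R.val u i - R.val u j) + (R.val u j - v) := by ring
      rw [this]
      exact (abs_add_le _ _).trans_lt (by linarith))
    have h3 := near_iff.1 (hep.2 i (R.val ep i) ((hep.1.appRel_iff ⟨hi, hiN⟩).2 rfl)) (e / 2)
      inferInstance (half_pos he)
    rw [sub_zero] at h3
    have : R.val₂ F (x₀ + i * (1 / N)) (R.val u i) + R.val ep i - m =
      (R.val₂ F (x₀ + i * (1 / N)) (R.val u i) - m) + R.val ep i := by ring
    rw [this]
    exact (abs_add_le _ _).trans (by linarith)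
  have hmesh : (|m| + e) * (x + η - (x₀ + j * (1 / N))) ≤ δ - η := by
    rw [← hηδ']
    exact mul_le_mul_of_nonneg_left (by linarith) (by linarith)
  -- A first use of `euler_bound` from `j` confines the whole run to the box; a second one from `i`
  -- can then use the slope bound unconditionally.
  have hstay : ∀ l, R.IsNat l → j ≤ l → l < N ^ 2 → x₀ + l * (1 / N) < x + η →
      |R.val u l - R.val u j| ≤ δ - η := by
    intro l hl hjl hlN hlx
    have h1 := euler_bound hN he.le (g := fun i =>
      R.val₂ F (x₀ + i * ((1 : R.K) / N)) (R.val u i) + R.val ep i)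
          hj hus hslope hmesh hl hjl hlN.le hlx
    have hd : 0 ≤ (l - j) * (1 / N) := mul_nonneg (sub_nonneg.2 hjl) hh.le
    have h2 : |R.val u l - R.val u j| ≤ |R.val u l - R.val u j - m * ((l - j) * (1 / N))| +
        |m * ((l - j) * (1 / N))| := by
      simpa using abs_add_le (R.val u l - R.val u j - m * ((l - j) * (1 / N)))
        (m * ((l - j) * (1 / N)))
    rw [abs_mul m, abs_of_nonneg hd] at h2
    have h3 : (|m| + e) * ((l - j) * (1 / N)) ≤ (|m| + e) * (x + η - (x₀ + j * (1 / N))) :=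
      mul_le_mul_of_nonneg_left (by linarith) (by linarith)
    linarith
  exact euler_bound hN he.le (g := fun i =>
    R.val₂ F (x₀ + i * ((1 : R.K) / N)) (R.val u i) + R.val ep i)
    (b := (|m| + e) * (x + η - (x₀ + i * (1 / N)))) hi hus
    (fun l hl hil hlN hlx _ => hslope l hl (hji.trans hil) hlN hlx
      (hstay l hl (hji.trans hil) hlN hlx)) le_rfl hk hik hkN hkx

/-! ### Funnels -/

/-- The internal properties of the shadow `Y` of an Euler sequence: it starts at `(0, 0)`, and
from each of its points it continues as a function with slopes close to the values of `F`. -/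
def IsFunnel (R : RealField M) (F Y : M) : Prop :=
  (∀ w : R.K, AppRel Y (0 : R.K).1 w.1 ↔ w = 0) ∧
  ∀ x v e : R.K, 0 ≤ x → 0 < e → ∃ η : R.K, 0 < η ∧ ∀ z w z' : R.K, AppRel Y z.1 w.1 →
    |z - x| < η → |w - v| < η → z < z' → z' < x + η → ∃ w' : R.K, AppRel Y z'.1 w'.1 ∧
      |w' - w - R.val₂ F x v * (z' - z)| ≤ e * (z' - z) ∧
      ∀ w'' : R.K, AppRel Y z'.1 w''.1 → w'' = w'

theorem IsShadow.nonneg {N x₀ : R.K} {u Y : M} (h : R.IsShadow N x₀ u Y) {x v : R.K}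
    (hxv : AppRel Y x.1 v.1) : 0 ≤ x := by
  obtain ⟨p, hp, hpY⟩ := hxv
  obtain ⟨x', v', h0, hp'⟩ := h.2.1 p hpY
  rwa [Subtype.ext (hp.inj hp').1]

theorem IsShadow.appRel_iff {F ep u Y : M} {N x₀ y₀ : R.K} (hF : R.IsContinuousRHS F)
    (hNnat : R.IsNat N) (hN : 0 < N) (hx₀ : 0 ≤ x₀) (hep : R.IsPerturbation N ep)
    (hu : R.IsEuler F N x₀ y₀ ep u) (hY : R.IsShadow N x₀ u Y) {x v : R.K} [Std x] [Std v]
    (hx : 0 ≤ x) : AppRel Y x.1 v.1 ↔ ∃ k : R.K, R.IsNat k ∧ k < N ^ 2 ∧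
      R.Near x (x₀ + k * (1 / N)) ∧ R.Near v (R.val u k) := by
  have hu' := ((isEuler_iff hF hNnat hN hx₀ hep).1 hu).1
  rw [hY.2.2 x v (std_subtype_iff.1 inferInstance) (std_subtype_iff.1 inferInstance) hx]
  constructor
  · rintro ⟨k, t, hk, hkN, hut, h1, h2⟩
    rw [hu'.appRel_iff ⟨hk, hkN.le⟩] at hut
    exact ⟨k, hk, hkN, h1, hut ▸ h2⟩
  · rintro ⟨k, hk, hkN, h1, h2⟩
    exact ⟨k, _, hk, hkN, (hu'.appRel_iff ⟨hk, hkN.le⟩).2 rfl, h1, h2⟩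

/-- For `x_k ≈ 0`, the box estimate at `(0, 0)` with error `1` bounds `|y_k - y₀|` by a standard
multiple of the infinitesimal `k h`. So `0` is the only standard value of `Y` at `0`, and Transfer
covers the other values. -/
theorem IsShadow.start {F ep u Y : M} {N x₀ y₀ : R.K} [Std F] (hF : R.IsContinuousRHS F)
    (hNnat : R.IsNat N) (hN : 0 < N) (hx₀ : 0 ≤ x₀) (hep : R.IsPerturbation N ep)
    (hx₀' : R.Near x₀ 0) (hy₀ : R.Near y₀ 0)
    (hu : R.IsEuler F N x₀ y₀ ep u) (hY : R.IsShadow N x₀ u Y) (w : R.K) :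
    AppRel Y (0 : R.K).1 w.1 ↔ w = 0 := by
  have hYs : Std Y := std_iff.2 hY.1
  have hu0 := ((isEuler_iff hF hNnat hN hx₀ hep).1 hu).2.1
  refine transfer (P := fun w : R.K => AppRel Y (0 : R.K).1 w.1 ↔ w = 0) (fun w hw => ?_) w
  rw [hY.appRel_iff hF hNnat hN hx₀ hep hu le_rfl]
  constructor
  · rintro ⟨k, hk, hkN, h1, h2⟩
    obtain ⟨η, hη, hη0, hbox⟩ := hu.box hF hNnat hN hx₀ hep (x := 0) (v := 0) (e := 1) le_rfl
      one_pos
    have h3 := hbox 0 0 k isNat_zero isNat_zero hk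
      (by simpa using near_iff.1 hx₀' η hη hη0) (by simpa [hu0] using near_iff.1 hy₀ η hη hη0)
      le_rfl hk.nonneg hkN.le (by
        have := near_iff.1 h1.symm η hη hη0
        rw [sub_zero] at this
        linarith [le_abs_self (x₀ + k * (1 / N))])
    set m := R.val₂ F 0 0 with hm
    have hms : Std m := by rw [hm]; infer_instance
    have h4 : R.Near (k * (1 / N)) 0 := by simpa using h1.symm.sub hx₀'
    have h5 : R.Near ((|m| + 1) * (k * (1 / N))) ((|m| + 1) * 0) :=
      h4.mul_left (|m| + 1) (abs_of_pos (by positivity)).le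
    have h6 : R.Near (R.val u k) (R.val u 0) := by
      refine h5.of_abs_le ?_
      rw [sub_zero] at h3
      have hd : 0 ≤ k * (1 / N) := mul_nonneg hk.nonneg (one_div_pos.2 hN).le
      have : |R.val u k - R.val u 0| ≤ |R.val u k - R.val u 0 - m * (k * (1 / N))| +
        |m * (k * (1 / N))| := by
        simpa using abs_add_le (R.val u k - R.val u 0 - m * (k * (1 / N))) (m * (k * (1 / N)))
      rw [abs_mul m, abs_of_nonneg hd] at this
      rw [mul_zero, sub_zero, abs_mul, abs_of_nonneg hd,
          abs_of_pos (show 0 < |m| + 1 by positivity)]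
      linarith
    rw [hu0] at h6
    exact (h2.trans (h6.trans hy₀)).eq
  · rintro rfl
    refine ⟨0, isNat_zero, by positivity, ?_, ?_⟩
    · simpa using hx₀'.symm
    · rw [hu0]; exact hy₀.symm

/-- This is the funnel property at standard arguments. A point `(z, w)` of `Y` comes from an index
`j`, and `z'` from a later index `k`. The box estimate shows that `y_k` is limited; its standard
part is `w'`, and the slope bound passes to standard parts. -/
theorem IsShadow.step {F ep u Y : M} {N x₀ y₀ : R.K} [Std F] (hF : R.IsContinuousRHS F)
    (hNnat : R.IsNat N) (hN : 0 < N) (hN' : ¬ R.Limited N) (hx₀ : 0 ≤ x₀)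
    (hep : R.IsPerturbation N ep) (hx₀' : R.Near x₀ 0)
    (hu : R.IsEuler F N x₀ y₀ ep u) (hY : R.IsShadow N x₀ u Y) {x v e : R.K} [Std x] [Std v]
    [Std e] (hx : 0 ≤ x) (he : 0 < e) : ∃ η : R.K, Std η ∧ 0 < η ∧
      ∀ z w z' : R.K, Std z → Std w → Std z' → AppRel Y z.1 w.1 →
      |z - x| < η → |w - v| < η → z < z' → z' < x + η → ∃ w' : R.K, Std w' ∧ AppRel Y z'.1 w'.1 ∧
      |w' - w - R.val₂ F x v * (z' - z)| ≤ e * (z' - z) ∧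
      ∀ w'' : R.K, Std w'' → AppRel Y z'.1 w''.1 → w'' = w' := by
  obtain ⟨η, hη, hη0, hbox⟩ := hu.box hF hNnat hN hx₀ hep (x := x) (v := v) (e := e) hx he
  refine ⟨η, hη, hη0, fun z w z' hz hw hz' hzw hzx hwv hzz' hz'x => ?_⟩
  have hz0 := hY.nonneg hzw
  have hz'0 := hz0.trans hzz'.le
  have hh : 0 < 1 / N := one_div_pos.2 hN
  obtain ⟨j, hj, hjN, hzj, hwj⟩ := (hY.appRel_iff hF hNnat hN hx₀ hep hu hz0).1 hzw
  obtain ⟨k, hk, hkN, hzk⟩ := exists_mesh_near (x := z') hN hN' hx₀' hz'0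
  set m := R.val₂ F x v with hm
  have hms : Std m := by rw [hm]; infer_instance
  have hm0 := abs_nonneg m
  have hjx : |x₀ + j * (1 / N) - x| < η :=
    Near.lt (hzj.symm.sub (Near.refl x)).abs (Near.refl η) hzx
  have hjv : |R.val u j - v| < η :=
    Near.lt (hwj.symm.sub (Near.refl v)).abs (Near.refl η) hwv
  have hle : ∀ k, R.IsNat k → R.Near z' (x₀ + k * (1 / N)) → j ≤ k ∧
      x₀ + k * (1 / N) < x + η := by
    intro k hk hzk
    have h1 := Near.lt hzj.symm hzk.symm hzz'
    have h2 : j * (1 / N) < k * (1 / N) := by linarith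
    exact ⟨((mul_lt_mul_iff_of_pos_right hh).1 h2).le, Near.lt hzk.symm (Near.refl _) hz'x⟩
  obtain ⟨hjk, hkx⟩ := hle k hk hzk
  have h1 := hbox j j k hj hj hk hjx hjv le_rfl hjk hkN.le hkx
  have hd : R.Near ((k - j) * (1 / N)) (z' - z) := by
    have := hzk.symm.sub hzj.symm
    convert! this using 1; ring
  have hd0 : 0 ≤ (k - j) * (1 / N) := mul_nonneg (sub_nonneg.2 hjk) hh.le
  -- The bound allows `|w|` for the start, `1` for `|y_j - w|`, and slope `|m| + e` over an elapsed
  -- time of at most `z' - z + 1`.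
  have hlim : R.Limited (R.val u k) := by
    refine limited_iff.2 ⟨|w| + 1 + (|m| + e) * (z' - z + 1), inferInstance, ?_⟩
    have h2 : R.val u k = (R.val u k - R.val u j - m * ((k - j) * (1 / N))) +
      (R.val u j - w) + m * ((k - j) * (1 / N)) + w := by ring
    have h3 := near_iff.1 hwj.symm 1 inferInstance one_pos
    have h4 := near_iff.1 hd 1 inferInstance one_pos
    rw [abs_lt] at h4
    have h5 : |m * ((k - j) * (1 / N))| = |m| * ((k - j) * (1 / N)) := by
      rw [abs_mul, abs_of_nonneg hd0]
    have h6 : (|m| + e) * ((k - j) * (1 / N)) ≤ (|m| + e) * (z' - z + 1) :=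
      mul_le_mul_of_nonneg_left (by linarith) (by linarith)
    rw [h2]
    refine (abs_add_le _ _).trans ?_
    have h7 := abs_add_le ((R.val u k - R.val u j - m * ((k - j) * (1 / N))) +
      (R.val u j - w)) (m * ((k - j) * (1 / N)))
    have h8 := abs_add_le (R.val u k - R.val u j - m * ((k - j) * (1 / N))) (R.val u j - w)
    linarith
  obtain ⟨w', hw', hkw'⟩ := hlim.exists_near
  refine ⟨w', hw', (hY.appRel_iff hF hNnat hN hx₀ hep hu hz'0).2 ⟨k, hk, hkN, hzk, hkw'.symm⟩,
    ?_, ?_⟩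
  · refine Near.le (Near.abs ((hkw'.sub hwj.symm).sub (hd.mul_left |m| le_rfl)))
      (hd.mul_left |e| le_rfl) h1
  · intro w'' hw'' hzw''
    obtain ⟨l, hl, hlN, hzl, hwl⟩ := (hY.appRel_iff hF hNnat hN hx₀ hep hu hz'0).1 hzw''
    obtain ⟨hjl, hlx⟩ := hle l hl hzl
    -- Single-valuedness: two indices at times infinitely close to `z'` are separated by an
    -- infinitesimal time, so bounded slopes give infinitely close values.
    have key : ∀ l k, R.IsNat l → R.IsNat k → R.Near z' (x₀ + k * (1 / N)) →
        R.Near z' (x₀ + l * (1 / N)) → j ≤ l → k < N ^ 2 → x₀ + k * (1 / N) < x + η → l ≤ k →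
        R.Near (R.val u k) (R.val u l) := by
      intro l k hl hk hzk hzl hjl hkN hkx hlk
      have h2 := hbox j l k hj hl hk hjx hjv hjl hlk hkN.le hkx
      have h4 : R.Near ((k - l) * (1 / N)) 0 := by
        have := hzk.symm.sub hzl.symm
        convert! this using 1 <;> ring
      have h5 : R.Near ((|m| + e) * ((k - l) * (1 / N))) ((|m| + e) * 0) :=
        h4.mul_left (|m| + e) (abs_of_pos (by positivity)).le
      refine h5.of_abs_le ?_
      have hd : 0 ≤ (k - l) * (1 / N) := mul_nonneg (sub_nonneg.2 hlk) hh.le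
      have : |R.val u k - R.val u l| ≤ |R.val u k - R.val u l - m * ((k - l) * (1 / N))| +
        |m * ((k - l) * (1 / N))| := by
        simpa using abs_add_le (R.val u k - R.val u l - m * ((k - l) * (1 / N)))
          (m * ((k - l) * (1 / N)))
      rw [abs_mul m, abs_of_nonneg hd] at this
      rw [mul_zero, sub_zero, abs_mul, abs_of_nonneg hd,
          abs_of_pos (show 0 < |m| + e by positivity)]
      linarith
    have h6 : R.Near (R.val u k) (R.val u l) := by
      rcases le_total l k with h | h
      · exact key l k hl hk hzk hzl hjl hkN hkx h
      · exact (key k l hk hl hzl hzk hjk hlN hlx h).symm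
    exact (hwl.trans (h6.symm.trans hkw')).eq

/-- `step` is transferred from the inside out: with `x`, `v`, `e`, `η` standard, first the
quantifiers over points of `Y` are transferred, and then those over `x`, `v`, `e`. -/
theorem IsShadow.isFunnel {F ep u Y : M} {N x₀ y₀ : R.K} [Std F] (hF : R.IsContinuousRHS F)
    (hNnat : R.IsNat N) (hN : 0 < N) (hN' : ¬ R.Limited N) (hx₀ : 0 ≤ x₀)
    (hep : R.IsPerturbation N ep) (hx₀' : R.Near x₀ 0) (hy₀ : R.Near y₀ 0)
    (hu : R.IsEuler F N x₀ y₀ ep u) (hY : R.IsShadow N x₀ u Y) : R.IsFunnel F Y := by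
  have hYs : Std Y := std_iff.2 hY.1
  refine ⟨hY.start hF hNnat hN hx₀ hep hx₀' hy₀ hu, fun x v e => ?_⟩
  refine transfer (P := fun p : R.K × R.K × R.K => 0 ≤ p.1 → 0 < p.2.2 → ∃ η : R.K, 0 < η ∧
    ∀ z w z' : R.K, AppRel Y z.1 w.1 → |z - p.1| < η → |w - p.2.1| < η → z < z' → z' < p.1 + η →
    ∃ w' : R.K, AppRel Y z'.1 w'.1 ∧
      |w' - w - R.val₂ F p.1 p.2.1 * (z' - z)| ≤ p.2.2 * (z' - z) ∧
      ∀ w'' : R.K, AppRel Y z'.1 w''.1 → w'' = w') ?_ (x, v, e)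
  rintro ⟨x, v, e⟩ hs hx he
  dsimp only at hx he ⊢
  simp only [std_prod_iff] at hs
  obtain ⟨hxs, hvs, hes⟩ := hs
  obtain ⟨η, hη, hη0, h⟩ := hY.step hF hNnat hN hN' hx₀ hep hx₀' hu (x := x) (v := v) hx he
  refine ⟨η, hη0, fun z w z' => ?_⟩
  refine transfer (P := fun p : R.K × R.K × R.K => AppRel Y p.1.1 p.2.1.1 → |p.1 - x| < η →
    |p.2.1 - v| < η → p.1 < p.2.2 → p.2.2 < x + η → ∃ w' : R.K, AppRel Y p.2.2.1 w'.1 ∧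
      |w' - p.2.1 - R.val₂ F x v * (p.2.2 - p.1)| ≤ e * (p.2.2 - p.1) ∧
      ∀ w'' : R.K, AppRel Y p.2.2.1 w''.1 → w'' = w') ?_ (z, w, z')
  rintro ⟨z, w, z'⟩ hs h1 h2 h3 h4 h5
  dsimp only at h1 h2 h3 h4 h5 ⊢
  simp only [std_prod_iff] at hs
  obtain ⟨hzs, hws, hzs'⟩ := hs
  obtain ⟨w', hw', h6, h7, h8⟩ := h z w z' hzs hws hzs' h1 h2 h3 h4 h5
  exact ⟨w', h6, h7, transfer (P := fun w'' : R.K => AppRel Y z'.1 w''.1 → w'' = w') h8⟩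

end RealField

namespace RealField

variable {M : Type u} [SPOT M] {R : RealField M}

/-! ### Funnels as functions -/

/-- With `η` shrunk as in `IsEuler.box`, the continuation from `(z, w)` never leaves the region
where the funnel property applies, so that property can be restarted at every later point. The
proviso `s = z → t = w` is needed because `Y` may have other values over `z` itself; only later
times are known to be single-valued. -/
theorem IsFunnel.box {F Y : M} (hY : R.IsFunnel F Y) {x v e : R.K} (hx : 0 ≤ x) (he : 0 < e) :
    ∃ η : R.K, 0 < η ∧ ∀ z w : R.K, AppRel Y z.1 w.1 → |z - x| < η → |w - v| < η →
      (∀ s : R.K, z < s → s < x + η → ∃! t : R.K, AppRel Y s.1 t.1) ∧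
      ∀ s t s' t' : R.K, AppRel Y s.1 t.1 → AppRel Y s'.1 t'.1 → z ≤ s → (s = z → t = w) →
        s < s' → s' < x + η → |t' - t - R.val₂ F x v * (s' - s)| ≤ e * (s' - s) := by
  obtain ⟨η₁, hη₁, h⟩ := hY.2 x v e hx he
  set m := R.val₂ F x v
  have hm := abs_nonneg m
  have hden : 0 < 2 * (|m| + e) + 1 := by linarith
  set η := η₁ / (2 * (|m| + e) + 1) with hη
  have hη0 : 0 < η := by positivity
  have hηη : η * (2 * (|m| + e) + 1) = η₁ := div_mul_cancel₀ _ hden.ne'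
  have hpos : 0 ≤ (|m| + e) * η := by positivity
  have hle : η ≤ η₁ := by linarith
  refine ⟨η, hη0, fun z w hzw hzx hwv => ?_⟩
  have hstep : ∀ s, z < s → s < x + η → ∃ t : R.K, AppRel Y s.1 t.1 ∧ |s - x| < η₁ ∧
      |t - v| < η₁ ∧ |t - w - m * (s - z)| ≤ e * (s - z) ∧
      ∀ t' : R.K, AppRel Y s.1 t'.1 → t' = t := by
    intro s hzs hsx
    obtain ⟨t, ht, h1, h2⟩ := h z w s hzw (hzx.trans_le hle) (hwv.trans_le hle) hzs
      (by linarith)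
    rw [abs_lt] at hzx
    refine ⟨t, ht, ?_, ?_, h1, h2⟩
    · rw [abs_lt]; constructor <;> linarith
    · have h3 : t - v = (t - w - m * (s - z)) + m * (s - z) + (w - v) := by ring
      have h4 := abs_add_le ((t - w - m * (s - z)) + m * (s - z)) (w - v)
      have h5 := abs_add_le (t - w - m * (s - z)) (m * (s - z))
      have h6 : |m * (s - z)| = |m| * (s - z) := by rw [abs_mul, abs_of_pos (sub_pos.2 hzs)]
      have h7 : (|m| + e) * (s - z) ≤ (|m| + e) * (2 * η) :=
        mul_le_mul_of_nonneg_left (by linarith) (by linarith)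
      rw [h3]
      linarith
  refine ⟨fun s hzs hsx => ?_, fun s t s' t' hst hst' hzs hsw hss' hs'x => ?_⟩
  · obtain ⟨t, ht, -, -, -, hu⟩ := hstep s hzs hsx
    exact ⟨t, ht, hu⟩
  · rcases hzs.eq_or_lt with rfl | hlt
    · obtain rfl := hsw rfl
      obtain ⟨t₁, ht₁, -, -, h1, hu⟩ := hstep s' hss' hs'x
      rw [hu t' hst']
      exact h1
    · obtain ⟨t₁, ht₁, h1, h2, -, hu⟩ := hstep s hlt (hss'.trans hs'x)
      rw [← hu t hst] at h2
      obtain ⟨t₂, ht₂, h3, hu₂⟩ := h s t s' hst h1 h2 hss' (by linarith)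
      rw [hu₂ t' hst']
      exact h3

/-- `box` with error `1` bounds all slopes by `|F(x, v)| + 1`. -/
theorem IsFunnel.lipschitz {F Y : M} (hY : R.IsFunnel F Y) {x : R.K} (v : R.K) (hx : 0 ≤ x) :
    ∃ η C : R.K, 0 < η ∧ 0 < C ∧ ∀ z w : R.K, AppRel Y z.1 w.1 → |z - x| < η → |w - v| < η →
      (∀ s : R.K, z < s → s < x + η → ∃! t : R.K, AppRel Y s.1 t.1) ∧
      ∀ s t s' t' : R.K, AppRel Y s.1 t.1 → AppRel Y s'.1 t'.1 → z < s →
        z ≤ s' → (s' = z → t' = w) → s < x + η → s' < x + η → |t' - t| ≤ C * |s' - s| := by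
  obtain ⟨η, hη, h⟩ := hY.box (v := v) hx one_pos
  set m := R.val₂ F x v
  have hm := abs_nonneg m
  refine ⟨η, |m| + 1, hη, by linarith, fun z w hzw hzx hwv => ?_⟩
  obtain ⟨h1, h2⟩ := h z w hzw hzx hwv
  have key : ∀ s t s' t' : R.K, AppRel Y s.1 t.1 → AppRel Y s'.1 t'.1 → z ≤ s → (s = z → t = w) →
      s < s' → s' < x + η → |t' - t| ≤ (|m| + 1) * |s' - s| := by
    intro s t s' t' a1 a2 a3 a4 a5 a6
    have h3 := h2 s t s' t' a1 a2 a3 a4 a5 a6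
    have h4 : |t' - t| ≤ |t' - t - m * (s' - s)| + |m * (s' - s)| := by
      simpa using abs_add_le (t' - t - m * (s' - s)) (m * (s' - s))
    rw [abs_mul, abs_of_pos (sub_pos.2 a5)] at h4
    rw [abs_of_pos (sub_pos.2 a5)]
    linarith
  refine ⟨h1, fun s t s' t' a1 a2 a3 b1 b2 a5 a6 => ?_⟩
  rcases lt_trichotomy s s' with hlt | rfl | hlt
  · exact key s t s' t' a1 a2 a3.le (fun h => absurd h a3.ne') hlt a6
  · rw [(h1 s a3 a5).unique a1 a2]; simp
  · rw [abs_sub_comm t', abs_sub_comm s']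
    exact key s' t' s t a2 a1 b1 b2 hlt a5

theorem mem_Ico0_coe {x b : R.K} : x ∈ R.Ico0 (b : WithTop R.K) ↔ 0 ≤ x ∧ x < b := by
  simp [Ico0]

/-- Being a continuous function on `[0, a)` is a local property. -/
theorem IsContinuousFunOn.of_local {Y : M} {a : WithTop R.K}
    (h : ∀ x ∈ R.Ico0 a, ∃ b : R.K, x < b ∧ R.IsContinuousFunOn Y (R.Ico0 (b : WithTop R.K))) :
    R.IsContinuousFunOn Y (R.Ico0 a) := by
  refine ⟨fun x hx => ?_, fun x hx v hv e he => ?_⟩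
  · obtain ⟨b, hxb, hb⟩ := h x hx
    exact hb.1 x (mem_Ico0_coe.2 ⟨hx.1, hxb⟩)
  · obtain ⟨b, hxb, hb⟩ := h x hx
    obtain ⟨δ, hδ, h1⟩ := hb.2 x (mem_Ico0_coe.2 ⟨hx.1, hxb⟩) v hv e he
    refine ⟨min δ (b - x), lt_min hδ (sub_pos.2 hxb), fun x' hx' v' hv' hd => ?_⟩
    rw [lt_min_iff] at hd
    refine h1 x' (mem_Ico0_coe.2 ⟨hx'.1, ?_⟩) v' hv' hd.1
    linarith [le_abs_self (x' - x)]

theorem IsContinuousFunOn.mono {Y : M} {D D' : Set R.K} (h : R.IsContinuousFunOn Y D')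
    (hD : D ⊆ D') : R.IsContinuousFunOn Y D := by
  refine ⟨fun x hx => h.1 x (hD hx), fun x hx v hv e he => ?_⟩
  obtain ⟨δ, hδ, h1⟩ := h.2 x (hD hx) v hv e he
  exact ⟨δ, hδ, fun x' hx' => h1 x' (hD hx')⟩

theorem Ico0_mono {a b : WithTop R.K} (h : a ≤ b) : R.Ico0 a ⊆ R.Ico0 b :=
  fun _ hx => ⟨hx.1, hx.2.trans_le h⟩

theorem IsFunnel.exists_isContinuousFunOn {F Y : M} (hY : R.IsFunnel F Y) :
    ∃ b : R.K, 0 < b ∧ R.IsContinuousFunOn Y (R.Ico0 (b : WithTop R.K)) := by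
  obtain ⟨η, C, hη, hC, h⟩ := hY.lipschitz 0 le_rfl
  obtain ⟨h1, h2⟩ := h 0 0 ((hY.1 0).2 rfl) (by simpa) (by simpa)
  have hlip : ∀ s t s' t' : R.K, AppRel Y s.1 t.1 → AppRel Y s'.1 t'.1 → 0 ≤ s → 0 ≤ s' → s < η →
      s' < η → |t' - t| ≤ C * |s' - s| := by
    intro s t s' t' a1 a2 a3 a4 a5 a6
    rcases a3.eq_or_lt with rfl | hs
    · rcases a4.eq_or_lt with rfl | hs'
      · rw [(hY.1 t).1 a1, (hY.1 t').1 a2]; simp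
      · rw [abs_sub_comm t', abs_sub_comm s']
        exact h2 s' t' 0 t a2 a1 hs' le_rfl (fun _ => (hY.1 t).1 a1) (by linarith) (by linarith)
    · exact h2 s t s' t' a1 a2 hs a4 (by rintro rfl; exact (hY.1 t').1 a2) (by linarith)
        (by linarith)
  refine ⟨η, hη, fun x hx => ?_, fun x hx v hv e he => ?_⟩
  · rw [mem_Ico0_coe] at hx
    rcases hx.1.eq_or_lt with rfl | h0
    · exact ⟨0, (hY.1 0).2 rfl, fun w hw => (hY.1 w).1 hw⟩
    · exact h1 x h0 (by linarith)
  · rw [mem_Ico0_coe] at hx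
    refine ⟨e / C, div_pos he hC, fun x' hx' v' hv' hd => ?_⟩
    rw [mem_Ico0_coe] at hx'
    rw [lt_div_iff₀ hC] at hd
    have := hlip x v x' v' hv hv' hx.1 hx'.1 hx.2 hx'.2
    linarith

/-- A funnel which approaches a point is a continuous function up to and beyond this point. -/
theorem IsFunnel.extend {F Y : M} (hY : R.IsFunnel F Y) {x : R.K} (v : R.K) (hx : 0 ≤ x) :
    ∃ η : R.K, 0 < η ∧ ∀ a z w : R.K, R.IsContinuousFunOn Y (R.Ico0 (a : WithTop R.K)) → z < a →
      AppRel Y z.1 w.1 → |z - x| < η → |w - v| < η →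
      R.IsContinuousFunOn Y (R.Ico0 ((x + η : R.K) : WithTop R.K)) := by
  obtain ⟨η, C, hη, hC, h⟩ := hY.lipschitz v hx
  refine ⟨η, hη, fun a z w ha hza hzw hzx hwv => ?_⟩
  obtain ⟨h1, h2⟩ := h z w hzw hzx hwv
  refine ⟨fun s hs => ?_, fun s hs t ht e he => ?_⟩
  · rw [mem_Ico0_coe] at hs
    rcases le_or_gt s z with hsz | hzs
    · exact ha.1 s (mem_Ico0_coe.2 ⟨hs.1, hsz.trans_lt hza⟩)
    · exact h1 s hzs hs.2
  · rw [mem_Ico0_coe] at hs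
    rcases le_or_gt s z with hsz | hzs
    · obtain ⟨δ, hδ, h3⟩ := ha.2 s (mem_Ico0_coe.2 ⟨hs.1, hsz.trans_lt hza⟩) t ht e he
      refine ⟨min δ (a - s), lt_min hδ (by linarith), fun s' hs' t' ht' hd => ?_⟩
      rw [lt_min_iff] at hd
      exact h3 s' (mem_Ico0_coe.2 ⟨hs'.1, by linarith [le_abs_self (s' - s)]⟩) t' ht' hd.1
    · refine ⟨min (s - z) (e / C), lt_min (by linarith) (div_pos he hC),
        fun s' hs' t' ht' hd => ?_⟩
      rw [mem_Ico0_coe] at hs'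
      rw [lt_min_iff, lt_div_iff₀ hC] at hd
      have hzs' : z < s' := by linarith [neg_abs_le (s' - s)]
      have := h2 s t s' t' ht ht' hzs hzs'.le (fun h => absurd h hzs'.ne') hs.2 hs'.2
      linarith

/-! ### The maximal interval -/

instance instDefIsContinuousFunOn {A : Set M} [StdSub A] [Par A R.carrier] {α : Type u} [Enc M α]
    [EncRange A α] (f : α → M) (g : α → R.K) [hf : DefFun A f] [hg : DefFun A g] :
    DefPred A (no_index (fun a => R.IsContinuousFunOn (f a) (R.Ico0 (g a : WithTop R.K)))) := by
  have : DefPred A (fun p : M × R.K =>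
      R.IsContinuousFunOn p.1 (R.Ico0 (p.2 : WithTop R.K))) := by
    simp only [IsContinuousFunOn, mem_Ico0_coe]
    infer_instance
  exact this.comp (f := fun a => (f a, g a)) inferInstance

/-- `[0, a)` is the largest interval on which `Y` is a continuous function. -/
def IsMaxInterval (R : RealField M) (Y : M) (a : WithTop R.K) : Prop :=
  0 < a ∧ R.IsContinuousFunOn Y (R.Ico0 a) ∧
    ∀ b : WithTop R.K, a < b → ¬ R.IsContinuousFunOn Y (R.Ico0 b)

theorem exists_coe_btwn {c : R.K} {b : WithTop R.K} (h : (c : WithTop R.K) < b) :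
    ∃ b' : R.K, c < b' ∧ (b' : WithTop R.K) ≤ b := by
  rcases b with _ | b
  · exact ⟨c + 1, by linarith, le_top⟩
  · exact ⟨b, WithTop.coe_lt_coe.1 h, le_rfl⟩

/-- Testing maximality against finite endpoints is enough, and in that form the condition is
definable, so Transfer can be used on it. -/
theorem isMaxInterval_coe {Y : M} {c : R.K} : R.IsMaxInterval Y (c : WithTop R.K) ↔
    0 < c ∧ R.IsContinuousFunOn Y (R.Ico0 (c : WithTop R.K)) ∧
      ∀ b : R.K, c < b → ¬ R.IsContinuousFunOn Y (R.Ico0 (b : WithTop R.K)) := by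
  refine and_congr (by norm_cast) (and_congr_right fun _ => ⟨fun h b hb => h b (by exact_mod_cast hb),
    fun h b hb hb' => ?_⟩)
  obtain ⟨b', h1, h2⟩ := exists_coe_btwn hb
  exact h b' h1 (hb'.mono (Ico0_mono h2))

theorem IsMaxInterval.unique {Y : M} {a a' : WithTop R.K} (h : R.IsMaxInterval Y a)
    (h' : R.IsMaxInterval Y a') : a = a' := by
  rcases lt_trichotomy a a' with hlt | rfl | hlt
  · exact absurd h'.2.1 (h.2.2 a' hlt)
  · rfl
  · exact absurd h.2.1 (h'.2.2 a hlt)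

/-- The endpoint is the supremum of the finite endpoints that work, or `⊤` if they are unbounded.
The union of the intervals works because continuity is local. -/
theorem IsFunnel.exists_isMaxInterval {F Y : M} (hY : R.IsFunnel F Y) :
    ∃ a, R.IsMaxInterval Y a := by
  obtain ⟨b₀, hb₀, hc₀⟩ := hY.exists_isContinuousFunOn
  by_cases hbd : ∃ B : R.K, ∀ b : R.K, R.IsContinuousFunOn Y (R.Ico0 (b : WithTop R.K)) → b ≤ B
  · obtain ⟨B, hB⟩ := hbd
    obtain ⟨c, hc1, hc2⟩ := exists_lub
      (fun b : R.K => R.IsContinuousFunOn Y (R.Ico0 (b : WithTop R.K))) ⟨b₀, hc₀⟩ B hB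
    refine ⟨c, isMaxInterval_coe.2 ⟨hb₀.trans_le (hc1 b₀ hc₀), .of_local fun x hx => ?_,
      fun b hb hb' => absurd (hc1 b hb') (not_le.2 hb)⟩⟩
    rw [mem_Ico0_coe] at hx
    by_contra hcon
    push Not at hcon
    refine absurd (hc2 x fun b hb => ?_) (not_le.2 hx.2)
    by_contra hxb
    exact hcon b (not_le.1 hxb) hb
  · push Not at hbd
    refine ⟨⊤, WithTop.coe_lt_top 0, .of_local fun x hx => ?_, fun b hb => absurd hb not_top_lt⟩
    obtain ⟨b, hb, hxb⟩ := hbd x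
    exact ⟨b, hxb, hb⟩

theorem IsMaxInterval.std {Y : M} [Std Y] {c : R.K} (h : R.IsMaxInterval Y (c : WithTop R.K)) :
    Std c :=
  std_of_unique (fun c : R.K => 0 < c ∧ R.IsContinuousFunOn Y (R.Ico0 (c : WithTop R.K)) ∧
      ∀ b : R.K, c < b → ¬ R.IsContinuousFunOn Y (R.Ico0 (b : WithTop R.K)))
    (isMaxInterval_coe.1 h) fun c' h' => by
      exact WithTop.coe_injective ((isMaxInterval_coe.2 h').unique h)

/-! ### Restrictions of funnels as standard global solutions -/

/-- `y` is the restriction of `Y` to `[0, a)`. -/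
def IsRestriction (R : RealField M) (Y : M) (a : WithTop R.K) (y : M) : Prop :=
  ∀ p, p ∈ₘ y ↔ (p ∈ₘ Y ∧ ∃ x ∈ R.Ico0 a, ∃ v : R.K, IsPair p x.1 v.1)

theorem exists_isRestriction (Y : M) (a : WithTop R.K) : ∃ y, R.IsRestriction Y a y := by
  obtain ⟨y, hy⟩ := exists_sep (fun p : M => ∃ x : R.K, (0 ≤ x ∧ (x : WithTop R.K) < a) ∧
    ∃ v : R.K, IsPair p x.1 v.1) Y
  exact ⟨y, hy⟩

theorem IsRestriction.unique {Y y y' : M} {a : WithTop R.K} (h : R.IsRestriction Y a y)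
    (h' : R.IsRestriction Y a y') : y = y' :=
  SPOT.extensionality _ _ fun p => (h p).trans (h' p).symm

theorem IsRestriction.appRel_iff {Y y : M} {a : WithTop R.K} (h : R.IsRestriction Y a y)
    {x v : R.K} : AppRel y x.1 v.1 ↔ AppRel Y x.1 v.1 ∧ x ∈ R.Ico0 a := by
  obtain ⟨p, hp⟩ := exists_isPair x.1 v.1
  rw [_root_.appRel_iff hp, _root_.appRel_iff hp, h p]
  refine and_congr_right fun _ => ⟨?_, fun hx => ⟨x, hx, v, hp⟩⟩
  rintro ⟨x', hx', v', hp'⟩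
  rwa [Subtype.ext (hp.inj hp').1]

theorem IsRestriction.std {Y y : M} [Std Y] {a : WithTop R.K} (h : R.IsRestriction Y a y)
    (ha : R.IsMaxInterval Y a) : Std y := by
  have : Fact (∀ b : R.K, a = b → Par (stdSet M) b) := ⟨by rintro b rfl; exact ha.std⟩
  refine std_of_unique (fun y : M => ∀ p, p ∈ₘ y ↔ (p ∈ₘ Y ∧ ∃ x : R.K,
    (0 ≤ x ∧ (x : WithTop R.K) < a) ∧ ∃ v : R.K, IsPair p x.1 v.1)) h fun y' h' => ?_
  exact IsRestriction.unique h' h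

/-- To the right of `x`, the box estimate run from `(x, v)` gives the derivative. To the left, it is
run from `(z, w)` forward to `(x, v)`; continuity of `Y` at `x` ensures that `(z, w)` is close
enough to `(x, v)` for this. -/
theorem IsFunnel.isSolution {F Y y : M} (hF : R.IsContinuousRHS F) (hY : R.IsFunnel F Y)
    {a : WithTop R.K} (ha : 0 < a) (hc : R.IsContinuousFunOn Y (R.Ico0 a))
    (hy : R.IsRestriction Y a y) : R.IsSolution F a y := by
  refine ⟨⟨fun p hp => ?_, fun x hx => ?_⟩, hy.appRel_iff.2 ⟨(hY.1 0).2 rfl, le_rfl, ha⟩,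
    fun x hx v d hv hd e he => ?_⟩
  · exact ((hy p).1 hp).2
  · obtain ⟨v, hv, hu⟩ := hc.1 x hx
    exact ⟨v, hy.appRel_iff.2 ⟨hv, hx⟩, fun w hw => hu w (hy.appRel_iff.1 hw).1⟩
  · rw [hF.appRel₂_iff hx.1] at hd
    subst hd
    replace hv := (hy.appRel_iff.1 hv).1
    obtain ⟨η, hη, h⟩ := hY.box (v := v) hx.1 he
    obtain ⟨δ, hδ, hcont⟩ := hc.2 x hx v hv η hη
    refine ⟨min δ η, lt_min hδ hη, fun z hz w hw hd => ?_⟩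
    rw [lt_min_iff] at hd
    replace hw := (hy.appRel_iff.1 hw).1
    rcases lt_trichotomy z x with hlt | rfl | hlt
    · have h1 := (h z w hw hd.2 (hcont z hz w hw hd.1)).2 z w x v hw hv le_rfl (fun _ => rfl) hlt
        (by linarith)
      rw [abs_sub_comm z x, abs_of_pos (sub_pos.2 hlt), ← abs_neg]
      convert! h1 using 2
      ring
    · rw [(hc.1 z hz).unique hw hv]
      simp
    · have h1 := (h x v hv (by simpa) (by simpa)).2 x v z w hv hw le_rfl (fun _ => rfl) hlt
        (by linarith [le_abs_self (z - x)])
      rwa [abs_of_pos (sub_pos.2 hlt)]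

theorem IsSolution.continuous {F y : M} {a : WithTop R.K} (hF : R.IsContinuousRHS F)
    (h : R.IsSolution F a y) {x : R.K} (hx : x ∈ R.Ico0 a) {e : R.K} (he : 0 < e) :
    ∃ δ : R.K, 0 < δ ∧ ∀ z ∈ R.Ico0 a, |z - x| < δ → |R.val y z - R.val y x| < e := by
  set d := R.val₂ F x (R.val y x)
  obtain ⟨δ, hδ, h1⟩ := h.2.2 x hx _ d ((h.1.appRel_iff hx).2 rfl) ((hF.appRel₂_iff hx.1).2 rfl) 1
    one_pos
  have hd0 := abs_nonneg d
  refine ⟨min δ (e / (|d| + 1)), lt_min hδ (by positivity), fun z hz hd => ?_⟩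
  rw [lt_min_iff, lt_div_iff₀ (by linarith)] at hd
  have h2 := h1 z hz _ ((h.1.appRel_iff hz).2 rfl) hd.1
  have h3 : |R.val y z - R.val y x| ≤ |R.val y z - R.val y x - d * (z - x)| + |d * (z - x)| := by
    simpa using abs_add_le (R.val y z - R.val y x - d * (z - x)) (d * (z - x))
  rw [abs_mul] at h3
  linarith

/-- A solution `z` continuing `y` past a finite end `c` is continuous at `c`, so `Y` contains points
`(t, z(t))` with `t < c` arbitrarily close to `(c, z(c))`. Then `IsFunnel.extend` makes `Y` a
continuous function up to `c + η`, against maximality. -/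
theorem IsFunnel.isGlobalSolution {F Y y : M} (hF : R.IsContinuousRHS F) (hY : R.IsFunnel F Y)
    {a : WithTop R.K} (ha : R.IsMaxInterval Y a) (hy : R.IsRestriction Y a y) :
    R.IsGlobalSolution F y := by
  refine ⟨a, ha.1, hY.isSolution hF ha.1 ha.2.1 hy, fun a' haa' z hz hyz => ?_⟩
  rcases a with _ | c
  · exact not_top_lt haa'
  obtain ⟨hc0, hcont, hmax⟩ := isMaxInterval_coe.1 ha
  have hcz : c ∈ R.Ico0 a' := ⟨hc0.le, haa'⟩
  obtain ⟨η, hη, h⟩ := hY.extend (R.val z c) hc0.le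
  obtain ⟨δ, hδ, h1⟩ := hz.continuous hF hcz hη
  have hm : 0 < min (min δ η) c := lt_min (lt_min hδ hη) hc0
  -- The three minima keep `t` within `δ` and `η` of `c` and nonnegative.
  set t := c - min (min δ η) c / 2 with ht
  have htc : t < c := by linarith
  have ht0 : 0 ≤ t := by linarith [min_le_right (min δ η) c]
  have htd : |t - c| = min (min δ η) c / 2 := by
    rw [abs_sub_comm, abs_of_pos (by linarith)]; linarith
  have hle := min_le_left (min δ η) c
  have htY : t ∈ R.Ico0 (c : WithTop R.K) := mem_Ico0_coe.2 ⟨ht0, htc⟩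
  have htz : t ∈ R.Ico0 a' := Ico0_mono haa'.le htY
  obtain ⟨w, hw, -⟩ := hcont.1 t htY
  have hwz : R.val z t = w := by
    rw [← hz.1.appRel_iff htz]
    obtain ⟨p, hp, hpy⟩ := hy.appRel_iff.2 ⟨hw, htY⟩
    exact ⟨p, hp, hyz p hpy⟩
  refine hmax (c + η) (by linarith) (h c t w hcont htc hw ?_ ?_)
  · linarith [min_le_right δ η]
  · rw [← hwz]
    exact h1 t htz (by linarith [min_le_left δ η])

end RealField

namespace RealField

variable {M : Type u} [SPOT M] {R : RealField M}

/-! ### Standard solutions -/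

/-- The mean value inequality for solutions. -/
theorem IsSolution.mean_value {F y : M} {a : WithTop R.K} (hF : R.IsContinuousRHS F)
    (h : R.IsSolution F a y) {p q m e : R.K} (hp : 0 ≤ p) (hpq : p ≤ q) (hq : (q : WithTop R.K) < a)
    (he : 0 < e) (hm : ∀ s, p ≤ s → s ≤ q → |R.val₂ F s (R.val y s) - m| ≤ e) :
    |R.val y q - R.val y p - m * (q - p)| ≤ 2 * e * (q - p) := by
  have hmem : ∀ s, p ≤ s → s ≤ q → s ∈ R.Ico0 a := fun s h1 h2 =>
    ⟨hp.trans h1, (WithTop.coe_le_coe.2 h2).trans_lt hq⟩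
  have hloc : ∀ s, p ≤ s → s ≤ q → ∃ δ, 0 < δ ∧ ∀ z, p ≤ z → z ≤ q → |z - s| < δ →
      |R.val y z - R.val y s - m * (z - s)| ≤ 2 * e * |z - s| := by
    intro s h1 h2
    have hs := hmem s h1 h2
    obtain ⟨δ, hδ, h3⟩ := h.2.2 s hs _ _ ((h.1.appRel_iff hs).2 rfl)
      ((hF.appRel₂_iff hs.1).2 rfl) e he
    refine ⟨δ, hδ, fun z hz1 hz2 hd => ?_⟩
    have h4 := h3 z (hmem z hz1 hz2) _ ((h.1.appRel_iff (hmem z hz1 hz2)).2 rfl) hd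
    have h5 := hm s h1 h2
    have h6 : R.val y z - R.val y s - m * (z - s) = (R.val y z - R.val y s -
      R.val₂ F s (R.val y s) * (z - s)) + (R.val₂ F s (R.val y s) - m) * (z - s) := by ring
    rw [h6]
    refine (abs_add_le _ _).trans ?_
    rw [abs_mul (R.val₂ F s (R.val y s) - m)]
    have := mul_le_mul_of_nonneg_right h5 (abs_nonneg (z - s))
    linarith
  -- Continuous induction: the estimate holds at the supremum `c` of the points where it holds, and
  -- if `c < q` the local estimate carries it beyond `c`.
  obtain ⟨c, hc1, hc2⟩ := exists_lub (fun s : R.K => p ≤ s ∧ s ≤ q ∧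
    |R.val y s - R.val y p - m * (s - p)| ≤ 2 * e * (s - p)) ⟨p, le_rfl, hpq, by simp⟩ q
    (fun s hs => hs.2.1)
  have hpc : p ≤ c := hc1 p ⟨le_rfl, hpq, by simp⟩
  have hcq : c ≤ q := hc2 q fun s hs => hs.2.1
  have hadd : ∀ s t, |R.val y s - R.val y p - m * (s - p)| ≤ 2 * e * (s - p) →
      |R.val y t - R.val y s - m * (t - s)| ≤ 2 * e * (t - s) →
      |R.val y t - R.val y p - m * (t - p)| ≤ 2 * e * (t - p) := by
    intro s t h1 h2
    have h3 := abs_add_le (R.val y s - R.val y p - m * (s - p))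
      (R.val y t - R.val y s - m * (t - s))
    have h4 : (R.val y s - R.val y p - m * (s - p)) + (R.val y t - R.val y s - m * (t - s)) =
      R.val y t - R.val y p - m * (t - p) := by ring
    rw [h4] at h3
    linarith
  obtain ⟨δ, hδ, hd⟩ := hloc c hpc hcq
  have hcS : |R.val y c - R.val y p - m * (c - p)| ≤ 2 * e * (c - p) := by
    have : ∃ s, (p ≤ s ∧ s ≤ q ∧ |R.val y s - R.val y p - m * (s - p)| ≤ 2 * e * (s - p)) ∧
        c - δ < s := by
      by_contra hcon
      push Not at hcon
      linarith [hc2 (c - δ) hcon]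
    obtain ⟨s, hs, hcs⟩ := this
    have hsc := hc1 s hs
    refine hadd s c hs.2.2 ?_
    have h1 := hd s hs.1 hs.2.1 (by rw [abs_lt]; constructor <;> linarith)
    rw [abs_sub_comm s c, abs_of_nonneg (sub_nonneg.2 hsc), ← abs_neg] at h1
    convert! h1 using 2
    ring
  rcases hcq.eq_or_lt with rfl | hlt
  · exact hcS
  · exfalso
    set s := min q (c + δ / 2) with hs
    have hcs : c < s := lt_min hlt (by linarith)
    have hsd : s ≤ c + δ / 2 := min_le_right _ _
    have hsq : s ≤ q := min_le_left _ _
    have h1 := hd s (hpc.trans hcs.le) hsq (by rw [abs_lt]; constructor <;> linarith)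
    rw [abs_of_pos (sub_pos.2 hcs)] at h1
    linarith [hc1 s ⟨hpc.trans hcs.le, hsq, hadd c s hcS h1⟩]

/-- The endpoint is determined by the domain of the standard function `y`. -/
theorem IsFunOn.std_end {y : M} [Std y] {c : R.K} (hc : 0 < c)
    (hy : R.IsFunOn y (R.Ico0 (c : WithTop R.K))) : Std c := by
  refine std_of_unique (fun c : R.K => 0 < c ∧ ∀ x : R.K, (∃ v : R.K, AppRel y x.1 v.1) ↔
    (0 ≤ x ∧ x < c)) ⟨hc, fun x => ⟨?_, fun hx => ?_⟩⟩ ?_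
  · rintro ⟨v, hv⟩
    exact mem_Ico0_coe.1 (hy.mem_of_appRel hv)
  · exact (hy.2 x (mem_Ico0_coe.2 hx)).exists
  · rintro c' ⟨hc', h⟩
    have h' : ∀ x : R.K, (0 ≤ x ∧ x < c) ↔ (0 ≤ x ∧ x < c') := fun x => by
      rw [← h]
      exact ⟨fun hx => (hy.2 x (mem_Ico0_coe.2 hx)).exists,
        fun ⟨v, hv⟩ => mem_Ico0_coe.1 (hy.mem_of_appRel hv)⟩
    refine le_antisymm (not_lt.1 fun hlt => ?_) (not_lt.1 fun hlt => ?_)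
    · exact lt_irrefl _ ((h' c).2 ⟨hc.le, hlt⟩).2
    · exact lt_irrefl _ ((h' c').1 ⟨hc'.le, hlt⟩).2

theorem IsSolution.fact_std {F y : M} {a : WithTop R.K} [Std y] (ha : 0 < a)
    (h : R.IsSolution F a y) : Fact (∀ b : R.K, a = b → Par (stdSet M) b) :=
  ⟨by rintro b rfl; exact h.1.std_end (by exact_mod_cast ha)⟩

/-- A standard endpoint lies at a noninfinitesimal distance above the standard `x`, so an
infinitesimal move cannot reach it. -/
theorem below_of_near {a : WithTop R.K} [h : Fact (∀ b : R.K, a = b → Par (stdSet M) b)]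
    {x x' : R.K} [Std x] (hx : (x : WithTop R.K) < a) (hn : R.Near x' x) :
    (x' : WithTop R.K) < a := by
  rcases a with _ | b
  · exact WithTop.coe_lt_top _
  · have : Std b := h.out b rfl
    exact WithTop.coe_lt_coe.2 (Near.lt hn (Near.refl b) (WithTop.coe_lt_coe.1 hx))

theorem IsSolution.std_continuous {F y : M} {a : WithTop R.K} [Std y] (hF : R.IsContinuousRHS F)
    [Fact (∀ b : R.K, a = b → Par (stdSet M) b)] (h : R.IsSolution F a y) {x e : R.K} [Std x]
    [Std e] (hx : x ∈ R.Ico0 a) (he : 0 < e) :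
    ∃ δ : R.K, Std δ ∧ 0 < δ ∧ ∀ z : R.K, (0 ≤ z ∧ (z : WithTop R.K) < a) → |z - x| < δ →
      |R.val y z - R.val y x| < e :=
  exists_std (P := fun δ : R.K => 0 < δ ∧ ∀ z : R.K, (0 ≤ z ∧ (z : WithTop R.K) < a) →
    |z - x| < δ → |R.val y z - R.val y x| < e) (h.continuous hF hx he)

theorem IsSolution.near {F y : M} {a : WithTop R.K} [Std y] (hF : R.IsContinuousRHS F)
    [Fact (∀ b : R.K, a = b → Par (stdSet M) b)] (h : R.IsSolution F a y) {x x' : R.K} [Std x]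
    (hx : x ∈ R.Ico0 a) (hx' : 0 ≤ x') (hn : R.Near x' x) : R.Near (R.val y x') (R.val y x) := by
  refine near_iff.2 fun e he he0 => ?_
  obtain ⟨δ, hδ, hδ0, h1⟩ := h.std_continuous hF hx he0
  exact h1 x' ⟨hx', below_of_near hx.2 hn⟩ (near_iff.1 hn δ hδ hδ0)

/-! ### Euler sequences that follow a given standard solution -/

/-- Difference quotients of a standard solution along an infinitesimal mesh agree with the values
of `F` up to standard errors. -/
theorem IsSolution.quotient_bound {F y : M} {a : WithTop R.K} [Std y] [Std F]
    (hF : R.IsContinuousRHS F) [hfact : Fact (∀ b : R.K, a = b → Par (stdSet M) b)]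
    (h : R.IsSolution F a y) {N : R.K} (hN : 0 < N) (hN' : ¬ R.Limited N) {c : R.K}
    (hc : R.Near c 0) {e : R.K} [Std e] (he : 0 < e) {x : R.K} (hx : 0 ≤ x)
    (hxe : x + 1 / N ≤ 1 / e) (hxa : ((x + 1 / N + e : R.K) : WithTop R.K) < a) :
    |(R.val y (x + 1 / N) - R.val y x) * N - R.val₂ F x (R.val y x + c)| ≤ e := by
  have hh : 0 < 1 / N := one_div_pos.2 hN
  have hh0 := near_one_div hN hN'
  -- The cutoffs make `x` limited and keep its standard part `r` at least `e` below a finite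
  -- endpoint, so `y` and `F` may be estimated near the standard point `(r, y(r))`.
  obtain ⟨r, hr, hxr⟩ := (limited_iff.2 ⟨1 / e, inferInstance, by
    rw [abs_of_nonneg hx]; linarith⟩ : R.Limited x).exists_near
  have hr0 : 0 ≤ r := Near.le (Near.refl 0) hxr hx
  have hra : (r : WithTop R.K) < a := by
    rcases a with _ | b
    · exact WithTop.coe_lt_top _
    · have : Std b := hfact.out b rfl
      have h1 := WithTop.coe_lt_coe.1 hxa
      have h2 : r + e ≤ b := Near.le (hxr.add (Near.refl e)) (Near.refl b) (by linarith)
      exact WithTop.coe_lt_coe.2 (by linarith)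
  set m := R.val₂ F r (R.val y r) with hm
  obtain ⟨δ₁, hδ₁s, hδ₁, h1⟩ := hF.std_continuous (x := r) (y := R.val y r) (e := e / 4) hr0
    (by linarith)
  obtain ⟨δ₂, hδ₂s, hδ₂, h2⟩ := h.std_continuous hF (e := δ₁ / 2) ⟨hr0, hra⟩ (by linarith)
  have hxd : ∀ d, Std d → 0 < d → ∀ s, x ≤ s → s ≤ x + 1 / N → |s - r| < d := by
    intro d hd hd0 s hs1 hs2
    have g1 := near_iff.1 hxr d hd hd0
    have h3 : R.Near (x + 1 / N) r := by simpa using hxr.add hh0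
    have g2 := near_iff.1 h3 d hd hd0
    rw [abs_lt] at g1 g2 ⊢
    constructor <;> linarith
  have hmem : ∀ s, s ≤ x + 1 / N → (s : WithTop R.K) < a := fun s hs =>
    (WithTop.coe_le_coe.2 (by linarith)).trans_lt hxa
  have hyd : ∀ s, x ≤ s → s ≤ x + 1 / N → |R.val y s - R.val y r| < δ₁ / 2 := fun s hs1 hs2 =>
    h2 s ⟨hx.trans hs1, hmem s hs2⟩ (hxd δ₂ hδ₂s hδ₂ s hs1 hs2)
  have h3 := h.mean_value hF (m := m) (e := e / 4) hx (show x ≤ x + 1 / N by linarith)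
    (hmem _ le_rfl) (by linarith) fun s hs1 hs2 => (h1 s _ (hx.trans hs1)
      (hxd δ₁ hδ₁s hδ₁ s hs1 hs2) ((hyd s hs1 hs2).trans (by linarith))).le
  have h4 := h1 x (R.val y x + c) hx (hxd δ₁ hδ₁s hδ₁ x le_rfl (by linarith)) (by
    have g1 := hyd x le_rfl (by linarith)
    have g2 := near_iff.1 hc (δ₁ / 2) inferInstance (by linarith)
    rw [sub_zero] at g2
    have g3 : R.val y x + c - R.val y r = (R.val y x - R.val y r) + c := by ring
    rw [g3]
    exact (abs_add_le _ _).trans_lt (by linarith))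
  -- Both terms are compared with `m`: the mean value inequality with `e / 4` costs `e / 2`, and
  -- continuity of `F` costs another `e / 4`.
  have h5 : (R.val y (x + 1 / N) - R.val y x) * N - R.val₂ F x (R.val y x + c) =
    (R.val y (x + 1 / N) - R.val y x - m * (x + 1 / N - x)) * N -
      (R.val₂ F x (R.val y x + c) - m) := by
    field_simp
    ring
  rw [h5]
  refine (abs_sub _ _).trans ?_
  rw [abs_mul, abs_of_pos hN]
  have h6 := mul_le_mul_of_nonneg_right h3 hN.le
  have h7 : 2 * (e / 4) * (x + 1 / N - x) * N = e / 2 := by field_simp; ring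
  rw [h7] at h6
  linarith

/-- A standard solution is infinitely close to an Euler sequence with infinitesimal
perturbation. -/
theorem IsSolution.exists_euler {F y : M} {a : WithTop R.K} [Std y] [Std F]
    (hF : R.IsContinuousRHS F) [hfact : Fact (∀ b : R.K, a = b → Par (stdSet M) b)]
    (ha : 0 < a) (h : R.IsSolution F a y) {N x₀ y₀ : R.K} (hNnat : R.IsNat N) (hN : 0 < N)
    (hN' : ¬ R.Limited N) (hx₀ : 0 ≤ x₀) (hx₀' : R.Near x₀ 0) (hy₀ : R.Near y₀ 0) :
    ∃ ep u : M, R.IsPerturbation N ep ∧ R.IsEuler F N x₀ y₀ ep u ∧ ∀ x : R.K, Std x →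
      x ∈ R.Ico0 a → ∀ k : R.K, R.IsNat k → k < N ^ 2 → R.Near x (x₀ + k * (1 / N)) →
      R.Near (R.val u k) (R.val y x) := by
  classical
  have hh : 0 < 1 / N := one_div_pos.2 hN
  have h0a : (0 : R.K) ∈ R.Ico0 a := ⟨le_rfl, ha⟩
  have hy0 : R.val y 0 = 0 := (h.1.appRel_iff h0a).1 h.2.1
  -- This is the initial offset; the Euler sequence will be `y` shifted by the constant `c`.
  set c := y₀ - R.val y x₀ with hc
  have hc0 : R.Near c 0 := by
    have := hy₀.sub (h.near hF h0a hx₀ hx₀')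
    rwa [hy0, sub_zero] at this
  -- Enlarging `e` weakens the bound and shrinks its range, so the property is monotone, and
  -- overspill provides an infinitesimal `t`.
  obtain ⟨t, ht, ht0, hbd⟩ := exists_infinitesimal hh (near_one_div hN hN')
    (fun e : R.K => ∀ i : R.K, R.IsNat i → x₀ + i * ((1 : R.K) / N) + (1 : R.K) / N ≤
      (1 : R.K) / e →
      ((x₀ + i * ((1 : R.K) / N) + (1 : R.K) / N + e : R.K) : WithTop R.K) < a →
      |(R.val y (x₀ + i * ((1 : R.K) / N) + (1 : R.K) / N) - R.val y (x₀ + i * ((1 : R.K) / N))) *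
          N -
        R.val₂ F (x₀ + i * ((1 : R.K) / N)) (R.val y (x₀ + i * ((1 : R.K) / N)) + c)| ≤ e)
    (by
      intro e e' he hP hee' i hi h1 h2
      exact (hP i hi (h1.trans (one_div_le_one_div_of_le he hee'))
        ((WithTop.coe_le_coe.2 (by linarith)).trans_lt h2)).trans hee')
    (fun e he he0 i hi h1 h2 =>
      h.quotient_bound hF hN hN' hc0 he0 (hi.mesh_nonneg hN hx₀) h1 h2)
  -- The perturbation is the defect of the shifted solution in the Euler recursion, cut off to `0`
  -- where the bound by `t` is not guaranteed.
  obtain ⟨ep, hep, hepv⟩ := exists_fun (R := R) (fun k => R.IsNat k ∧ k < N ^ 2) (fun k =>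
    if x₀ + k * ((1 : R.K) / N) + (1 : R.K) / N ≤ (1 : R.K) / t ∧
      ((x₀ + k * ((1 : R.K) / N) + (1 : R.K) / N + t : R.K) : WithTop R.K) < a then
      (R.val y (x₀ + k * ((1 : R.K) / N) + (1 : R.K) / N) - R.val y (x₀ + k * ((1 : R.K) / N))) *
          N -
        R.val₂ F (x₀ + k * ((1 : R.K) / N)) (R.val y (x₀ + k * ((1 : R.K) / N)) + c) else 0)
  have hpert : R.IsPerturbation N ep := by
    refine ⟨hep, fun k e hke => ?_⟩
    have hk := hep.mem_of_appRel hke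
    rw [hep.appRel_iff hk, hepv k hk] at hke
    subst hke
    split_ifs with hQ
    · refine ht0.of_abs_le ?_
      rw [sub_zero, sub_zero, abs_of_pos ht]
      exact hbd k hk.1 hQ.1 hQ.2
    · exact Near.refl 0
  obtain ⟨u, hu⟩ := exists_isEuler (y₀ := y₀) hF hNnat hN hx₀ hpert
  obtain ⟨-, hu0, hus⟩ := (isEuler_iff hF hNnat hN hx₀ hpert).1 hu
  have key : ∀ k, R.IsNat k → k ≤ N ^ 2 → x₀ + k * ((1 : R.K) / N) ≤ (1 : R.K) / t →
      ((x₀ + k * ((1 : R.K) / N) + t : R.K) : WithTop R.K) < a →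
      R.val u k = R.val y (x₀ + k * ((1 : R.K) / N)) + c := by
    intro k hk
    refine IsNat.induction (P := fun k => k ≤ N ^ 2 → x₀ + k * ((1 : R.K) / N) ≤ (1 : R.K) / t →
      ((x₀ + k * ((1 : R.K) / N) + t : R.K) : WithTop R.K) < a →
      R.val u k = R.val y (x₀ + k * ((1 : R.K) / N)) + c) ?_ ?_ hk
    · intro _ _ _
      rw [hu0, zero_mul, add_zero, hc]
      ring
    · intro k hk ih h1 h2 h3
      have hkN : k < N ^ 2 := by linarith
      have hsucc : x₀ + (k + 1) * (1 / N) = x₀ + k * (1 / N) + 1 / N := by ring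
      rw [hsucc] at h2 h3 ⊢
      have ih' := ih hkN.le (by linarith) ((WithTop.coe_le_coe.2 (by linarith)).trans_lt h3)
      rw [hus k hk hkN, hepv k ⟨hk, hkN⟩, if_pos ⟨h2, h3⟩, ih']
      field_simp
      ring
  refine ⟨ep, u, hpert, hu, fun x hx hxa k hk hkN hxk => ?_⟩
  have hx1 : 0 < x + 1 := by linarith [hxa.1]
  -- Since `t` is infinitesimal, `1 / t` exceeds every standard number, so mesh points close to a
  -- standard `x` satisfy the cutoff.
  have hkt : x₀ + k * (1 / N) ≤ 1 / t := by
    have h1 := near_iff.1 hxk.symm 1 inferInstance one_pos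
    have h2 := near_iff.1 ht0 (1 / (x + 1)) inferInstance (one_div_pos.2 hx1)
    rw [sub_zero, abs_of_pos ht] at h2
    have h3 := one_div_lt_one_div_of_lt ht h2
    rw [one_div_one_div] at h3
    linarith [le_abs_self (x₀ + k * (1 / N) - x)]
  have hka : ((x₀ + k * (1 / N) + t : R.K) : WithTop R.K) < a :=
    below_of_near hxa.2 (by simpa using hxk.symm.add ht0)
  rw [key k hk hkN.le hkt hka]
  simpa using (h.near hF hxa (hk.mesh_nonneg hN hx₀) hxk.symm).add hc0

/-- The shadow of the sequence from `exists_euler` agrees with `y` at standard points of the domain,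
hence by Transfer on all of it. What remains is maximality of this interval for `Y`. -/
theorem IsGlobalSolution.exists_isPerturbedSolution {F y : M} [Std y] [Std F]
    (hF : R.IsContinuousRHS F) (h : R.IsGlobalSolution F y) {N x₀ y₀ : R.K} (hNnat : R.IsNat N)
    (hN : 0 < N) (hN' : ¬ R.Limited N) (hx₀ : 0 ≤ x₀) (hx₀' : R.Near x₀ 0) (hy₀ : R.Near y₀ 0) :
    ∃ ep : M, R.IsPerturbation N ep ∧ R.IsPerturbedSolution F N x₀ y₀ ep y := by
  obtain ⟨a, ha, hs, hglob⟩ := h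
  have hfact := hs.fact_std ha
  obtain ⟨ep, u, hep, hu, hnear⟩ := hs.exists_euler hF ha hNnat hN hN' hx₀ hx₀' hy₀
  obtain ⟨Y, hY⟩ := exists_isShadow (x₀ := x₀) (u := u) hN hN'
  have hYs : Std Y := std_iff.2 hY.1
  have hfun := hY.isFunnel hF hNnat hN hN' hx₀ hep hx₀' hy₀ hu
  have hstd : ∀ p : R.K × R.K, Std p → (0 ≤ p.1 ∧ (p.1 : WithTop R.K) < a) →
      (AppRel Y p.1.1 p.2.1 ↔ R.val y p.1 = p.2) := by
    rintro ⟨x, v⟩ hp hx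
    obtain ⟨hxs, hvs⟩ := std_prod_iff.1 hp
    dsimp only at hx ⊢
    rw [hY.appRel_iff hF hNnat hN hx₀ hep hu hx.1]
    constructor
    · rintro ⟨k, hk, hkN, h1, h2⟩
      exact (h2.trans (hnear x hxs hx k hk hkN h1)).eq.symm
    · rintro rfl
      obtain ⟨k, hk, hkN, h1⟩ := exists_mesh_near hN hN' hx₀' hx.1
      exact ⟨k, hk, hkN, h1, (hnear x hxs hx k hk hkN h1).symm⟩
  have hval : ∀ x ∈ R.Ico0 a, ∀ v : R.K, AppRel Y x.1 v.1 ↔ R.val y x = v := fun x hx v =>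
    transfer (M := M) (P := fun p : R.K × R.K => (0 ≤ p.1 ∧ (p.1 : WithTop R.K) < a) →
      (AppRel Y p.1.1 p.2.1 ↔ R.val y p.1 = p.2)) hstd (x, v) hx
  have hyY : ∀ x ∈ R.Ico0 a, ∀ p, ∀ v : R.K, IsPair p x.1 v.1 → (p ∈ₘ y ↔ p ∈ₘ Y) :=
    fun x hx p v hp => by
      rw [← _root_.appRel_iff hp, ← _root_.appRel_iff hp, hval x hx, hs.1.appRel_iff hx]
  refine ⟨ep, hep, u, Y, hu, hY, a, ha, ⟨fun x hx => ?_, fun x hx v hv e he => ?_⟩,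
    fun b hab hb => ?_, fun p => ⟨fun hp => ?_, ?_⟩⟩
  · exact ⟨R.val y x, (hval x hx _).2 rfl, fun v hv => ((hval x hx v).1 hv).symm⟩
  · obtain ⟨δ, hδ, h1⟩ := hs.continuous hF hx he
    refine ⟨δ, hδ, fun x' hx' v' hv' hd => ?_⟩
    rw [← (hval x hx v).1 hv, ← (hval x' hx' v').1 hv']
    exact h1 x' hx' hd
  -- On a larger interval of continuity the funnel `Y` would restrict to a solution that properly
  -- continues `y`, which globality excludes.
  · obtain ⟨z, hz⟩ := exists_isRestriction (R := R) Y b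
    refine hglob b hab z (hfun.isSolution hF (ha.trans hab) hb hz) fun p hp => ?_
    obtain ⟨x, hx, v, hpair⟩ := hs.1.1 p hp
    exact (hz p).2 ⟨(hyY x hx p v hpair).1 hp, x, Ico0_mono hab.le hx, v, hpair⟩
  · obtain ⟨x, hx, v, hpair⟩ := hs.1.1 p hp
    exact ⟨(hyY x hx p v hpair).1 hp, x, hx, v, hpair⟩
  · rintro ⟨hp, x, hx, v, hpair⟩
    exact (hyY x hx p v hpair).2 hp

end RealField

/-! ### The correspondence between perturbations and standard global solutions -/

theorem theorem5p3 {M : Type u} [SPOT M] (R : RealField M) (F : M)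
    (hFst : St F) (hF : R.IsContinuousRHS F)
    (N x₀ y₀ : R.K) (hN : R.IsNat N) (hNpos : 0 < N) (hNunlim : ¬ R.Limited N)
    (hx₀ : 0 ≤ x₀) (hx₀near : R.Near x₀ 0) (hy₀near : R.Near y₀ 0) :
    (∀ y : M, St y → R.IsGlobalSolution F y →
      ∃ ep : M, R.IsPerturbation N ep ∧ R.IsPerturbedSolution F N x₀ y₀ ep y) ∧
    (∀ ep : M, R.IsPerturbation N ep →
      ∃! y : M, R.IsPerturbedSolution F N x₀ y₀ ep y) ∧
    (∀ ep y : M, R.IsPerturbation N ep → R.IsPerturbedSolution F N x₀ y₀ ep y →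
      St y ∧ R.IsGlobalSolution F y) := by
  have hFs : Std F := std_iff.2 hFst
  refine ⟨fun y hy hglob => ?_, fun ep hep => ?_, fun ep y hep hy => ?_⟩
  · have hys : Std y := std_iff.2 hy
    exact hglob.exists_isPerturbedSolution hF hN hNpos hNunlim hx₀ hx₀near hy₀near
  · obtain ⟨u, hu⟩ := RealField.exists_isEuler (y₀ := y₀) hF hN hNpos hx₀ hep
    obtain ⟨Y, hY⟩ := RealField.exists_isShadow (x₀ := x₀) (u := u) hNpos hNunlim
    have hfun := hY.isFunnel hF hN hNpos hNunlim hx₀ hep hx₀near hy₀near hu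
    obtain ⟨a, ha⟩ := hfun.exists_isMaxInterval
    obtain ⟨y, hy⟩ := RealField.exists_isRestriction Y a
    refine ⟨y, ⟨u, Y, hu, hY, a, ha.1, ha.2.1, ha.2.2, hy⟩, ?_⟩
    rintro y' ⟨u', Y', hu', hY', a', h1, h2, h3, hy'⟩
    -- The Euler sequence, its shadow, the maximal interval and the restriction are each uniquely
    -- determined, in this order.
    obtain rfl := hu.unique hF hN hNpos hx₀ hep hu'
    obtain rfl := hY.unique hY'
    obtain rfl := ha.unique ⟨h1, h2, h3⟩
    exact RealField.IsRestriction.unique hy' hy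
  · obtain ⟨u, Y, hu, hY, a, h1, h2, h3, hya⟩ := hy
    have hYs : Std Y := std_iff.2 hY.1
    have ha : R.IsMaxInterval Y a := ⟨h1, h2, h3⟩
    have hfun := hY.isFunnel hF hN hNpos hNunlim hx₀ hep hx₀near hy₀near hu
    exact ⟨std_iff.1 (RealField.IsRestriction.std hya ha), hfun.isGlobalSolution hF ha hya⟩
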